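/- Let $n\ge 1$ be an integer and let $(\mathcal C,\mathbb E,\mathfrak s)$ be an $n$-exangulated category in the sense of Herschend–Liu–Nakaoka: $\mathcal C$ is an additive category, $\mathbb E\colon\mathcal C^{\mathrm{op}}\times\mathcal C\to\mathsf{Ab}$ is a biadditive functor, and $\mathfrak s$ is an exact realisation of $\mathbb E$ satisfying the axioms (EA1), (EA2) and (EA2)$^{\mathrm{op}}$. Here $\mathfrak s$ assigns to each $\delta\in\mathbb E(C,A)$ the class $\mathfrak s(\delta)=[X_\bullet]$ of a complex $A=X_0\to X_1\to\cdots\to X_n\to X_{n+1}=C$, up to homotopy equivalence by morphisms of complexes that are the identity on $A$ and on $C$. For morphisms $a\colon A\to B$ and $c\colon D\to C$ write $a_{\mathbb E}\delta=\mathbb E(C,a)(\delta)$ and $c^{\mathbb E}\delta=\mathbb E(c,A)(\delta)$. Let $\widetilde{\mathcal C}$ be the idempotent completion (Karoubi envelope) of $\mathcal C$: its objects are the pairs $(X,e)$ with $e\colon X\to X$ idempotent in $\mathcal C$, and its morphisms $(X,e)\to(Y,e')$ are the morphisms $r\colon X\to Y$ of $\mathcal C$ with $re=r=e'r$. Let $\mathbb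 F\colon\widetilde{\mathcal C}^{\mathrm{op}}\times\widetilde{\mathcal C}\to\mathsf{Ab}$ be the functor with $$\mathbb F\big((Z,e'),(X,e)\big)=\{\delta\in\mathbb E(Z,X)\;:\;e_{\mathbb E}\delta=\delta=e'^{\,\mathbb E}\delta\},$$ on which morphisms act through $\mathbb E$. For $\tilde\delta\in\mathbb F((X_{n+1},e_{n+1}),(X_0,e_0))$ with underlying $\mathbb E$-extension $\delta$, put $\mathfrak t(\tilde\delta)=[(X_\bullet,e_\bullet)]$, where $\mathfrak s(\delta)=[X_\bullet]$, where $e_\bullet\colon X_\bullet\to X_\bullet$ is an idempotent morphism of complexes that is $e_0$ in degree $0$ and $e_{n+1}$ in degree $n+1$, and where $(X_\bullet,e_\bullet)$ is the complex in $\widetilde{\mathcal C}$ with objects $(X_i,e_i)$ and differentials $e_{i+1}d_i^Xe_i$. Then for every $X_\bullet$ with $\mathfrak s(\delta)=[X_\bullet]$ such an $e_\bullet$ exists, and $\mathfrak t(\tilde\delta)$ does not depend on the choice of $X_\bullet$ and $e_\bullet$. Moreover, the triplet $(\widetilde{\mathcal C},\mathbb F,\mathfrak t)$ is an $n$-exangulated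 category, and it is idempotent complete, i.e. every idempotent of $\widetilde{\mathcal C}$ splits. -/

import Mathlib

open CategoryTheory CategoryTheory.Limits CategoryTheory.Idempotents Opposite

open scoped ZeroObject

universe w v u

attribute [local instance] hasBinaryBiproducts_of_finite_biproducts

namespace NExangulated

noncomputable section

section Extensions

variable {𝒞 : Type u} [Category.{v} 𝒞]

/-- The abelian group `𝔼(C, A)` of `𝔼`-extensions, for a bifunctor `𝔼 : 𝒞ᵒᵖ × 𝒞 → Ab`
(given in curried form). -/
abbrev Extn (E : 𝒞ᵒᵖ ⥤ 𝒞 ⥤ AddCommGrpCat.{w}) (C A : 𝒞) : Type w :=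
  (E.obj (op C)).obj A

/-- `a_𝔼 = 𝔼(C, a) : 𝔼(C, A) → 𝔼(C, B)` for `a : A ⟶ B`. -/
def push (E : 𝒞ᵒᵖ ⥤ 𝒞 ⥤ AddCommGrpCat.{w}) {A B C : 𝒞} (a : A ⟶ B) :
    Extn E C A →+ Extn E C B :=
  ((E.obj (op C)).map a).hom

/-- `c^𝔼 = 𝔼(c, A) : 𝔼(C, A) → 𝔼(D, A)` for `c : D ⟶ C`. -/
def pull (E : 𝒞ᵒᵖ ⥤ 𝒞 ⥤ AddCommGrpCat.{w}) {A C D : 𝒞} (c : D ⟶ C) :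
    Extn E C A →+ Extn E D A :=
  ((E.map c.op).app A).hom

end Extensions

section Complexes

variable {𝒞 : Type u} [Category.{v} 𝒞] [Preadditive 𝒞]

/-- A complex concentrated in degrees `0, 1, …, n + 1`, with `X₀ = A` and `Xₙ₊₁ = C`. -/
structure NComplex (n : ℕ) (A C : 𝒞) where
  /-- the underlying complex -/
  K : CochainComplex 𝒞 ℕ
  isZero : ∀ i, n + 1 < i → IsZero (K.X i)
  left : K.X 0 = A
  right : K.X (n + 1) = C

namespace NComplex

variable {n : ℕ} {A B C D : 𝒞}

/-- The first differential `d₀ : A = X₀ ⟶ X₁`. -/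
def ι (X : NComplex n A C) : A ⟶ X.K.X 1 := eqToHom X.left.symm ≫ X.K.d 0 1

/-- The last differential `dₙ : Xₙ ⟶ Xₙ₊₁ = C`. -/
def π (X : NComplex n A C) : X.K.X n ⟶ C := X.K.d n (n + 1) ≫ eqToHom X.right

/-- The morphism of complexes `f` satisfies `f₀ = a` and `fₙ₊₁ = c`. -/
def IsLift (X : NComplex n A C) (Y : NComplex n B D) (f : X.K ⟶ Y.K) (a : A ⟶ B) (c : C ⟶ D) :
    Prop :=
  f.f 0 ≫ eqToHom Y.left = eqToHom X.left ≫ a ∧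
    f.f (n + 1) ≫ eqToHom Y.right = eqToHom X.right ≫ c

/-- `X` and `Y` are isomorphic in the category of complexes from `A` to `C`, whose morphisms are
the homotopy classes of morphisms of complexes `f` with `f₀ = 𝟙 A` and `fₙ₊₁ = 𝟙 C`. -/
def HtpyEquiv (X Y : NComplex n A C) : Prop :=
  ∃ (f : X.K ⟶ Y.K) (g : Y.K ⟶ X.K), IsLift X Y f (𝟙 A) (𝟙 C) ∧ IsLift Y X g (𝟙 A) (𝟙 C) ∧
    Nonempty (Homotopy (f ≫ g) (𝟙 X.K)) ∧ Nonempty (Homotopy (g ≫ f) (𝟙 Y.K))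

/-- The class `[X]` of `X` under the relation `HtpyEquiv`. -/
def cls (X : NComplex n A C) : Set (NComplex n A C) := {Y | HtpyEquiv X Y}

end NComplex

end Complexes

section Additive

variable {𝒞 : Type u} [Category.{v} 𝒞] [Preadditive 𝒞] [HasFiniteBiproducts 𝒞]

namespace NComplex

variable {n : ℕ} {A B C D : 𝒞}

/-- The complex `A = A → 0 → ⋯ → 0`, with `A` in the degrees `0` and `1`. -/
def trivFirst (n : ℕ) [NeZero n] (A : 𝒞) : NComplex n A 0 where
  K := HomologicalComplex.double (c := ComplexShape.up ℕ) (i₀ := 0) (i₁ := 1) (𝟙 A) rfl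
  isZero i hi := HomologicalComplex.isZero_double_X _ _ _ (by omega) (by omega)
  left := by simp [HomologicalComplex.double]
  right := by
    have := NeZero.ne n
    simp [HomologicalComplex.double, this]

/-- The complex `0 → ⋯ → 0 → A = A`, with `A` in the degrees `n` and `n + 1`. -/
def trivLast (n : ℕ) [NeZero n] (A : 𝒞) : NComplex n 0 A where
  K := HomologicalComplex.double (c := ComplexShape.up ℕ) (i₀ := n) (i₁ := n + 1) (𝟙 A) rfl
  isZero i hi := HomologicalComplex.isZero_double_X _ _ _ (by omega) (by omega)
  left := by
    have := (NeZero.ne n).symm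
    simp [HomologicalComplex.double, this]
  right := by simp [HomologicalComplex.double]

/-! ### The mapping cone

For `f : X ⟶ Y` this is the complex `X₁ → X₂ ⊕ Y₁ → ⋯ → Xₙ₊₁ ⊕ Yₙ → Yₙ₊₁`. -/

/-- The objects of the mapping cone. -/
def coneX (X : NComplex n A C) (Y : NComplex n B D) : ℕ → 𝒞
  | 0 => X.K.X 1
  | i + 1 => if i + 1 ≤ n then X.K.X (i + 2) ⊞ Y.K.X (i + 1) else Y.K.X (i + 1)

lemma coneX_zero (X : NComplex n A C) (Y : NComplex n B D) : coneX X Y 0 = X.K.X 1 := rfl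

lemma coneX_of_le (X : NComplex n A C) (Y : NComplex n B D) {i : ℕ} (h : i + 1 ≤ n) :
    coneX X Y (i + 1) = (X.K.X (i + 2) ⊞ Y.K.X (i + 1) :) := if_pos h

lemma coneX_of_not_le (X : NComplex n A C) (Y : NComplex n B D) {i : ℕ} (h : ¬ i + 1 ≤ n) :
    coneX X Y (i + 1) = Y.K.X (i + 1) := if_neg h

/-- The inclusion of `Xᵢ₊₁`; it is zero where this summand is absent. -/
def coneInl (X : NComplex n A C) (Y : NComplex n B D) : ∀ i, X.K.X (i + 1) ⟶ coneX X Y i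
  | 0 => eqToHom (coneX_zero X Y).symm
  | i + 1 => if h : i + 1 ≤ n then biprod.inl ≫ eqToHom (coneX_of_le X Y h).symm else 0

/-- The inclusion of `Yᵢ`; it is zero where this summand is absent. -/
def coneInr (X : NComplex n A C) (Y : NComplex n B D) : ∀ i, Y.K.X i ⟶ coneX X Y i
  | 0 => 0
  | i + 1 => if h : i + 1 ≤ n then biprod.inr ≫ eqToHom (coneX_of_le X Y h).symm
      else eqToHom (coneX_of_not_le X Y h).symm

/-- The projection onto `Xᵢ₊₁`; it is zero where this summand is absent. -/
def coneFst (X : NComplex n A C) (Y : NComplex n B D) : ∀ i, coneX X Y i ⟶ X.K.X (i + 1)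
  | 0 => eqToHom (coneX_zero X Y)
  | i + 1 => if h : i + 1 ≤ n then eqToHom (coneX_of_le X Y h) ≫ biprod.fst else 0

/-- The projection onto `Yᵢ`; it is zero where this summand is absent. -/
def coneSnd (X : NComplex n A C) (Y : NComplex n B D) : ∀ i, coneX X Y i ⟶ Y.K.X i
  | 0 => 0
  | i + 1 => if h : i + 1 ≤ n then eqToHom (coneX_of_le X Y h) ≫ biprod.snd
      else eqToHom (coneX_of_not_le X Y h)

lemma coneInl_fst (X : NComplex n A C) (Y : NComplex n B D) (i : ℕ) :
    coneInl X Y i ≫ coneFst X Y i = 𝟙 _ := by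
  cases i with
  | zero => simp [coneInl, coneFst]
  | succ i =>
    by_cases h : i + 1 ≤ n
    · simp [coneInl, coneFst, h]
    · exact (X.isZero _ (by omega)).eq_of_src _ _

lemma coneInl_snd (X : NComplex n A C) (Y : NComplex n B D) (i : ℕ) :
    coneInl X Y i ≫ coneSnd X Y i = 0 := by
  cases i with
  | zero => simp [coneInl, coneSnd]
  | succ i => by_cases h : i + 1 ≤ n <;> simp [coneInl, coneSnd, h]

lemma coneInr_fst (X : NComplex n A C) (Y : NComplex n B D) (i : ℕ) :
    coneInr X Y i ≫ coneFst X Y i = 0 := by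
  cases i with
  | zero => simp [coneInr, coneFst]
  | succ i => by_cases h : i + 1 ≤ n <;> simp [coneInr, coneFst, h]

lemma coneInr_snd (X : NComplex n A C) (Y : NComplex n B D) (i : ℕ) :
    coneInr X Y (i + 1) ≫ coneSnd X Y (i + 1) = 𝟙 _ := by
  by_cases h : i + 1 ≤ n <;> simp [coneInr, coneSnd, h]

/-- The differentials of the mapping cone, with components `-dˣᵢ₊₁ : Xᵢ₊₁ ⟶ Xᵢ₊₂`,
`fᵢ₊₁ : Xᵢ₊₁ ⟶ Yᵢ₊₁` and `dʸᵢ : Yᵢ ⟶ Yᵢ₊₁`. -/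
def coneD (X : NComplex n A C) (Y : NComplex n B D) (f : X.K ⟶ Y.K) (i : ℕ) :
    coneX X Y i ⟶ coneX X Y (i + 1) :=
  coneFst X Y i ≫ (-X.K.d (i + 1) (i + 2)) ≫ coneInl X Y (i + 1) +
    coneFst X Y i ≫ f.f (i + 1) ≫ coneInr X Y (i + 1) +
    coneSnd X Y i ≫ Y.K.d i (i + 1) ≫ coneInr X Y (i + 1)

lemma coneD_comp (X : NComplex n A C) (Y : NComplex n B D) (f : X.K ⟶ Y.K) (i : ℕ) :
    coneD X Y f i ≫ coneD X Y f (i + 1) = 0 := by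
  have h1 {Z : 𝒞} (k : X.K.X (i + 2) ⟶ Z) :
      coneInl X Y (i + 1) ≫ coneFst X Y (i + 1) ≫ k = k := by
    rw [← Category.assoc, coneInl_fst, Category.id_comp]
  have h2 {Z : 𝒞} (k : Y.K.X (i + 1) ⟶ Z) :
      coneInl X Y (i + 1) ≫ coneSnd X Y (i + 1) ≫ k = 0 := by
    rw [← Category.assoc, coneInl_snd, zero_comp]
  have h3 {Z : 𝒞} (k : X.K.X (i + 2) ⟶ Z) :
      coneInr X Y (i + 1) ≫ coneFst X Y (i + 1) ≫ k = 0 := by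
    rw [← Category.assoc, coneInr_fst, zero_comp]
  have h4 {Z : 𝒞} (k : Y.K.X (i + 1) ⟶ Z) :
      coneInr X Y (i + 1) ≫ coneSnd X Y (i + 1) ≫ k = k := by
    rw [← Category.assoc, coneInr_snd, Category.id_comp]
  simp [coneD, h1, h2, h3, h4]

/-- The mapping cone of `f : X ⟶ Y`. -/
def cone (X : NComplex n A C) (Y : NComplex n B D) (f : X.K ⟶ Y.K) :
    NComplex n (X.K.X 1) D where
  K := CochainComplex.of (coneX X Y) (coneD X Y f) (coneD_comp X Y f)
  isZero i hi := by
    obtain ⟨i, rfl⟩ : ∃ j, i = j + 1 := ⟨i - 1, by omega⟩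
    have : ¬ i + 1 ≤ n := by omega
    simpa [coneX, this] using Y.isZero _ hi
  left := rfl
  right := by simpa [coneX] using Y.right

/-! ### The mapping cocone

For `f : X ⟶ Y` this is the complex `X₀ → X₁ ⊕ Y₀ → ⋯ → Xₙ ⊕ Yₙ₋₁ → Yₙ`. It is the complex
obtained by forming the mapping cone in the opposite category. -/

/-- The objects of the mapping cocone. -/
def coconeX (X : NComplex n A C) (Y : NComplex n B D) : ℕ → 𝒞
  | 0 => X.K.X 0
  | i + 1 => if i + 1 ≤ n then X.K.X (i + 1) ⊞ Y.K.X i else if i = n then Y.K.X i else 0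

lemma coconeX_zero (X : NComplex n A C) (Y : NComplex n B D) : coconeX X Y 0 = X.K.X 0 := rfl

lemma coconeX_of_le (X : NComplex n A C) (Y : NComplex n B D) {i : ℕ} (h : i + 1 ≤ n) :
    coconeX X Y (i + 1) = (X.K.X (i + 1) ⊞ Y.K.X i :) := if_pos h

lemma coconeX_of_eq (X : NComplex n A C) (Y : NComplex n B D) {i : ℕ} (h : i = n) :
    coconeX X Y (i + 1) = Y.K.X i := by simp [coconeX, h]

lemma isZero_coconeX (X : NComplex n A C) (Y : NComplex n B D) (i : ℕ) (hi : n + 1 < i) :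
    IsZero (coconeX X Y i) := by
  obtain ⟨i, rfl⟩ : ∃ j, i = j + 1 := ⟨i - 1, by omega⟩
  have h1 : ¬ i + 1 ≤ n := by omega
  have h2 : ¬ i = n := by omega
  simpa [coconeX, h1, h2] using isZero_zero 𝒞

/-- The inclusion of `Xᵢ`; it is zero where this summand is absent. -/
def coconeInl (X : NComplex n A C) (Y : NComplex n B D) : ∀ i, X.K.X i ⟶ coconeX X Y i
  | 0 => eqToHom (coconeX_zero X Y).symm
  | i + 1 => if h : i + 1 ≤ n then biprod.inl ≫ eqToHom (coconeX_of_le X Y h).symm else 0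

/-- The inclusion of `Yᵢ` in degree `i + 1`; it is zero where this summand is absent. -/
def coconeInr (X : NComplex n A C) (Y : NComplex n B D) (i : ℕ) :
    Y.K.X i ⟶ coconeX X Y (i + 1) :=
  if h : i + 1 ≤ n then biprod.inr ≫ eqToHom (coconeX_of_le X Y h).symm
  else if h' : i = n then eqToHom (coconeX_of_eq X Y h').symm else 0

/-- The projection onto `Xᵢ`; it is zero where this summand is absent. -/
def coconeFst (X : NComplex n A C) (Y : NComplex n B D) : ∀ i, coconeX X Y i ⟶ X.K.X i
  | 0 => eqToHom (coconeX_zero X Y)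
  | i + 1 => if h : i + 1 ≤ n then eqToHom (coconeX_of_le X Y h) ≫ biprod.fst else 0

/-- The projection onto `Yᵢ` in degree `i + 1`; it is zero where this summand is absent. -/
def coconeSnd (X : NComplex n A C) (Y : NComplex n B D) (i : ℕ) :
    coconeX X Y (i + 1) ⟶ Y.K.X i :=
  if h : i + 1 ≤ n then eqToHom (coconeX_of_le X Y h) ≫ biprod.snd
  else if h' : i = n then eqToHom (coconeX_of_eq X Y h') else 0

lemma coconeInl_fst (X : NComplex n A C) (Y : NComplex n B D) (i : ℕ) (hi : i ≤ n) :
    coconeInl X Y i ≫ coconeFst X Y i = 𝟙 _ := by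
  cases i with
  | zero => simp [coconeInl, coconeFst]
  | succ i => simp [coconeInl, coconeFst, hi]

lemma coconeInl_snd (X : NComplex n A C) (Y : NComplex n B D) (i : ℕ) :
    coconeInl X Y (i + 1) ≫ coconeSnd X Y i = 0 := by
  by_cases h : i + 1 ≤ n <;> simp [coconeInl, coconeSnd, h]

lemma coconeInr_fst (X : NComplex n A C) (Y : NComplex n B D) (i : ℕ) :
    coconeInr X Y i ≫ coconeFst X Y (i + 1) = 0 := by
  by_cases h : i + 1 ≤ n <;> simp [coconeInr, coconeFst, h]

lemma coconeInr_snd (X : NComplex n A C) (Y : NComplex n B D) (i : ℕ) (hi : i ≤ n) :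
    coconeInr X Y i ≫ coconeSnd X Y i = 𝟙 _ := by
  by_cases h : i + 1 ≤ n
  · simp [coconeInr, coconeSnd, h]
  · have h' : i = n := by omega
    simp [coconeInr, coconeSnd, h']

/-- The differentials of the mapping cocone, with components `dˣᵢ : Xᵢ ⟶ Xᵢ₊₁`,
`fᵢ : Xᵢ ⟶ Yᵢ` and `-dʸᵢ₋₁ : Yᵢ₋₁ ⟶ Yᵢ`. -/
def coconeD (X : NComplex n A C) (Y : NComplex n B D) (f : X.K ⟶ Y.K) :
    ∀ i, coconeX X Y i ⟶ coconeX X Y (i + 1)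
  | 0 => coconeFst X Y 0 ≫ X.K.d 0 1 ≫ coconeInl X Y 1 +
      coconeFst X Y 0 ≫ f.f 0 ≫ coconeInr X Y 0
  | i + 1 => coconeFst X Y (i + 1) ≫ X.K.d (i + 1) (i + 2) ≫ coconeInl X Y (i + 2) +
      coconeFst X Y (i + 1) ≫ f.f (i + 1) ≫ coconeInr X Y (i + 1) +
      coconeSnd X Y i ≫ (-Y.K.d i (i + 1)) ≫ coconeInr X Y (i + 1)

lemma coconeD_comp (X : NComplex n A C) (Y : NComplex n B D) (f : X.K ⟶ Y.K) (i : ℕ) :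
    coconeD X Y f i ≫ coconeD X Y f (i + 1) = 0 := by
  by_cases hi : i + 1 ≤ n
  · have h1 {Z : 𝒞} (k : X.K.X (i + 1) ⟶ Z) :
        coconeInl X Y (i + 1) ≫ coconeFst X Y (i + 1) ≫ k = k := by
      rw [← Category.assoc, coconeInl_fst X Y _ hi, Category.id_comp]
    have h2 {Z : 𝒞} (k : Y.K.X i ⟶ Z) :
        coconeInl X Y (i + 1) ≫ coconeSnd X Y i ≫ k = 0 := by
      rw [← Category.assoc, coconeInl_snd, zero_comp]
    have h3 {Z : 𝒞} (k : X.K.X (i + 1) ⟶ Z) :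
        coconeInr X Y i ≫ coconeFst X Y (i + 1) ≫ k = 0 := by
      rw [← Category.assoc, coconeInr_fst, zero_comp]
    have h4 {Z : 𝒞} (k : Y.K.X i ⟶ Z) :
        coconeInr X Y i ≫ coconeSnd X Y i ≫ k = k := by
      rw [← Category.assoc, coconeInr_snd X Y _ (by omega), Category.id_comp]
    cases i <;> simp [coconeD, h1, h2, h3, h4]
  · exact (isZero_coconeX X Y _ (by omega)).eq_of_tgt _ _

/-- The mapping cocone of `f : X ⟶ Y`. -/
def cocone (X : NComplex n A C) (Y : NComplex n B D) (f : X.K ⟶ Y.K) :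
    NComplex n A (Y.K.X n) where
  K := CochainComplex.of (coconeX X Y) (coconeD X Y f) (coconeD_comp X Y f)
  isZero i hi := isZero_coconeX X Y i hi
  left := X.left
  right := by simp [coconeX]

end NComplex

/-- `⟨X, δ⟩` is an `n`-exangle: the complex `X` is attached to `δ`, and the two induced sequences
of functors
`𝒞(-, X₀) → ⋯ → 𝒞(-, Xₙ₊₁) → 𝔼(-, X₀)` and `𝒞(Xₙ₊₁, -) → ⋯ → 𝒞(X₀, -) → 𝔼(Xₙ₊₁, -)`
are exact. -/
structure IsNExangle (E : 𝒞ᵒᵖ ⥤ 𝒞 ⥤ AddCommGrpCat.{w}) {n : ℕ} {A C : 𝒞} (X : NComplex n A C)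
    (δ : Extn E C A) : Prop where
  push_eq_zero : push E X.ι δ = 0
  pull_eq_zero : pull E X.π δ = 0
  exact_left (T : 𝒞) (i : ℕ) (hi : i < n) :
    Function.Exact (fun g : T ⟶ X.K.X i => g ≫ X.K.d i (i + 1))
      (fun g : T ⟶ X.K.X (i + 1) => g ≫ X.K.d (i + 1) (i + 2))
  exact_left_ext (T : 𝒞) :
    Function.Exact (fun g : T ⟶ X.K.X n => g ≫ X.π) (fun c : T ⟶ C => pull E c δ)
  exact_right (T : 𝒞) (i : ℕ) (hi : i < n) :
    Function.Exact (fun g : X.K.X (i + 2) ⟶ T => X.K.d (i + 1) (i + 2) ≫ g)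
      (fun g : X.K.X (i + 1) ⟶ T => X.K.d i (i + 1) ≫ g)
  exact_right_ext (T : 𝒞) :
    Function.Exact (fun g : X.K.X 1 ⟶ T => X.ι ≫ g) (fun a : A ⟶ T => push E a δ)

/-- An assignment of a collection of complexes in degrees `0, …, n + 1` from `A` to `C` to each
extension `δ ∈ 𝔼(C, A)`. When the collection assigned to `δ` is a class `[X]`, `X ∈ s δ` means
`s(δ) = [X]`. -/
abbrev Assignment (E : 𝒞ᵒᵖ ⥤ 𝒞 ⥤ AddCommGrpCat.{w}) (n : ℕ) : Type _ :=
  ∀ ⦃A C : 𝒞⦄, Extn E C A → Set (NComplex n A C)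

/-- `s` is an exact realisation of `𝔼`. -/
structure IsExactRealisation {E : 𝒞ᵒᵖ ⥤ 𝒞 ⥤ AddCommGrpCat.{w}} {n : ℕ} [NeZero n]
    (s : Assignment E n) : Prop where
  /-- each `s(δ)` is an isomorphism class -/
  isClass ⦃A C : 𝒞⦄ (δ : Extn E C A) : ∃ X : NComplex n A C, s δ = X.cls
  /-- every morphism of extensions lifts to the realising complexes -/
  exists_lift ⦃A B C D : 𝒞⦄ (δ : Extn E C A) (ρ : Extn E D B) (a : A ⟶ B) (c : C ⟶ D)
    (h : push E a δ = pull E c ρ) (X : NComplex n A C) (hX : X ∈ s δ) (Y : NComplex n B D)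
    (hY : Y ∈ s ρ) : ∃ f : X.K ⟶ Y.K, X.IsLift Y f a c
  /-- the realising complexes form `n`-exangles -/
  isNExangle ⦃A C : 𝒞⦄ (δ : Extn E C A) (X : NComplex n A C) (hX : X ∈ s δ) : IsNExangle E X δ
  /-- the trivial complex realises the zero element of `𝔼(0, A)` -/
  trivFirst_mem (A : 𝒞) : NComplex.trivFirst n A ∈ s (0 : Extn E 0 A)
  /-- the trivial complex realises the zero element of `𝔼(A, 0)` -/
  trivLast_mem (A : 𝒞) : NComplex.trivLast n A ∈ s (0 : Extn E A 0)

/-- `s`-inflations: the morphisms `d₀ : X₀ ⟶ X₁` where `s(δ) = [X]` for some `δ`. -/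
inductive IsInflation {E : 𝒞ᵒᵖ ⥤ 𝒞 ⥤ AddCommGrpCat.{w}} {n : ℕ} (s : Assignment E n) :
    ∀ {A B : 𝒞}, (A ⟶ B) → Prop
  | mk {A C : 𝒞} (δ : Extn E C A) (X : NComplex n A C) (hX : X ∈ s δ) : IsInflation s X.ι

/-- `s`-deflations: the morphisms `dₙ : Xₙ ⟶ Xₙ₊₁` where `s(δ) = [X]` for some `δ`. -/
inductive IsDeflation {E : 𝒞ᵒᵖ ⥤ 𝒞 ⥤ AddCommGrpCat.{w}} {n : ℕ} (s : Assignment E n) :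
    ∀ {B C : 𝒞}, (B ⟶ C) → Prop
  | mk {A C : 𝒞} (δ : Extn E C A) (X : NComplex n A C) (hX : X ∈ s δ) : IsDeflation s X.π

/-- `(𝒞, 𝔼, s)` is an `n`-exangulated category. -/
structure IsNExangulated (E : 𝒞ᵒᵖ ⥤ 𝒞 ⥤ AddCommGrpCat.{w}) {n : ℕ} [NeZero n]
    (s : Assignment E n) : Prop extends IsExactRealisation s where
  /-- `𝔼` is additive in its first (contravariant) argument -/
  additive_fst : E.Additive
  /-- `𝔼` is additive in its second (covariant) argument -/
  additive_snd (C : 𝒞ᵒᵖ) : (E.obj C).Additive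
  /-- inflations are closed under composition -/
  inflation_comp ⦃A B C : 𝒞⦄ (f : A ⟶ B) (g : B ⟶ C) (hf : IsInflation s f)
    (hg : IsInflation s g) : IsInflation s (f ≫ g)
  /-- deflations are closed under composition -/
  deflation_comp ⦃A B C : 𝒞⦄ (f : A ⟶ B) (g : B ⟶ C) (hf : IsDeflation s f)
    (hg : IsDeflation s g) : IsDeflation s (f ≫ g)
  /-- `(𝟙, c)` has a lift whose mapping cone realises `(d₀ʸ)_𝔼 δ` -/
  exists_good_lift ⦃A C D : 𝒞⦄ (δ : Extn E D A) (c : C ⟶ D) (Y : NComplex n A C)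
    (hY : Y ∈ s (pull E c δ)) (X : NComplex n A D) (hX : X ∈ s δ) :
    ∃ f : Y.K ⟶ X.K, Y.IsLift X f (𝟙 A) c ∧ Y.cone X f ∈ s (push E Y.ι δ)
  /-- `(a, 𝟙)` has a lift whose mapping cocone realises `(dₙʸ)^𝔼 δ` -/
  exists_good_lift_op ⦃A B C : 𝒞⦄ (δ : Extn E C A) (a : A ⟶ B) (X : NComplex n A C)
    (hX : X ∈ s δ) (Y : NComplex n B C) (hY : Y ∈ s (push E a δ)) :
    ∃ f : X.K ⟶ Y.K, X.IsLift Y f a (𝟙 C) ∧ X.cocone Y f ∈ s (pull E Y.π δ)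

end Additive

section Karoubi

variable {𝒞 : Type u} [Category.{v} 𝒞]

/-- The group `𝔽((Z, e'), (X, e))` of the extensions `δ ∈ 𝔼(Z, X)` with
`e_𝔼 δ = δ = e'^𝔼 δ`. -/
def karoubiExtn (E : 𝒞ᵒᵖ ⥤ 𝒞 ⥤ AddCommGrpCat.{w}) (Z X : Karoubi 𝒞) :
    AddSubgroup (Extn E Z.X X.X) where
  carrier := {δ | push E X.p δ = δ ∧ pull E Z.p δ = δ}
  add_mem' := by
    rintro δ ρ ⟨h1, h2⟩ ⟨h3, h4⟩
    exact ⟨by rw [map_add, h1, h3], by rw [map_add, h2, h4]⟩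
  zero_mem' := ⟨map_zero _, map_zero _⟩
  neg_mem' := by
    rintro δ ⟨h1, h2⟩
    exact ⟨by rw [map_neg, h1], by rw [map_neg, h2]⟩

lemma push_push (E : 𝒞ᵒᵖ ⥤ 𝒞 ⥤ AddCommGrpCat.{w}) {A B B' C : 𝒞} (a : A ⟶ B) (b : B ⟶ B')
    (δ : Extn E C A) : push E b (push E a δ) = push E (a ≫ b) δ := by
  simp [push]

lemma pull_pull (E : 𝒞ᵒᵖ ⥤ 𝒞 ⥤ AddCommGrpCat.{w}) {A C D D' : 𝒞} (c : D ⟶ C) (d : D' ⟶ D)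
    (δ : Extn E C A) : pull E d (pull E c δ) = pull E (d ≫ c) δ := by
  simp [pull]

lemma pull_push (E : 𝒞ᵒᵖ ⥤ 𝒞 ⥤ AddCommGrpCat.{w}) {A B C D : 𝒞} (a : A ⟶ B) (c : D ⟶ C)
    (δ : Extn E C A) : pull E c (push E a δ) = push E a (pull E c δ) :=
  ConcreteCategory.congr_hom ((E.map c.op).naturality a) δ

/-- The map `𝔽((Z, e'), (X, e)) → 𝔽((Z, e'), (Y, e''))` given by `δ ↦ a_𝔼 δ`. -/
def karoubiPush (E : 𝒞ᵒᵖ ⥤ 𝒞 ⥤ AddCommGrpCat.{w}) (Z : Karoubi 𝒞) {X Y : Karoubi 𝒞}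
    (a : X ⟶ Y) : karoubiExtn E Z X →+ karoubiExtn E Z Y :=
  ((push E a.f).comp (karoubiExtn E Z X).subtype).codRestrict _ (by
    rintro ⟨δ, h1, h2⟩
    refine ⟨?_, ?_⟩
    · simp [push_push]
    · simp [pull_push, h2])

/-- The map `𝔽((Z, e'), (X, e)) → 𝔽((W, e''), (X, e))` given by `δ ↦ c^𝔼 δ`. -/
def karoubiPull (E : 𝒞ᵒᵖ ⥤ 𝒞 ⥤ AddCommGrpCat.{w}) {Z W : Karoubi 𝒞} (c : W ⟶ Z)
    (X : Karoubi 𝒞) : karoubiExtn E Z X →+ karoubiExtn E W X :=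
  ((pull E c.f).comp (karoubiExtn E Z X).subtype).codRestrict _ (by
    rintro ⟨δ, h1, h2⟩
    refine ⟨?_, ?_⟩
    · simp [← pull_push, h1]
    · simp [pull_pull])

/-- The bifunctor `𝔽` on the idempotent completion. -/
def karoubiE (E : 𝒞ᵒᵖ ⥤ 𝒞 ⥤ AddCommGrpCat.{w}) :
    (Karoubi 𝒞)ᵒᵖ ⥤ Karoubi 𝒞 ⥤ AddCommGrpCat.{w} where
  obj Z :=
    { obj := fun X => AddCommGrpCat.of (karoubiExtn E Z.unop X)
      map := fun a => AddCommGrpCat.ofHom (karoubiPush E Z.unop a)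
      map_id := by
        intro X
        ext ⟨δ, h1, h2⟩
        exact h1
      map_comp := by
        intro X Y W a b
        ext ⟨δ, h1, h2⟩
        exact (push_push E a.f b.f δ).symm }
  map c :=
    { app := fun X => AddCommGrpCat.ofHom (karoubiPull E c.unop X)
      naturality := by
        intro X Y a
        ext ⟨δ, h1, h2⟩
        exact (pull_push E a.f c.unop.f δ) }
  map_id := by
    intro Z
    ext X ⟨δ, h1, h2⟩
    exact h2
  map_comp := by
    intro Z W V c d
    ext X ⟨δ, h1, h2⟩
    exact (pull_pull E c.unop.f d.unop.f δ).symm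

/-- The underlying `𝔼`-extension of an `𝔽`-extension. -/
def underlying (E : 𝒞ᵒᵖ ⥤ 𝒞 ⥤ AddCommGrpCat.{w}) {Z X : Karoubi 𝒞}
    (δ : Extn (karoubiE E) Z X) : Extn E Z.X X.X :=
  (show karoubiExtn E Z X from δ).1

variable [Preadditive 𝒞]

/-- The complex `(X•, e•)` over the idempotent completion, for an idempotent morphism of complexes
`e• : X• ⟶ X•`: it has the objects `(Xᵢ, eᵢ)` and the differentials `eᵢ₊₁ dᵢ eᵢ = dᵢ eᵢ`. -/
def karoubiComplex {n : ℕ} {A C : Karoubi 𝒞} (X : NComplex n A.X C.X) (e : X.K ⟶ X.K)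
    (idem : e ≫ e = e) (he : X.IsLift X e A.p C.p) : NComplex n A C where
  K := (karoubiCochainComplexEquivalence 𝒞 ℕ).functor.obj ⟨X.K, e, idem⟩
  isZero i hi := by
    refine ⟨fun Y => ⟨⟨⟨0⟩, fun f => ?_⟩⟩, fun Y => ⟨⟨⟨0⟩, fun f => ?_⟩⟩⟩
    · ext
      exact (X.isZero i hi).eq_of_src _ _
    · ext
      exact (X.isZero i hi).eq_of_tgt _ _
  left := Karoubi.ext X.left he.1
  right := Karoubi.ext X.right he.2

/-- The realisation `t` of `𝔽`: `t(δ) = [(X•, e•)]`, where `s(δ) = [X•]` for the underlying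
`𝔼`-extension and `e• : X• ⟶ X•` is an idempotent lift of the pair of the idempotents of the two
end terms. -/
def karoubiRealisation {E : 𝒞ᵒᵖ ⥤ 𝒞 ⥤ AddCommGrpCat.{w}} {n : ℕ} (s : Assignment E n) :
    Assignment (karoubiE E) n :=
  fun A C δ => {Z | ∃ (X : NComplex n A.X C.X) (_ : X ∈ s (underlying E δ)) (e : X.K ⟶ X.K)
    (idem : e ≫ e = e) (he : X.IsLift X e A.p C.p), Z ∈ (karoubiComplex X e idem he).cls}

end Karoubi

end

end NExangulated

/-!
Throughout, composition is written diagrammatically: `f g` means `f ≫ g`.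

**Realisation.** Let `X` realise `δ ∈ 𝔼(C, A)`, and let `p`, `c` be idempotents of `A` and `C`
which fix `δ`. By the long exact sequences `1 - p` extends along `d₀` and `1 - c` lifts along
`dₙ`. Such an extension `X₁ ⟶ A` and such a lift `C ⟶ Xₙ`, read as homotopies with a single
component and normalised by the idempotents, give two contractible idempotents of `X` which split
off, and the complement of both is an idempotent lift `e` of `(p, c)` homotopic to the identity
(`IsNExangle.exists_idempotent_lift`). The complex `(X, e)` is a direct summand of `X`, so it
inherits the exact sequences (`IsNExangle.karoubi`). Complexes with exact sequences are equivalent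
as soon as there are lifts of `(𝟙, 𝟙)` in both directions (`NComplex.RightExact.htpyEquiv`), which
gives the independence of the choices.

**Inflations and deflations.** A morphism `f : (A, p) ⟶ (B, q)` is an inflation of the idempotent
completion if and only if `p φ` factors through `f` for an inflation `φ` of `𝒞` with source `A`.
Given such a `φ = d₀ : A ⟶ X₁`, the realised extension may be replaced by its image under `p_𝔼`,
and is then fixed by `p`. The mapping cocone of a good lift of `(f, 𝟙)` provides an inflation `A ⟶
X₁ ⊕ B` of which `f` is a retract (`exists_inflation_retract`). The idempotent which cuts `B` out
of the middle term then extends to an idempotent of the whole complex which is `p` on `A` and is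
homotopic to the identity (`IsNExangle.exists_idempotent_first`), so that `f` is, up to
isomorphism, the first differential of a direct summand. The same retracts show that the criterion
is stable under composition. The case of deflations is dual.

**Good lifts.** A good lift `f` over `𝒞` is homotopic to its diagonal part
`e f e' + (1 - e) f (1 - e')` when `e` and `e'` are homotopic to the identity
(`exists_diagonal_lift`). Homotopic lifts have equivalent mapping cones
(`IsExactRealisation.cone_mem`), hence the diagonal part is a good lift as well. Since it commutes
with the idempotents, its mapping cone carries an idempotent, and the corresponding summand is the
mapping cone over the idempotent completion (`exists_htpyEquiv_cone_karoubi`).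
-/

namespace NExangulated

noncomputable section

/-! ### Homotopies given by families of morphisms -/

section Families

variable {𝒞 : Type u} [Category.{v} 𝒞] [Preadditive 𝒞] {K L M : CochainComplex 𝒞 ℕ}

/-- The family `Kᵢ ⟶ Lⱼ` for all `i, j`, in the format of `Homotopy`, which is `h j` for
`i = j + 1` and zero otherwise. -/
def familyHom (h : ∀ i, K.X (i + 1) ⟶ L.X i) (i j : ℕ) : K.X i ⟶ L.X j :=
  if hij : i = j + 1 then eqToHom (congrArg K.X hij) ≫ h j else 0

@[simp]
lemma familyHom_succ (h : ∀ i, K.X (i + 1) ⟶ L.X i) (i : ℕ) : familyHom h (i + 1) i = h i := by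
  simp [familyHom]

/-- The null-homotopic morphism `d h + h d`. -/
def nullMap (h : ∀ i, K.X (i + 1) ⟶ L.X i) : K ⟶ L :=
  Homotopy.nullHomotopicMap (familyHom h)

lemma nullMap_f_zero (h : ∀ i, K.X (i + 1) ⟶ L.X i) :
    (nullMap h).f 0 = K.d 0 1 ≫ h 0 := by
  simp only [nullMap, Homotopy.nullHomotopicMap]
  rw [Homotopy.dNext_cochainComplex, Homotopy.prevD_zero_cochainComplex]
  simp

lemma nullMap_f_succ (h : ∀ i, K.X (i + 1) ⟶ L.X i) (i : ℕ) :
    (nullMap h).f (i + 1) = K.d (i + 1) (i + 2) ≫ h (i + 1) + h i ≫ L.d i (i + 1) := by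
  simp only [nullMap, Homotopy.nullHomotopicMap]
  rw [Homotopy.dNext_cochainComplex, Homotopy.prevD_succ_cochainComplex]
  simp

lemma homotopy_sub {f f' g g' : K ⟶ L} (h : Homotopy f g) (h' : Homotopy f' g') :
    Nonempty (Homotopy (f - f') (g - g')) := by
  have H := Homotopy.equivSubZero h
  have H' := (Homotopy.equivSubZero h').symm
  exact ⟨Homotopy.equivSubZero.symm ((Homotopy.ofEq (by abel)).trans
    ((H.add (Homotopy.equivSubZero H')).trans (Homotopy.ofEq (by simp))))⟩

lemma nullMap_homotopy (h : ∀ i, K.X (i + 1) ⟶ L.X i) : Nonempty (Homotopy (nullMap h) 0) :=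
  ⟨Homotopy.nullHomotopy _ fun i j hij => by
    have : ¬ i = j + 1 := fun h => hij h.symm
    simp [familyHom, this]⟩

lemma homotopy_of_eq_nullMap {f g : K ⟶ L} (h : ∀ i, K.X (i + 1) ⟶ L.X i)
    (e : f = nullMap h + g) : Nonempty (Homotopy f g) := by
  obtain ⟨H⟩ := nullMap_homotopy h
  exact ⟨(Homotopy.ofEq e).trans ((H.add (Homotopy.refl g)).trans (Homotopy.ofEq (zero_add g)))⟩

lemma eq_nullMap_of_homotopy {f g : K ⟶ L} (H : Homotopy f g) :
    ∃ h : ∀ i, K.X (i + 1) ⟶ L.X i, f = nullMap h + g := by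
  refine ⟨fun i => H.hom (i + 1) i, ?_⟩
  ext i
  rw [H.comm i, HomologicalComplex.add_f_apply]
  congr 1
  cases i with
  | zero =>
    rw [Homotopy.dNext_cochainComplex, Homotopy.prevD_zero_cochainComplex, nullMap_f_zero, add_zero]
  | succ i =>
    rw [Homotopy.dNext_cochainComplex, Homotopy.prevD_succ_cochainComplex, nullMap_f_succ]

/-- The null-homotopic morphism of a family with the single component `s : Kⱼ₊₁ ⟶ Lⱼ`. -/
def singleMap (j : ℕ) (s : K.X (j + 1) ⟶ L.X j) : K ⟶ L :=
  nullMap (Function.update (fun _ => 0) j s)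

lemma singleMap_f_self (j : ℕ) (s : K.X (j + 1) ⟶ L.X j) :
    (singleMap j s).f j = K.d j (j + 1) ≫ s := by
  cases j with
  | zero => simp [singleMap, nullMap_f_zero]
  | succ j => simp [singleMap, nullMap_f_succ]

lemma singleMap_f_succ (j : ℕ) (s : K.X (j + 1) ⟶ L.X j) :
    (singleMap j s).f (j + 1) = s ≫ L.d j (j + 1) := by
  simp [singleMap, nullMap_f_succ]

lemma singleMap_f_of_ne (j : ℕ) (s : K.X (j + 1) ⟶ L.X j) (i : ℕ) (h1 : i ≠ j) (h2 : i ≠ j + 1) :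
    (singleMap j s).f i = 0 := by
  cases i with
  | zero => simp [singleMap, nullMap_f_zero, Function.update_of_ne h1]
  | succ i =>
    have h3 : i ≠ j := fun h => h2 (by rw [h])
    simp [singleMap, nullMap_f_succ, Function.update_of_ne h1, Function.update_of_ne h3]

lemma singleMap_idem (j : ℕ) (s : K.X (j + 1) ⟶ K.X j) (h : s ≫ K.d j (j + 1) ≫ s = s) :
    singleMap j s ≫ singleMap j s = singleMap j s := by
  ext i
  rw [HomologicalComplex.comp_f]
  by_cases h1 : i = j
  · subst h1
    simp [singleMap_f_self, h]
  by_cases h2 : i = j + 1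
  · subst h2
    rw [singleMap_f_succ, Category.assoc, ← Category.assoc (K.d j (j + 1)) s,
      ← Category.assoc, ← Category.assoc, Category.assoc s, h]
  · simp [singleMap_f_of_ne _ _ _ h1 h2]

lemma singleMap_comp_singleMap {j k : ℕ} (hjk : j < k) (s : K.X (j + 1) ⟶ L.X j)
    (u : L.X (k + 1) ⟶ M.X k) : singleMap j s ≫ singleMap k u = 0 := by
  ext i
  rw [HomologicalComplex.comp_f, HomologicalComplex.zero_f]
  by_cases h1 : i = j
  · rw [singleMap_f_of_ne k u i (by omega) (by omega), comp_zero]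
  by_cases h2 : i = j + 1
  · subst h2
    rw [singleMap_f_succ]
    by_cases h3 : j + 1 = k
    · subst h3
      simp [singleMap_f_self]
    · rw [singleMap_f_of_ne k u _ h3 (by omega), comp_zero]
  · rw [singleMap_f_of_ne j s i h1 h2, zero_comp]

/-- For `j < k`, the product of the complements of two contractible idempotents which are supported
in the degrees `j, j + 1` and `k, k + 1`. -/
def compl (j k : ℕ) (s : K.X (j + 1) ⟶ K.X j) (u : K.X (k + 1) ⟶ K.X k) : K ⟶ K :=
  (𝟙 K - singleMap k u) ≫ (𝟙 K - singleMap j s)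

section compl

variable {j k : ℕ} (hjk : j < k) (s : K.X (j + 1) ⟶ K.X j) (u : K.X (k + 1) ⟶ K.X k)

include hjk in
lemma compl_idem (hs : s ≫ K.d j (j + 1) ≫ s = s) (hu : u ≫ K.d k (k + 1) ≫ u = u) :
    compl j k s u ≫ compl j k s u = compl j k s u := by
  have h1 := singleMap_idem j s hs
  have h2 := singleMap_idem k u hu
  have h3 := singleMap_comp_singleMap (M := K) hjk s u
  have h4 : singleMap j s ≫ singleMap k u ≫ singleMap j s = 0 := by
    rw [← Category.assoc, h3, zero_comp]
  have h5 : singleMap k u ≫ singleMap k u ≫ singleMap j s = singleMap k u ≫ singleMap j s := by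
    rw [← Category.assoc, h2]
  simp only [compl, Preadditive.comp_sub, Preadditive.sub_comp, Category.id_comp, Category.comp_id,
    Category.assoc, h1, h2, h3, h4, h5, comp_zero]
  abel

lemma compl_homotopy : Nonempty (Homotopy (compl j k s u) (𝟙 K)) := by
  obtain ⟨H1⟩ := nullMap_homotopy (Function.update (fun _ => 0) j s : ∀ i, K.X (i + 1) ⟶ K.X i)
  obtain ⟨H2⟩ := nullMap_homotopy (Function.update (fun _ => 0) k u : ∀ i, K.X (i + 1) ⟶ K.X i)
  obtain ⟨H1'⟩ := homotopy_sub (Homotopy.refl (𝟙 K)) H1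
  obtain ⟨H2'⟩ := homotopy_sub (Homotopy.refl (𝟙 K)) H2
  exact ⟨(H2'.comp H1').trans (Homotopy.ofEq (by simp))⟩

end compl

end Families

namespace NComplex

variable {𝒞 : Type u} [Category.{v} 𝒞] [Preadditive 𝒞] {n : ℕ} {A B C D A' C' : 𝒞}

/-! ### Complexes with fixed ends -/

@[simp]
lemma ι_d (X : NComplex n A C) : X.ι ≫ X.K.d 1 2 = 0 := by simp [ι]

@[simp]
lemma ι_d_assoc (X : NComplex n A C) {T : 𝒞} (g : X.K.X 2 ⟶ T) : X.ι ≫ X.K.d 1 2 ≫ g = 0 := by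
  simp [ι]

lemma d_zero (X : NComplex n A C) : X.K.d 0 1 = eqToHom X.left ≫ X.ι := by simp [ι]

lemma d_last (X : NComplex n A C) : X.K.d n (n + 1) = X.π ≫ eqToHom X.right.symm := by simp [π]

namespace IsLift

variable {X : NComplex n A C} {Y : NComplex n B D} {Z : NComplex n A' C'} {a : A ⟶ B} {c : C ⟶ D}
  {f f' : X.K ⟶ Y.K}

lemma f_zero (h : X.IsLift Y f a c) :
    f.f 0 = eqToHom X.left ≫ a ≫ eqToHom Y.left.symm := by
  rw [← Category.assoc, ← h.1]; simp

lemma f_last (h : X.IsLift Y f a c) :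
    f.f (n + 1) = eqToHom X.right ≫ c ≫ eqToHom Y.right.symm := by
  rw [← Category.assoc, ← h.2]; simp

lemma ι_comp (h : X.IsLift Y f a c) : X.ι ≫ f.f 1 = a ≫ Y.ι := by
  simp [ι, ← f.comm, h.f_zero]

lemma comp_π (h : X.IsLift Y f a c) : f.f n ≫ Y.π = X.π ≫ c := by
  simp [π, h.f_last]

protected lemma id (X : NComplex n A C) : X.IsLift X (𝟙 _) (𝟙 A) (𝟙 C) := by simp [IsLift]

lemma comp (h : X.IsLift Y f a c) {g : Y.K ⟶ Z.K} {a' : B ⟶ A'} {c' : D ⟶ C'}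
    (h' : Y.IsLift Z g a' c') : X.IsLift Z (f ≫ g) (a ≫ a') (c ≫ c') := by
  simp [IsLift, h.f_zero, h'.f_zero, h.f_last, h'.f_last]

lemma add (h : X.IsLift Y f a c) {a' : A ⟶ B} {c' : C ⟶ D} (h' : X.IsLift Y f' a' c') :
    X.IsLift Y (f + f') (a + a') (c + c') := by
  simp [IsLift, h.f_zero, h'.f_zero, h.f_last, h'.f_last]

lemma sub (h : X.IsLift Y f a c) {a' : A ⟶ B} {c' : C ⟶ D} (h' : X.IsLift Y f' a' c') :
    X.IsLift Y (f - f') (a - a') (c - c') := by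
  simp [IsLift, h.f_zero, h'.f_zero, h.f_last, h'.f_last]

lemma congr (h : X.IsLift Y f a c) {a' : A ⟶ B} {c' : C ⟶ D} (ha : a = a') (hc : c = c') :
    X.IsLift Y f a' c' := by subst ha hc; exact h

lemma of_singleMap_zero [NeZero n] (X : NComplex n A C) (Y : NComplex n B D)
    (s : X.K.X 1 ⟶ B) :
    X.IsLift Y (singleMap 0 (s ≫ eqToHom Y.left.symm)) (X.ι ≫ s) 0 := by
  have := NeZero.ne n
  constructor
  · simp [singleMap_f_self, d_zero]
  · rw [singleMap_f_of_ne _ _ _ (by omega) (by omega)]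
    simp

lemma of_singleMap_last [NeZero n] (X : NComplex n A C) (Y : NComplex n B D)
    (t : C ⟶ Y.K.X n) :
    X.IsLift Y (singleMap n (eqToHom X.right ≫ t)) 0 (t ≫ Y.π) := by
  have := NeZero.ne n
  constructor
  · rw [singleMap_f_of_ne _ _ _ (by omega) (by omega)]
    simp
  · simp [singleMap_f_succ, d_last]

end IsLift

lemma HtpyEquiv.refl (X : NComplex n A C) : HtpyEquiv X X :=
  ⟨𝟙 _, 𝟙 _, IsLift.id X, IsLift.id X, ⟨Homotopy.ofEq (by simp)⟩, ⟨Homotopy.ofEq (by simp)⟩⟩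

lemma HtpyEquiv.symm {X Y : NComplex n A C} : HtpyEquiv X Y → HtpyEquiv Y X :=
  fun ⟨f, g, hf, hg, h1, h2⟩ => ⟨g, f, hg, hf, h2, h1⟩

lemma HtpyEquiv.trans {X Y Z : NComplex n A C} :
    HtpyEquiv X Y → HtpyEquiv Y Z → HtpyEquiv X Z := by
  rintro ⟨f, g, hf, hg, ⟨h1⟩, ⟨h2⟩⟩ ⟨f', g', hf', hg', ⟨h1'⟩, ⟨h2'⟩⟩
  refine ⟨f ≫ f', g' ≫ g, (hf.comp hf').congr (by simp) (by simp),
    (hg'.comp hg).congr (by simp) (by simp), ⟨?_⟩, ⟨?_⟩⟩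
  · exact (Homotopy.ofEq (by simp)).trans
      (((h1'.compRightId g).compLeft f).trans h1)
  · exact (Homotopy.ofEq (by simp)).trans
      (((h2.compRightId f').compLeft g').trans h2')

/-- Exactness of the sequences `𝒞(Xₙ₊₁, T) → ⋯ → 𝒞(X₀, T)` in the degrees `1, …, n`. -/
def RightExact (X : NComplex n A C) : Prop :=
  ∀ (T : 𝒞) (i : ℕ), i < n → ∀ g : X.K.X (i + 1) ⟶ T, X.K.d i (i + 1) ≫ g = 0 →
    ∃ g' : X.K.X (i + 2) ⟶ T, X.K.d (i + 1) (i + 2) ≫ g' = g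

/-- For a right exact complex, the square of an endomorphism that is zero at both ends is
null-homotopic. If `r = d s + s d` holds below degree `n + 1`, then `r r = d (s r) + (s r) d` holds
in every degree. -/
lemma RightExact.homotopy_comp_self {X : NComplex n A C} (hX : X.RightExact) (r : X.K ⟶ X.K)
    (h0 : r.f 0 = 0) (h1 : r.f (n + 1) = 0) : Nonempty (Homotopy (r ≫ r) 0) := by
  let I : ∀ i, (X.K.X (i + 1) ⟶ X.K.X i) → Prop := fun i s =>
    i ≤ n → X.K.d i (i + 1) ≫ s ≫ X.K.d i (i + 1) = r.f i ≫ X.K.d i (i + 1)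
  have step : ∀ i (s : {s // I i s}), ∃ s' : {s' // I (i + 1) s'}, i + 1 ≤ n →
      r.f (i + 1) = X.K.d (i + 1) (i + 2) ≫ s'.1 + s.1 ≫ X.K.d i (i + 1) := by
    rintro i ⟨s, hs⟩
    by_cases hi : i + 1 ≤ n
    · obtain ⟨s', hs'⟩ := hX (X.K.X (i + 1)) i (by omega) (r.f (i + 1) - s ≫ X.K.d i (i + 1)) (by
        rw [Preadditive.comp_sub, hs (by omega), r.comm, sub_self])
      refine ⟨⟨s', fun _ => ?_⟩, fun _ => ?_⟩
      · rw [← Category.assoc, hs']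
        simp
      · simp [hs']
    · exact ⟨⟨0, fun h => absurd h hi⟩, fun h => absurd h hi⟩
  choose next hnext using step
  let s : ∀ i, {s // I i s} := fun i => Nat.rec ⟨0, fun _ => by simp [h0]⟩ (fun i s => next i s) i
  have hs0 : (s 0).1 = 0 := rfl
  have hs : ∀ i, i + 1 ≤ n → r.f (i + 1) =
      X.K.d (i + 1) (i + 2) ≫ (s (i + 1)).1 + (s i).1 ≫ X.K.d i (i + 1) :=
    fun i hi => hnext i (s i) hi
  refine homotopy_of_eq_nullMap (fun i => (s i).1 ≫ r.f i) ?_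
  ext i
  rw [add_zero, HomologicalComplex.comp_f]
  cases i with
  | zero => simp [nullMap_f_zero, h0]
  | succ i =>
    rw [nullMap_f_succ, Category.assoc, r.comm]
    rcases lt_trichotomy i n with hi | hi | hi
    · nth_rw 1 [hs i hi]
      simp
    · subst hi
      simp [h1]
    · exact (X.isZero _ (by omega)).eq_of_src _ _

/-- Two right exact complexes are equivalent as soon as there are morphisms in both directions which
are the identity at the ends: if `f g = 1 + r`, then `2 - g f` corrects `g` to a homotopy inverse of
`f`. -/
lemma RightExact.htpyEquiv {X Y : NComplex n A C} (hX : X.RightExact) (hY : Y.RightExact)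
    (f : X.K ⟶ Y.K) (g : Y.K ⟶ X.K) (hf : X.IsLift Y f (𝟙 A) (𝟙 C))
    (hg : Y.IsLift X g (𝟙 A) (𝟙 C)) : HtpyEquiv X Y := by
  obtain ⟨H1⟩ := hX.homotopy_comp_self (f ≫ g - 𝟙 _) (by simp [hf.f_zero, hg.f_zero])
    (by simp [hf.f_last, hg.f_last])
  obtain ⟨H2⟩ := hY.homotopy_comp_self (g ≫ f - 𝟙 _) (by simp [hf.f_zero, hg.f_zero])
    (by simp [hf.f_last, hg.f_last])
  obtain ⟨H1'⟩ := homotopy_sub (Homotopy.refl (𝟙 X.K)) H1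
  obtain ⟨H2'⟩ := homotopy_sub (Homotopy.refl (𝟙 Y.K)) H2
  have hgfg : Y.IsLift X (g ≫ f ≫ g) (𝟙 A) (𝟙 C) :=
    (hg.comp (hf.comp hg)).congr (by simp) (by simp)
  refine ⟨f, (g + g) - g ≫ f ≫ g, hf, ((hg.add hg).sub hgfg).congr (by simp) (by simp), ⟨?_⟩, ⟨?_⟩⟩
  · refine (Homotopy.ofEq ?_).trans (H1'.trans (Homotopy.ofEq (sub_zero _)))
    simp
    abel
  · refine (Homotopy.ofEq ?_).trans (H2'.trans (Homotopy.ofEq (sub_zero _)))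
    simp
    abel

end NComplex

/-! ### Extensions -/

section Extensions

variable {𝒞 : Type u} [Category.{v} 𝒞] (E : 𝒞ᵒᵖ ⥤ 𝒞 ⥤ AddCommGrpCat.{w}) {A B C D : 𝒞}

@[simp]
lemma push_id (δ : Extn E C A) : push E (𝟙 A) δ = δ := by simp [push]

@[simp]
lemma pull_id (δ : Extn E C A) : pull E (𝟙 C) δ = δ := by simp [pull]

variable [Preadditive 𝒞]

lemma push_sub (h : ∀ C, (E.obj C).Additive) (a b : A ⟶ B) (δ : Extn E C A) :
    push E (a - b) δ = push E a δ - push E b δ := by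
  have := h (op C)
  simp [push, Functor.map_sub]

lemma pull_sub (h : E.Additive) (c d : D ⟶ C) (δ : Extn E C A) :
    pull E (c - d) δ = pull E c δ - pull E d δ := by
  simp [pull, op_sub, Functor.map_sub, NatTrans.app_sub]

end Extensions

/-! ### Exangles -/

namespace NComplex

variable {𝒞 : Type u} [Category.{v} 𝒞] [Preadditive 𝒞] {n : ℕ} {A B C D : 𝒞}

/-- Exactness of the sequences `𝒞(T, X₀) → ⋯ → 𝒞(T, Xₙ₊₁)` in the degrees `1, …, n`. -/
def LeftExact (X : NComplex n A C) : Prop :=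
  ∀ (T : 𝒞) (i : ℕ), i < n → ∀ g : T ⟶ X.K.X (i + 1), g ≫ X.K.d (i + 1) (i + 2) = 0 →
    ∃ g' : T ⟶ X.K.X i, g' ≫ X.K.d i (i + 1) = g

lemma RightExact.of_htpyEquiv {X Y : NComplex n A C} (hX : X.RightExact) (h : HtpyEquiv X Y) :
    Y.RightExact := by
  obtain ⟨F, G, -, -, -, ⟨H⟩⟩ := h
  obtain ⟨k, hk⟩ := eq_nullMap_of_homotopy H
  intro T i hi g hg
  obtain ⟨g', hg'⟩ := hX T i hi (F.f (i + 1) ≫ g) (by simp [← F.comm_assoc, hg])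
  have e := HomologicalComplex.congr_hom hk (i + 1)
  rw [HomologicalComplex.add_f_apply, nullMap_f_succ, HomologicalComplex.comp_f,
    HomologicalComplex.id_f] at e
  refine ⟨G.f (i + 2) ≫ g' - k (i + 1) ≫ g, ?_⟩
  have e' := congrArg (fun x => x ≫ g) e
  simp only [Preadditive.add_comp, Category.assoc, hg, comp_zero, add_zero, Category.id_comp,
    ← hg', HomologicalComplex.Hom.comm_assoc] at e'
  rw [Preadditive.comp_sub, e']
  abel

lemma LeftExact.of_htpyEquiv {X Y : NComplex n A C} (hX : X.LeftExact) (h : HtpyEquiv X Y) :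
    Y.LeftExact := by
  obtain ⟨F, G, -, -, -, ⟨H⟩⟩ := h
  obtain ⟨k, hk⟩ := eq_nullMap_of_homotopy H
  intro T i hi g hg
  obtain ⟨g', hg'⟩ := hX T i hi (g ≫ G.f (i + 1)) (by simp [reassoc_of% hg])
  have e := HomologicalComplex.congr_hom hk (i + 1)
  rw [HomologicalComplex.add_f_apply, nullMap_f_succ, HomologicalComplex.comp_f,
    HomologicalComplex.id_f] at e
  refine ⟨g' ≫ F.f i - g ≫ k i, ?_⟩
  have e' := congrArg (fun x => g ≫ x) e
  simp only [Preadditive.comp_add, reassoc_of% hg, zero_comp, zero_add, Category.comp_id] at e'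
  rw [Preadditive.sub_comp, Category.assoc, F.comm, ← Category.assoc, hg', Category.assoc, e',
    Category.assoc]
  abel

/-- The endomorphism of the left end induced by an endomorphism of the complex. -/
def endLeft (X : NComplex n A C) (f : X.K ⟶ X.K) : A ⟶ A :=
  eqToHom X.left.symm ≫ f.f 0 ≫ eqToHom X.left

/-- The endomorphism of the right end induced by an endomorphism of the complex. -/
def endRight (X : NComplex n A C) (f : X.K ⟶ X.K) : C ⟶ C :=
  eqToHom X.right.symm ≫ f.f (n + 1) ≫ eqToHom X.right

lemma isLift_endLeft_endRight (X : NComplex n A C) (f : X.K ⟶ X.K) :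
    X.IsLift X f (X.endLeft f) (X.endRight f) := by
  simp [IsLift, endLeft, endRight]

/-- A term of a complex other than the two ends may be replaced by an isomorphic object. -/
lemma exists_replace (X : NComplex n A C) (j : ℕ) (h0 : j ≠ 0) (hj : j ≤ n) (α : X.K.X j ≅ B) :
    ∃ (Z : NComplex n A C) (F : X.K ⟶ Z.K) (hB : Z.K.X j = B), HtpyEquiv X Z ∧
      X.IsLift Z F (𝟙 A) (𝟙 C) ∧ F.f j ≫ eqToHom hB = α.hom := by
  classical
  let X' : ℕ → 𝒞 := Function.update X.K.X j B
  have hX' : X' j = B := Function.update_self ..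
  have hX'' : ∀ i, i ≠ j → X.K.X i = X' i := fun i hi => (Function.update_of_ne hi ..).symm
  let β : ∀ i, X.K.X i ≅ X' i := fun i =>
    if h : i = j then eqToIso (by rw [h]) ≪≫ α ≪≫ eqToIso (by rw [h, hX'])
    else eqToIso (hX'' i h)
  let K' : CochainComplex 𝒞 ℕ :=
    { X := X'
      d := fun i k => (β i).inv ≫ X.K.d i k ≫ (β k).hom
      shape := fun i k hik => by rw [X.K.shape i k hik]; simp
      d_comp_d' := fun i k l _ _ => by simp }
  let φ : X.K ≅ K' := HomologicalComplex.Hom.isoOfComponents β (fun i k _ => by simp [K'])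
  have hβ0 : ∀ i (h : i ≠ j), β i = eqToIso (hX'' i h) := fun i h => dif_neg h
  let Z : NComplex n A C :=
    { K := K'
      isZero := fun i hi => (X.isZero i hi).of_iso (β i).symm
      left := (hX'' 0 h0.symm).symm.trans X.left
      right := (hX'' (n + 1) (by omega)).symm.trans X.right }
  have hφ : ∀ i, φ.hom.f i = (β i).hom := fun i => rfl
  have hφ' : ∀ i, φ.inv.f i = (β i).inv := fun i => rfl
  refine ⟨Z, φ.hom, hX', ⟨φ.hom, φ.inv, ?_, ?_, ⟨Homotopy.ofEq (by simp)⟩,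
    ⟨Homotopy.ofEq (by simp [Z])⟩⟩, ?_, ?_⟩
  · constructor
    · rw [hφ, hβ0 0 h0.symm]; simp [Z]
    · rw [hφ, hβ0 (n + 1) (by omega)]; simp [Z]
  · constructor
    · rw [hφ', hβ0 0 h0.symm]; simp [Z]
    · rw [hφ', hβ0 (n + 1) (by omega)]; simp [Z]
  · constructor
    · rw [hφ, hβ0 0 h0.symm]; simp [Z]
    · rw [hφ, hβ0 (n + 1) (by omega)]; simp [Z]
  · rw [hφ]
    simp [β]

end NComplex

section Exangles

open NComplex

variable {𝒞 : Type u} [Category.{v} 𝒞] [Preadditive 𝒞]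
  {E : 𝒞ᵒᵖ ⥤ 𝒞 ⥤ AddCommGrpCat.{w}} {n : ℕ} {A B C D : 𝒞}

namespace IsNExangle

variable {X Y : NComplex n A C} {δ : Extn E C A}

lemma rightExact (h : IsNExangle E X δ) : X.RightExact :=
  fun T i hi g hg => (h.exact_right T i hi g).1 hg

lemma leftExact (h : IsNExangle E X δ) : X.LeftExact :=
  fun T i hi g hg => (h.exact_left T i hi g).1 hg

lemma exists_ι_comp (h : IsNExangle E X δ) {T : 𝒞} (a : A ⟶ T) (ha : push E a δ = 0) :
    ∃ g : X.K.X 1 ⟶ T, X.ι ≫ g = a :=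
  (h.exact_right_ext T a).1 ha

lemma exists_comp_π (h : IsNExangle E X δ) {T : 𝒞} (c : T ⟶ C) (hc : pull E c δ = 0) :
    ∃ g : T ⟶ X.K.X n, g ≫ X.π = c :=
  (h.exact_left_ext T c).1 hc

lemma of_exact (hl : X.LeftExact) (hr : X.RightExact)
    (h0 : push E X.ι δ = 0) (h1 : pull E X.π δ = 0)
    (hp : ∀ (T : 𝒞) (a : A ⟶ T), push E a δ = 0 → ∃ g : X.K.X 1 ⟶ T, X.ι ≫ g = a)
    (hq : ∀ (T : 𝒞) (c : T ⟶ C), pull E c δ = 0 → ∃ g : T ⟶ X.K.X n, g ≫ X.π = c) :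
    IsNExangle E X δ where
  push_eq_zero := h0
  pull_eq_zero := h1
  exact_left T i hi g := ⟨hl T i hi g, by rintro ⟨g', rfl⟩; simp⟩
  exact_left_ext T c := ⟨hq T c, by
    rintro ⟨g', rfl⟩
    simp only
    rw [← pull_pull, h1, map_zero]⟩
  exact_right T i hi g := ⟨hr T i hi g, by rintro ⟨g', rfl⟩; simp⟩
  exact_right_ext T a := ⟨hp T a, by
    rintro ⟨g', rfl⟩
    simp only
    rw [← push_push, h0, map_zero]⟩

lemma of_htpyEquiv (h : IsNExangle E X δ) (hXY : HtpyEquiv X Y) : IsNExangle E Y δ := by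
  obtain ⟨F, G, hF, hG, -, -⟩ := id hXY
  have e1 : Y.ι = X.ι ≫ F.f 1 := by rw [hF.ι_comp, Category.id_comp]
  have e2 : Y.π = G.f n ≫ X.π := by rw [hG.comp_π, Category.comp_id]
  refine of_exact (h.leftExact.of_htpyEquiv hXY) (h.rightExact.of_htpyEquiv hXY) ?_ ?_ ?_ ?_
  · rw [e1, ← push_push, h.push_eq_zero, map_zero]
  · rw [e2, ← pull_pull, h.pull_eq_zero, map_zero]
  · intro T a ha
    obtain ⟨g, hg⟩ := h.exists_ι_comp a ha
    exact ⟨G.f 1 ≫ g, by rw [← Category.assoc, hG.ι_comp, Category.id_comp, hg]⟩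
  · intro T c hc
    obtain ⟨g, hg⟩ := h.exists_comp_π c hc
    exact ⟨g ≫ F.f n, by rw [Category.assoc, hF.comp_π, Category.comp_id, hg]⟩

/-- All exangles of the zero extension are equivalent. The morphism in each direction is the
null-homotopic one given by a retraction of the inflation and a section of the deflation. -/
lemma htpyEquiv_of_zero [NeZero n] (hX : IsNExangle E X (0 : Extn E C A))
    (hY : IsNExangle E Y (0 : Extn E C A)) : HtpyEquiv X Y := by
  have key : ∀ {X Y : NComplex n A C}, IsNExangle E X (0 : Extn E C A) →
      IsNExangle E Y (0 : Extn E C A) → ∃ f : X.K ⟶ Y.K, X.IsLift Y f (𝟙 A) (𝟙 C) := by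
    intro X Y hX hY
    obtain ⟨r, hr⟩ := hX.exists_ι_comp (𝟙 A) (map_zero _)
    obtain ⟨t, ht⟩ := hY.exists_comp_π (𝟙 C) (map_zero _)
    exact ⟨_, ((IsLift.of_singleMap_zero X Y r).add (IsLift.of_singleMap_last X Y t)).congr
      (by rw [hr, add_zero]) (by rw [ht, zero_add])⟩
  obtain ⟨f, hf⟩ := key hX hY
  obtain ⟨g, hg⟩ := key hY hX
  exact hX.rightExact.htpyEquiv hY.rightExact f g hf hg

lemma push_endLeft (hE : ∀ C, (E.obj C).Additive) (h : IsNExangle E X δ) {e : X.K ⟶ X.K}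
    (H : Homotopy e (𝟙 _)) : push E (X.endLeft e) δ = δ := by
  obtain ⟨k, hk⟩ := eq_nullMap_of_homotopy H
  have e1 : X.endLeft e - 𝟙 A = X.ι ≫ k 0 ≫ eqToHom X.left := by
    simp [endLeft, hk, nullMap_f_zero, d_zero]
  rw [← sub_eq_zero]
  nth_rw 2 [← push_id E δ]
  rw [← push_sub E hE, e1, ← push_push, h.push_eq_zero, map_zero]

lemma pull_endRight (hE : E.Additive) (h : IsNExangle E X δ) {e : X.K ⟶ X.K}
    (H : Homotopy e (𝟙 _)) : pull E (X.endRight e) δ = δ := by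
  obtain ⟨k, hk⟩ := eq_nullMap_of_homotopy H
  have e1 : X.endRight e - 𝟙 C = (eqToHom X.right.symm ≫ k n) ≫ X.π := by
    have : X.K.d (n + 1) (n + 2) = 0 := (X.isZero _ (by omega)).eq_of_tgt _ _
    simp [endRight, hk, nullMap_f_succ, d_last, this]
  rw [← sub_eq_zero]
  nth_rw 2 [← pull_id E δ]
  rw [← pull_sub E hE, e1, ← pull_pull, h.pull_eq_zero, map_zero]

/-- For an idempotent `p` of `A` with `p_𝔼 δ = δ` and an idempotent `c` of `C` with `c^𝔼 δ = δ`,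
the pair `(p, c)` lifts to an idempotent of `X` homotopic to the identity. The morphisms `1 - p` and
`1 - c` factor through the first and the last differential of `X`, so they extend to contractible
idempotents. -/
lemma exists_idempotent_lift [NeZero n] (hE : ∀ C, (E.obj C).Additive) (hE' : E.Additive)
    (h : IsNExangle E X δ)
    {p : A ⟶ A} {c : C ⟶ C} (hp : p ≫ p = p) (hc : c ≫ c = c) (hpδ : push E p δ = δ)
    (hcδ : pull E c δ = δ) :
    ∃ e : X.K ⟶ X.K, e ≫ e = e ∧ X.IsLift X e p c ∧ Nonempty (Homotopy e (𝟙 _)) := by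
  obtain ⟨s', hs'⟩ := h.exists_ι_comp (𝟙 A - p) (by rw [push_sub E hE, push_id, hpδ, sub_self])
  obtain ⟨t', ht'⟩ := h.exists_comp_π (𝟙 C - c) (by rw [pull_sub E hE', pull_id, hcδ, sub_self])
  obtain ⟨s, hs, hs1⟩ : ∃ s : X.K.X 1 ⟶ A, X.ι ≫ s = 𝟙 A - p ∧ s ≫ (𝟙 A - p) = s :=
    ⟨s' ≫ (𝟙 A - p), by rw [← Category.assoc, hs']; simp [hp], by simp [hp]⟩
  obtain ⟨t, ht, ht1⟩ : ∃ t : C ⟶ X.K.X n, t ≫ X.π = 𝟙 C - c ∧ (𝟙 C - c) ≫ t = t :=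
    ⟨(𝟙 C - c) ≫ t', by rw [Category.assoc, ht']; simp [hc], by
      rw [← Category.assoc]; simp [hc]⟩
  have hs2 : (s ≫ eqToHom X.left.symm) ≫ X.K.d 0 1 ≫ (s ≫ eqToHom X.left.symm) =
      s ≫ eqToHom X.left.symm := by
    simp only [d_zero, Category.assoc, eqToHom_trans_assoc, eqToHom_refl, Category.id_comp]
    rw [← Category.assoc X.ι, hs, ← Category.assoc, hs1]
  have ht2 : (eqToHom X.right ≫ t) ≫ X.K.d n (n + 1) ≫ (eqToHom X.right ≫ t) =
      eqToHom X.right ≫ t := by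
    simp only [d_last, Category.assoc, eqToHom_trans_assoc, eqToHom_refl, Category.id_comp]
    rw [← Category.assoc t, ht, ht1]
  refine ⟨compl 0 n (s ≫ eqToHom X.left.symm) (eqToHom X.right ≫ t),
    compl_idem (Nat.pos_of_ne_zero (NeZero.ne n)) _ _ hs2 ht2, ?_, compl_homotopy _ _⟩
  exact (((IsLift.id X).sub (IsLift.of_singleMap_last X X t)).comp
    ((IsLift.id X).sub (IsLift.of_singleMap_zero X X s))).congr (by simp [hs]) (by simp [ht])

section

variable [HasFiniteBiproducts 𝒞]

lemma isIso_double_d {ι : Type*} {c : ComplexShape ι} {i j : ι} (hij : c.Rel i j) (h : i ≠ j)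
    (A : 𝒞) : IsIso ((HomologicalComplex.double (𝟙 A) hij).d i j) := by
  rw [HomologicalComplex.double_d _ _ h]
  infer_instance

lemma trivFirst [NeZero n] (A : 𝒞) : IsNExangle E (trivFirst n A) (0 : Extn E 0 A) := by
  have := NeZero.ne n
  have h01 : IsIso ((NComplex.trivFirst n A).K.d 0 1) :=
    isIso_double_d (c := ComplexShape.up ℕ) rfl (by omega) A
  have hz : ∀ i, IsZero ((NComplex.trivFirst n A).K.X (i + 2)) := fun i =>
    HomologicalComplex.isZero_double_X (c := ComplexShape.up ℕ) _ rfl _ (by omega) (by omega)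
  have hι : IsIso (NComplex.trivFirst n A).ι := by
    rw [NComplex.ι]
    infer_instance
  refine of_exact ?_ ?_ (map_zero _) (map_zero _) ?_ ?_
  · intro T i _ g hg
    rcases i with _ | i
    · exact ⟨g ≫ inv ((NComplex.trivFirst n A).K.d 0 1), by simp⟩
    · exact ⟨0, (hz i).eq_of_tgt _ _⟩
  · intro T i _ g hg
    rcases i with _ | i
    · refine ⟨0, ?_⟩
      rw [comp_zero]
      exact ((cancel_epi _).1 (hg.trans comp_zero.symm)).symm
    · exact ⟨0, (hz i).eq_of_src _ _⟩
  · intro T a _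
    exact ⟨inv (NComplex.trivFirst n A).ι ≫ a, by simp⟩
  · intro T c _
    exact ⟨0, (isZero_zero 𝒞).eq_of_tgt _ _⟩

lemma trivLast [NeZero n] (A : 𝒞) : IsNExangle E (trivLast n A) (0 : Extn E A 0) := by
  have := NeZero.ne n
  have h01 : IsIso ((NComplex.trivLast n A).K.d n (n + 1)) :=
    isIso_double_d (c := ComplexShape.up ℕ) rfl (by omega) A
  have hz : ∀ i, i < n → IsZero ((NComplex.trivLast n A).K.X i) := fun i hi =>
    HomologicalComplex.isZero_double_X (c := ComplexShape.up ℕ) _ rfl _ (by omega) (by omega)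
  have hπ : IsIso (NComplex.trivLast n A).π := by
    rw [NComplex.π]
    infer_instance
  refine of_exact ?_ ?_ (map_zero _) (map_zero _) ?_ ?_
  · intro T i hi g hg
    obtain hi' | hi' : i + 1 < n ∨ i + 1 = n := by omega
    · exact ⟨0, (hz _ hi').eq_of_tgt _ _⟩
    · subst hi'
      refine ⟨0, ?_⟩
      rw [zero_comp]
      exact ((cancel_mono _).1 (hg.trans zero_comp.symm)).symm
  · intro T i hi g hg
    obtain hi' | hi' : i + 1 < n ∨ i + 1 = n := by omega
    · exact ⟨0, (hz _ hi').eq_of_src _ _⟩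
    · subst hi'
      exact ⟨inv ((NComplex.trivLast (i + 1) A).K.d (i + 1) (i + 2)) ≫ g, by simp⟩
  · intro T a _
    exact ⟨0, (isZero_zero 𝒞).eq_of_src _ _⟩
  · intro T c _
    exact ⟨c ≫ inv (NComplex.trivLast n A).π, by simp⟩

end

end IsNExangle

namespace IsExactRealisation

variable [HasFiniteBiproducts 𝒞] [NeZero n] {s : Assignment E n} (h : IsExactRealisation s)

include h

lemma htpyEquiv_of_mem {δ : Extn E C A} {X Y : NComplex n A C} (hX : X ∈ s δ) (hY : Y ∈ s δ) :
    HtpyEquiv X Y := by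
  obtain ⟨Z, hZ⟩ := h.isClass δ
  rw [hZ] at hX hY
  exact (HtpyEquiv.symm hX).trans hY

lemma mem_of_htpyEquiv {δ : Extn E C A} {X Y : NComplex n A C} (hX : X ∈ s δ)
    (hXY : HtpyEquiv X Y) : Y ∈ s δ := by
  obtain ⟨Z, hZ⟩ := h.isClass δ
  rw [hZ] at hX ⊢
  exact HtpyEquiv.trans hX hXY

lemma exists_mem (δ : Extn E C A) : ∃ X, X ∈ s δ := by
  obtain ⟨Z, hZ⟩ := h.isClass δ
  exact ⟨Z, hZ ▸ HtpyEquiv.refl Z⟩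

lemma isInflation_of_iso {δ : Extn E C A} {X : NComplex n A C} (hX : X ∈ s δ)
    (α : X.K.X 1 ≅ B) : IsInflation s (X.ι ≫ α.hom) := by
  obtain ⟨Z, F, hB, hXZ, hF, e⟩ := X.exists_replace 1 one_ne_zero
    (Nat.one_le_iff_ne_zero.2 (NeZero.ne n)) α
  subst hB
  have : X.ι ≫ α.hom = Z.ι := by
    rw [← e, eqToHom_refl, Category.comp_id, hF.ι_comp, Category.id_comp]
  rw [this]
  exact ⟨δ, Z, h.mem_of_htpyEquiv hX hXZ⟩

lemma isDeflation_of_iso {δ : Extn E C A} {X : NComplex n A C} (hX : X ∈ s δ)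
    (α : X.K.X n ≅ B) : IsDeflation s (α.inv ≫ X.π) := by
  obtain ⟨Z, F, hB, hXZ, hF, e⟩ := X.exists_replace n (NeZero.ne n) le_rfl α
  subst hB
  have : α.inv ≫ X.π = Z.π := by
    rw [Iso.inv_comp_eq, ← e, eqToHom_refl, Category.comp_id, hF.comp_π, Category.comp_id]
  rw [this]
  exact ⟨δ, Z, h.mem_of_htpyEquiv hX hXZ⟩

end IsExactRealisation

end Exangles

namespace NComplex

/-! ### Normalised homotopies -/

section Normalised

variable {𝒞 : Type u} [Category.{v} 𝒞] [Preadditive 𝒞] {n : ℕ} {A B C D : 𝒞}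

/-- A homotopy between two morphisms which agree on the first term can be chosen with vanishing
first component. -/
lemma RightExact.exists_homotopy_first_eq_zero [NeZero n] {X : NComplex n A C} (hX : X.RightExact)
    {L : CochainComplex 𝒞 ℕ} {f g : X.K ⟶ L} (H : Homotopy f g) (h0 : f.f 0 = g.f 0) :
    ∃ k : ∀ i, X.K.X (i + 1) ⟶ L.X i, k 0 = 0 ∧ f = nullMap k + g := by
  obtain ⟨k, hk⟩ := eq_nullMap_of_homotopy H
  have hk' := fun i => HomologicalComplex.congr_hom hk i
  obtain ⟨u, hu⟩ := hX _ 0 (Nat.pos_of_ne_zero (NeZero.ne n)) (k 0) (by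
    have := hk' 0
    rw [HomologicalComplex.add_f_apply, nullMap_f_zero, h0] at this
    simpa using this)
  refine ⟨fun | 0 => 0 | 1 => k 1 + u ≫ L.d 0 1 | i + 2 => k (i + 2), rfl, ?_⟩
  ext i
  rcases i with _ | _ | _ | i
  · rw [HomologicalComplex.add_f_apply, nullMap_f_zero, h0]; simp
  · rw [hk', HomologicalComplex.add_f_apply, HomologicalComplex.add_f_apply, nullMap_f_succ,
      nullMap_f_succ, ← hu]
    simp
  · rw [hk', HomologicalComplex.add_f_apply, HomologicalComplex.add_f_apply, nullMap_f_succ,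
      nullMap_f_succ]
    simp
  · rw [hk', HomologicalComplex.add_f_apply, HomologicalComplex.add_f_apply, nullMap_f_succ,
      nullMap_f_succ]

/-- A homotopy between two morphisms which agree on the last term can be chosen with vanishing
last component. -/
lemma LeftExact.exists_homotopy_last_eq_zero [NeZero n] {Y : NComplex n B D} (hY : Y.LeftExact)
    {X : NComplex n A C} {f g : X.K ⟶ Y.K} (H : Homotopy f g)
    (h1 : f.f (n + 1) = g.f (n + 1)) :
    ∃ k : ∀ i, X.K.X (i + 1) ⟶ Y.K.X i, k n = 0 ∧ f = nullMap k + g := by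
  obtain ⟨k, hk⟩ := eq_nullMap_of_homotopy H
  have hk' := fun i => HomologicalComplex.congr_hom hk i
  obtain ⟨m, rfl⟩ : ∃ m, n = m + 1 := ⟨n - 1, by have := NeZero.ne n; omega⟩
  have hz : X.K.d (m + 2) (m + 3) = 0 := (X.isZero _ (by omega)).eq_of_tgt _ _
  obtain ⟨u, hu⟩ := hY _ m (by omega) (k (m + 1)) (by
    have := hk' (m + 2)
    rw [HomologicalComplex.add_f_apply, nullMap_f_succ, h1, hz] at this
    simpa using this)
  refine ⟨Function.update (Function.update k (m + 1) 0) m (k m + X.K.d (m + 1) (m + 2) ≫ u),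
    by simp, ?_⟩
  ext i
  rw [HomologicalComplex.add_f_apply]
  rcases i with _ | i
  · by_cases h : m = 0
    · subst h
      rw [hk', HomologicalComplex.add_f_apply, nullMap_f_zero, nullMap_f_zero]
      simp
    · rw [hk', HomologicalComplex.add_f_apply, nullMap_f_zero, nullMap_f_zero,
        Function.update_of_ne (by omega), Function.update_of_ne (by omega)]
  · obtain h | h | h | h : i = m + 1 ∨ i = m ∨ i + 1 = m ∨ (i ≠ m + 1 ∧ i ≠ m ∧ i + 1 ≠ m) := by
      omega
    · subst h
      rw [h1, nullMap_f_succ, hz]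
      simp
    · subst h
      rw [hk', HomologicalComplex.add_f_apply, nullMap_f_succ, nullMap_f_succ, ← hu]
      simp [add_comm]
    · subst h
      have h3 : i ≠ i + 1 + 1 := by omega
      rw [hk', HomologicalComplex.add_f_apply, nullMap_f_succ, nullMap_f_succ]
      simp [Function.update_of_ne h3]
    · obtain ⟨h2, h3, h4⟩ := h
      rw [hk', HomologicalComplex.add_f_apply, nullMap_f_succ, nullMap_f_succ,
        Function.update_of_ne h3, Function.update_of_ne h2, Function.update_of_ne h4,
        Function.update_of_ne (by omega)]

end Normalised

/-! ### Mapping cones -/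

section Cone

variable {𝒞 : Type u} [Category.{v} 𝒞] [Preadditive 𝒞] [HasFiniteBiproducts 𝒞] {n : ℕ}
  {A B C D A' B' C' D' : 𝒞}

lemma coneFst_inl_add (X : NComplex n A C) (Y : NComplex n B D) (i : ℕ) :
    coneFst X Y i ≫ coneInl X Y i + coneSnd X Y i ≫ coneInr X Y i = 𝟙 _ := by
  cases i with
  | zero => simp [coneInl, coneFst, coneSnd]
  | succ i =>
    by_cases h : i + 1 ≤ n
    · simp only [coneFst, h, ↓reduceDIte, coneInl, Category.assoc, coneSnd, coneInr]
      rw [← Preadditive.comp_add, ← Category.assoc biprod.fst, ← Category.assoc biprod.snd,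
        ← Preadditive.add_comp, biprod.total]
      simp
    · simp [coneInl, coneFst, coneInr, coneSnd, h]

lemma cone_d (X : NComplex n A C) (Y : NComplex n B D) (f : X.K ⟶ Y.K) (i : ℕ) :
    (X.cone Y f).K.d i (i + 1) = coneD X Y f i :=
  CochainComplex.of_d _ _ _

lemma coneInl_fst_assoc (X : NComplex n A C) (Y : NComplex n B D) (i : ℕ) {T : 𝒞}
    (g : X.K.X (i + 1) ⟶ T) : coneInl X Y i ≫ coneFst X Y i ≫ g = g := by
  rw [← Category.assoc, coneInl_fst, Category.id_comp]

lemma coneInl_snd_assoc (X : NComplex n A C) (Y : NComplex n B D) (i : ℕ) {T : 𝒞}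
    (g : Y.K.X i ⟶ T) : coneInl X Y i ≫ coneSnd X Y i ≫ g = 0 := by
  rw [← Category.assoc, coneInl_snd, zero_comp]

lemma coneInr_fst_assoc (X : NComplex n A C) (Y : NComplex n B D) (i : ℕ) {T : 𝒞}
    (g : X.K.X (i + 1) ⟶ T) : coneInr X Y i ≫ coneFst X Y i ≫ g = 0 := by
  rw [← Category.assoc, coneInr_fst, zero_comp]

lemma coneInr_snd_assoc (X : NComplex n A C) (Y : NComplex n B D) (i : ℕ) {T : 𝒞}
    (g : Y.K.X (i + 1) ⟶ T) : coneInr X Y (i + 1) ≫ coneSnd X Y (i + 1) ≫ g = g := by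
  rw [← Category.assoc, coneInr_snd, Category.id_comp]

lemma coneX_hom_ext (X : NComplex n A C) (Y : NComplex n B D) (i : ℕ) {T : 𝒞}
    {g g' : coneX X Y i ⟶ T} (h1 : coneInl X Y i ≫ g = coneInl X Y i ≫ g')
    (h2 : coneInr X Y i ≫ g = coneInr X Y i ≫ g') : g = g' := by
  rw [← Category.id_comp g, ← Category.id_comp g', ← coneFst_inl_add]
  simp [Preadditive.add_comp, h1, h2]

lemma coneInl_d (X : NComplex n A C) (Y : NComplex n B D) (f : X.K ⟶ Y.K) (i : ℕ) :
    coneInl X Y i ≫ coneD X Y f i =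
      f.f (i + 1) ≫ coneInr X Y (i + 1) - X.K.d (i + 1) (i + 2) ≫ coneInl X Y (i + 1) := by
  simp [coneD, coneInl_fst_assoc, coneInl_snd_assoc]
  abel

lemma coneInr_d (X : NComplex n A C) (Y : NComplex n B D) (f : X.K ⟶ Y.K) (i : ℕ) :
    coneInr X Y (i + 1) ≫ coneD X Y f (i + 1) =
      Y.K.d (i + 1) (i + 2) ≫ coneInr X Y (i + 2) := by
  simp [coneD, coneInr_fst_assoc, coneInr_snd_assoc]

lemma cone_ι (X : NComplex n A C) (Y : NComplex n B D) (f : X.K ⟶ Y.K) :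
    (X.cone Y f).ι = coneInl X Y 0 ≫ coneD X Y f 0 := by
  rw [ι, cone_d]
  rfl

/-- The projection of the mapping cone onto `X₂` in degree `1`. -/
def coneProj (X : NComplex n A C) (Y : NComplex n B D) (f : X.K ⟶ Y.K) :
    (X.cone Y f).K.X 1 ⟶ X.K.X 2 :=
  coneFst X Y 1

lemma cone_ι_proj (X : NComplex n A C) (Y : NComplex n B D) (f : X.K ⟶ Y.K) :
    (X.cone Y f).ι ≫ coneProj X Y f = - X.K.d 1 2 := by
  refine (congrArg (fun x : _ ⟶ coneX X Y 1 => x ≫ coneFst X Y 1) (cone_ι X Y f)).trans ?_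
  simp [coneInl_d, coneInl_fst, coneInr_fst]

section coneMap

variable (X : NComplex n A C) (Y : NComplex n B D) (X' : NComplex n A' C') (Y' : NComplex n B' D')
  (f : X.K ⟶ Y.K) (f' : X'.K ⟶ Y'.K) (a : X'.K ⟶ X.K) (b : Y'.K ⟶ Y.K)
  (H : ∀ i, X'.K.X (i + 1) ⟶ Y.K.X i) (H0 : H 0 = 0)
  (hH : f' ≫ b = nullMap H + a ≫ f)

/-- The degree `i` part of the morphism of mapping cones `coneMap`. -/
def coneMapX (i : ℕ) : coneX X' Y' i ⟶ coneX X Y i :=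
  coneFst X' Y' i ≫ a.f (i + 1) ≫ coneInl X Y i + coneFst X' Y' i ≫ H i ≫ coneInr X Y i +
    coneSnd X' Y' i ≫ b.f i ≫ coneInr X Y i

include H0 hH in
lemma coneMapX_comm (i : ℕ) : coneMapX X Y X' Y' a b H i ≫ coneD X Y f i =
    coneD X' Y' f' i ≫ coneMapX X Y X' Y' a b H (i + 1) := by
  have e := HomologicalComplex.congr_hom hH (i + 1)
  rw [HomologicalComplex.add_f_apply, nullMap_f_succ, HomologicalComplex.comp_f,
    HomologicalComplex.comp_f] at e
  have e' := congrArg (fun x => x ≫ coneInr X Y (i + 1)) e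
  simp only [Category.assoc, Preadditive.add_comp] at e'
  apply coneX_hom_ext
  · rw [← Category.assoc (coneInl X' Y' i) (coneD X' Y' f' i), coneInl_d]
    simp only [coneMapX, Preadditive.add_comp, Preadditive.comp_add, Preadditive.sub_comp,
      Category.assoc, coneInl_d, coneInl_fst_assoc, coneInl_snd_assoc, coneInr_fst_assoc,
      coneInr_snd_assoc, Preadditive.comp_sub, e', HomologicalComplex.Hom.comm_assoc]
    cases i with
    | zero =>
      simp only [H0, zero_comp, comp_zero, add_zero]
      abel
    | succ i =>
      simp only [coneInr_d, comp_zero, add_zero]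
      abel
  · cases i with
    | zero => simp [coneInr]
    | succ i =>
      rw [← Category.assoc (coneInr X' Y' _) (coneD X' Y' f' _), coneInr_d]
      simp [coneMapX, coneInr_fst_assoc, coneInr_snd_assoc, coneInr_d]

/-- The morphism of mapping cones given by a square which commutes up to a homotopy `H`. The cone
lacks the term `Y₀`, which forces the condition `H 0 = 0`. -/
def coneMap : (X'.cone Y' f').K ⟶ (X.cone Y f).K :=
  CochainComplex.ofHom (coneMapX X Y X' Y' a b H) (fun i => by
    rw [cone_d, cone_d]
    exact coneMapX_comm X Y X' Y' f f' a b H H0 hH i)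

lemma isLift_coneMap {b₀ : B' ⟶ B} {b₁ : D' ⟶ D} (hb : Y'.IsLift Y b b₀ b₁) :
    (X'.cone Y' f').IsLift (X.cone Y f) (coneMap X Y X' Y' f f' a b H H0 hH) (a.f 1) b₁ := by
  have h0 (h : coneX X Y 0 = X.K.X 1) (h' : coneX X' Y' 0 = X'.K.X 1) :
      coneMapX X Y X' Y' a b H 0 ≫ eqToHom h = eqToHom h' ≫ a.f 1 := by
    simp [coneMapX, H0, coneFst, coneInl, coneSnd]
  have h1 (h : coneX X Y (n + 1) = D) (h' : coneX X' Y' (n + 1) = D') :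
      coneMapX X Y X' Y' a b H (n + 1) ≫ eqToHom h = eqToHom h' ≫ b₁ := by
    simp [coneMapX, coneFst, hb.f_last, coneSnd, coneInr]
  exact ⟨h0 _ _, h1 _ _⟩

end coneMap

/-- The mapping cone of a lift of `(𝟙, c)` is right exact, provided that a certain condition holds
which only concerns the last terms of `X` and `Y`. -/
lemma RightExact.cone {X : NComplex n A C} {Y : NComplex n A D} (hX : X.RightExact)
    (hY : Y.RightExact) {f : X.K ⟶ Y.K} {c : C ⟶ D} (hf : X.IsLift Y f (𝟙 A) c)
    (hc : ∀ (T : 𝒞) (a : C ⟶ T), X.π ≫ a = 0 → ∃ b : D ⟶ T, Y.π ≫ b = 0 ∧ c ≫ b = a) :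
    (X.cone Y f).RightExact := by
  intro T i hi g hg
  rw [cone_d] at hg ⊢
  change coneX X Y (i + 1) ⟶ T at g
  change ∃ g' : coneX X Y (i + 2) ⟶ T, coneD X Y f (i + 1) ≫ g' = g
  have hg' : coneD X Y f i ≫ g = 0 := hg
  obtain ⟨a, ha⟩ : ∃ a, a = coneInl X Y (i + 1) ≫ g := ⟨_, rfl⟩
  obtain ⟨b, hb⟩ : ∃ b, b = coneInr X Y (i + 1) ≫ g := ⟨_, rfl⟩
  have h1 : f.f (i + 1) ≫ b = X.K.d (i + 1) (i + 2) ≫ a := by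
    have := (coneInl_d X Y f i =≫ g)
    rw [Category.assoc, hg', Preadditive.sub_comp, comp_zero, Category.assoc, Category.assoc,
      eq_comm, sub_eq_zero] at this
    rw [ha, hb, this]
  have h2 : Y.K.d i (i + 1) ≫ b = 0 := by
    cases i with
    | zero =>
      have e : Y.ι = X.ι ≫ f.f 1 := by rw [hf.ι_comp, Category.id_comp]
      rw [d_zero, e, Category.assoc, Category.assoc, h1, ι_d_assoc, comp_zero]
    | succ i =>
      have := (coneInr_d X Y f i =≫ g)
      rw [Category.assoc, hg', comp_zero, Category.assoc] at this
      rw [hb, ← this]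
  obtain ⟨b', hb'⟩ := hY T i hi b h2
  -- The hypothesis `hc` is needed for `i + 1 = n`, where the cone lacks the next term of `X`.
  have key : ∃ (a'' : X.K.X (i + 3) ⟶ T) (b'' : Y.K.X (i + 2) ⟶ T),
      Y.K.d (i + 1) (i + 2) ≫ b'' = b ∧
        f.f (i + 2) ≫ b'' - X.K.d (i + 2) (i + 3) ≫ a'' = a := by
    have h3 : X.K.d (i + 1) (i + 2) ≫ (f.f (i + 2) ≫ b' - a) = 0 := by
      rw [Preadditive.comp_sub, ← h1, ← f.comm_assoc, hb', sub_self]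
    obtain hi' | hi' : i + 1 < n ∨ i + 1 = n := by omega
    · obtain ⟨a'', ha''⟩ := hX T (i + 1) hi' _ h3
      exact ⟨a'', b', hb', by rw [ha'']; abel⟩
    · subst hi'
      obtain ⟨b₁, hb₁, hb₂⟩ := hc T (eqToHom X.right.symm ≫ (f.f (i + 2) ≫ b' - a))
        (by simpa [π] using h3)
      refine ⟨0, b' - eqToHom Y.right ≫ b₁, ?_, ?_⟩
      · rw [Preadditive.comp_sub, hb', ← Category.assoc]
        exact (congrArg (b - ·) hb₁).trans (sub_zero b)
      · rw [comp_zero, sub_zero, Preadditive.comp_sub, ← Category.assoc (f.f _), hf.2,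
          Category.assoc, hb₂]
        simp
  obtain ⟨a'', b'', e1, e2⟩ := key
  refine ⟨coneFst X Y (i + 2) ≫ a'' + coneSnd X Y (i + 2) ≫ b'', ?_⟩
  apply coneX_hom_ext
  · rw [← Category.assoc, coneInl_d, ← ha, ← e2]
    simp [coneInl_fst_assoc, coneInl_snd_assoc, coneInr_fst_assoc, coneInr_snd_assoc]
    abel
  · rw [← Category.assoc, coneInr_d, ← hb, ← e1]
    simp [coneInr_fst_assoc, coneInr_snd_assoc]

/-- The condition in `RightExact.cone` is necessary. -/
lemma RightExact.exists_of_cone [NeZero n] {X : NComplex n A C} {Y : NComplex n B D}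
    {f : X.K ⟶ Y.K} (h : (X.cone Y f).RightExact) {b : A ⟶ B} {c : C ⟶ D} (hf : X.IsLift Y f b c)
    {T : 𝒞} (a : C ⟶ T) (ha : X.π ≫ a = 0) : ∃ b : D ⟶ T, Y.π ≫ b = 0 ∧ c ≫ b = a := by
  obtain ⟨m, rfl⟩ : ∃ m, n = m + 1 := ⟨n - 1, by have := NeZero.ne n; omega⟩
  have hd : coneD X Y f m ≫ coneFst X Y (m + 1) ≫ eqToHom X.right ≫ a = 0 := by
    apply coneX_hom_ext
    · rw [← Category.assoc, coneInl_d]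
      have := X.d_last
      simp only [π] at ha
      simp [coneInl_fst_assoc, coneInr_fst_assoc, ← ha]
    · cases m with
      | zero => simp [coneInr]
      | succ m => rw [← Category.assoc, coneInr_d]; simp [coneInr_fst_assoc]
  obtain ⟨g, hg⟩ : ∃ g : coneX X Y (m + 2) ⟶ T, coneD X Y f (m + 1) ≫ g =
      coneFst X Y (m + 1) ≫ eqToHom X.right ≫ a := by
    have := h T m (by omega) (coneFst X Y (m + 1) ≫ eqToHom X.right ≫ a)
    rw [cone_d, cone_d] at this
    exact this hd
  refine ⟨eqToHom Y.right.symm ≫ coneInr X Y (m + 2) ≫ g, ?_, ?_⟩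
  · have := coneInr_d X Y f m =≫ g
    rw [Category.assoc, hg, coneInr_fst_assoc] at this
    simpa [π] using this.symm
  · have := coneInl_d X Y f (m + 1) =≫ g
    have hz : X.K.d (m + 2) (m + 3) = 0 := (X.isZero _ (by omega)).eq_of_tgt _ _
    rw [Category.assoc, hg, coneInl_fst_assoc, hz, zero_comp, sub_zero, hf.f_last] at this
    rw [← cancel_epi (eqToHom X.right), this]
    simp

end Cone

end NComplex

section Realisation

open NComplex

variable {𝒞 : Type u} [Category.{v} 𝒞] [Preadditive 𝒞] [HasFiniteBiproducts 𝒞]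
  {E : 𝒞ᵒᵖ ⥤ 𝒞 ⥤ AddCommGrpCat.{w}} {n : ℕ} [NeZero n] {A B C D : 𝒞} {s : Assignment E n}

/-- If the mapping cone of one lift of `(𝟙, c)` realises `(d₀)_𝔼 δ`, then so does the mapping cone
of any other lift which is homotopic to it along equivalences of the complexes. -/
lemma IsExactRealisation.cone_mem (h : IsExactRealisation s) (hE : ∀ C, (E.obj C).Additive)
    (δ : Extn E D A) (c : C ⟶ D)
    {X X' : NComplex n A C} (hX : X ∈ s (pull E c δ)) (hX' : X' ∈ s (pull E c δ))
    {Y Y' : NComplex n A D} (hY' : Y' ∈ s δ)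
    {f : X.K ⟶ Y.K} (hf : X.IsLift Y f (𝟙 A) c) {f' : X'.K ⟶ Y'.K} (hf' : X'.IsLift Y' f' (𝟙 A) c)
    (hcone : X.cone Y f ∈ s (push E X.ι δ))
    {α : X'.K ⟶ X.K} (hα : X'.IsLift X α (𝟙 A) (𝟙 C))
    {β : X.K ⟶ X'.K} (hβ : X.IsLift X' β (𝟙 A) (𝟙 C))
    {γ : Y'.K ⟶ Y.K} (hγ : Y'.IsLift Y γ (𝟙 A) (𝟙 D))
    {ε : Y.K ⟶ Y'.K} (hε : Y.IsLift Y' ε (𝟙 A) (𝟙 D))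
    (H1 : Homotopy (α ≫ β) (𝟙 _)) (H2 : Homotopy (f' ≫ γ) (α ≫ f))
    (H3 : Homotopy (f ≫ ε) (β ≫ f')) : X'.cone Y' f' ∈ s (push E X'.ι δ) := by
  have hXr := (h.isNExangle _ X hX).rightExact
  have hXr' := (h.isNExangle _ X' hX').rightExact
  obtain ⟨k₁, hk₁, e₁⟩ := hXr'.exists_homotopy_first_eq_zero H1 (by simp [hα.f_zero, hβ.f_zero])
  obtain ⟨k₂, hk₂, e₂⟩ := hXr'.exists_homotopy_first_eq_zero H2
    (by simp [hα.f_zero, hf.f_zero, hf'.f_zero, hγ.f_zero])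
  obtain ⟨k₃, hk₃, e₃⟩ := hXr.exists_homotopy_first_eq_zero H3
    (by simp [hβ.f_zero, hf.f_zero, hf'.f_zero, hε.f_zero])
  have hF := isLift_coneMap X Y X' Y' f f' α γ k₂ hk₂ e₂ hγ
  have hG := isLift_coneMap X' Y' X Y f' f β ε k₃ hk₃ e₃ hε
  obtain ⟨W, hW⟩ := h.exists_mem (push E X'.ι δ)
  have hWr := h.isNExangle _ W hW
  obtain ⟨L, hL⟩ := h.exists_lift (push E X.ι δ) (push E X'.ι δ) (β.f 1) (𝟙 D)
    (by rw [push_push, hβ.ι_comp, pull_id, Category.id_comp]) _ hcone W hW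
  obtain ⟨L', hL'⟩ := h.exists_lift (push E X'.ι δ) (push E X.ι δ) (α.f 1) (𝟙 D)
    (by rw [push_push, hα.ι_comp, pull_id, Category.id_comp]) W hW _ hcone
  have e₁' : α.f 1 ≫ β.f 1 = X'.K.d 1 2 ≫ k₁ 1 + 𝟙 _ := by
    have := HomologicalComplex.congr_hom e₁ 1
    rw [HomologicalComplex.add_f_apply, nullMap_f_succ, hk₁] at this
    simpa using this
  -- The two comparison morphisms are `α₁ β₁` in degree `0`; a null-homotopic summand corrects this.
  obtain ⟨q, hq⟩ := hWr.exists_ι_comp (𝟙 _ - α.f 1 ≫ β.f 1) (by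
    rw [push_sub E hE, push_id, push_push, ← Category.assoc, hα.ι_comp, Category.id_comp,
      hβ.ι_comp, Category.id_comp, sub_self])
  have hd : (X'.cone Y' f').ι ≫ coneProj X' Y' f' ≫ k₁ 1 = 𝟙 _ - α.f 1 ≫ β.f 1 := by
    rw [← Category.assoc, cone_ι_proj, e₁']
    simp
  have hcr := (h.isNExangle _ _ hcone).rightExact
  refine h.mem_of_htpyEquiv hW (hWr.rightExact.htpyEquiv ?_ _ _
    (((hL'.comp hG).add (IsLift.of_singleMap_zero W (X'.cone Y' f') q)).congr ?_ ?_)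
    (((hF.comp hL).add (IsLift.of_singleMap_zero (X'.cone Y' f') W
      (coneProj X' Y' f' ≫ k₁ 1))).congr ?_ ?_))
  · refine RightExact.cone hXr' (h.isNExangle _ Y' hY').rightExact hf' ?_
    intro T a ha
    obtain ⟨b, hb1, hb2⟩ := hcr.exists_of_cone hf a (by
      rw [← Category.comp_id X.π, ← hβ.comp_π, Category.assoc, ha, comp_zero])
    exact ⟨b, by rw [← Category.comp_id Y'.π, ← hγ.comp_π, Category.assoc, hb1, comp_zero], hb2⟩
  · rw [hq]; simp
  · simp
  · rw [hd]; simp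
  · simp

end Realisation

namespace NComplex

/-! ### Mapping cocones -/

section Cocone

variable {𝒞 : Type u} [Category.{v} 𝒞] [Preadditive 𝒞] [HasFiniteBiproducts 𝒞] {n : ℕ}
  {A B C D A' B' C' D' : 𝒞}

lemma coconeX_hom_ext_zero (X : NComplex n A C) (Y : NComplex n B D) {T : 𝒞}
    {g g' : coconeX X Y 0 ⟶ T} (h : coconeInl X Y 0 ≫ g = coconeInl X Y 0 ≫ g') : g = g' := by
  simp only [coconeInl] at h
  exact (cancel_epi (eqToHom (coconeX_zero X Y).symm)).1 h

lemma coconeX_hom_ext_succ (X : NComplex n A C) (Y : NComplex n B D) (i : ℕ) {T : 𝒞}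
    {g g' : coconeX X Y (i + 1) ⟶ T}
    (h1 : coconeInl X Y (i + 1) ≫ g = coconeInl X Y (i + 1) ≫ g')
    (h2 : coconeInr X Y i ≫ g = coconeInr X Y i ≫ g') : g = g' := by
  by_cases h : i + 1 ≤ n
  · simp only [coconeInl, h, ↓reduceDIte, coconeInr, Category.assoc] at h1 h2
    rw [← cancel_epi (eqToHom (coconeX_of_le X Y h).symm)]
    exact biprod.hom_ext' _ _ h1 h2
  · by_cases h' : i = n
    · rw [coconeInr, dif_neg h, dif_pos h'] at h2
      exact (cancel_epi (eqToHom (coconeX_of_eq X Y h').symm)).1 h2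
    · exact (isZero_coconeX X Y _ (by omega)).eq_of_src _ _

lemma cocone_d (X : NComplex n A C) (Y : NComplex n B D) (f : X.K ⟶ Y.K) (i : ℕ) :
    (X.cocone Y f).K.d i (i + 1) = coconeD X Y f i :=
  CochainComplex.of_d _ _ _

lemma coconeInl_last (X : NComplex n A C) (Y : NComplex n B D) : coconeInl X Y (n + 1) = 0 := by
  simp [coconeInl]

lemma coconeInl_fst_assoc (X : NComplex n A C) (Y : NComplex n B D) {i : ℕ} (hi : i ≤ n) {T : 𝒞}
    (g : X.K.X i ⟶ T) : coconeInl X Y i ≫ coconeFst X Y i ≫ g = g := by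
  rw [← Category.assoc, coconeInl_fst X Y i hi, Category.id_comp]

lemma coconeInl_snd_assoc (X : NComplex n A C) (Y : NComplex n B D) (i : ℕ) {T : 𝒞}
    (g : Y.K.X i ⟶ T) : coconeInl X Y (i + 1) ≫ coconeSnd X Y i ≫ g = 0 := by
  rw [← Category.assoc, coconeInl_snd, zero_comp]

lemma coconeInr_fst_assoc (X : NComplex n A C) (Y : NComplex n B D) (i : ℕ) {T : 𝒞}
    (g : X.K.X (i + 1) ⟶ T) : coconeInr X Y i ≫ coconeFst X Y (i + 1) ≫ g = 0 := by
  rw [← Category.assoc, coconeInr_fst, zero_comp]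

lemma coconeInr_snd_assoc (X : NComplex n A C) (Y : NComplex n B D) {i : ℕ} (hi : i ≤ n) {T : 𝒞}
    (g : Y.K.X i ⟶ T) : coconeInr X Y i ≫ coconeSnd X Y i ≫ g = g := by
  rw [← Category.assoc, coconeInr_snd X Y i hi, Category.id_comp]

lemma coconeInl_d (X : NComplex n A C) (Y : NComplex n B D) (f : X.K ⟶ Y.K) {i : ℕ} (hi : i ≤ n) :
    coconeInl X Y i ≫ coconeD X Y f i =
      X.K.d i (i + 1) ≫ coconeInl X Y (i + 1) + f.f i ≫ coconeInr X Y i := by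
  cases i <;> simp [coconeD, coconeInl_fst_assoc X Y hi, coconeInl_snd_assoc]

lemma coconeInr_d (X : NComplex n A C) (Y : NComplex n B D) (f : X.K ⟶ Y.K) {i : ℕ} (hi : i ≤ n) :
    coconeInr X Y i ≫ coconeD X Y f (i + 1) = - Y.K.d i (i + 1) ≫ coconeInr X Y (i + 1) := by
  simp [coconeD, coconeInr_fst_assoc, coconeInr_snd_assoc X Y hi]

/-- The inclusion of `Yᵢ` into the mapping cocone. -/
def coconeInj (X : NComplex n A C) (Y : NComplex n B D) (f : X.K ⟶ Y.K) (i : ℕ) :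
    Y.K.X i ⟶ (X.cocone Y f).K.X (i + 1) :=
  coconeInr X Y i

lemma coconeInj_π {n : ℕ} (X : NComplex (n + 1) A C) (Y : NComplex (n + 1) B D) (f : X.K ⟶ Y.K) :
    coconeInj X Y f n ≫ (X.cocone Y f).π = - Y.K.d n (n + 1) := by
  have e (h : coconeX X Y (n + 2) = Y.K.X (n + 1)) :
      coconeInr X Y n ≫ coconeD X Y f (n + 1) ≫ eqToHom h = - Y.K.d n (n + 1) := by
    rw [← Category.assoc, coconeInr_d X Y f (by omega)]
    simp [coconeInr]
  rw [π, cocone_d]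
  exact e _

section coconeMap

variable (X : NComplex n A C) (Y : NComplex n B D) (X' : NComplex n A' C') (Y' : NComplex n B' D')
  (f : X.K ⟶ Y.K) (f' : X'.K ⟶ Y'.K) (a : X'.K ⟶ X.K) (b : Y'.K ⟶ Y.K)
  (H : ∀ i, X'.K.X (i + 1) ⟶ Y.K.X i) (H0 : H n = 0)
  (hH : f' ≫ b = nullMap H + a ≫ f)

/-- The degree `i` part of the morphism of mapping cocones `coconeMap`. -/
def coconeMapX : ∀ i, coconeX X' Y' i ⟶ coconeX X Y i
  | 0 => coconeFst X' Y' 0 ≫ a.f 0 ≫ coconeInl X Y 0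
  | i + 1 => coconeFst X' Y' (i + 1) ≫ a.f (i + 1) ≫ coconeInl X Y (i + 1) -
      coconeFst X' Y' (i + 1) ≫ H i ≫ coconeInr X Y i + coconeSnd X' Y' i ≫ b.f i ≫ coconeInr X Y i

lemma coconeInl_mapX_zero :
    coconeInl X' Y' 0 ≫ coconeMapX X Y X' Y' a b H 0 = a.f 0 ≫ coconeInl X Y 0 := by
  simp [coconeMapX, coconeInl_fst_assoc]

include H0 in
lemma coconeInl_mapX_succ {i : ℕ} (hi : i ≤ n) :
    coconeInl X' Y' (i + 1) ≫ coconeMapX X Y X' Y' a b H (i + 1) =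
      a.f (i + 1) ≫ coconeInl X Y (i + 1) - H i ≫ coconeInr X Y i := by
  obtain hi | rfl := Nat.lt_or_eq_of_le hi
  · simp [coconeMapX, coconeInl_fst_assoc X' Y' (show i + 1 ≤ n by omega), coconeInl_snd_assoc]
  · simp [coconeInl_last, H0]

lemma coconeInr_mapX {i : ℕ} (hi : i ≤ n) :
    coconeInr X' Y' i ≫ coconeMapX X Y X' Y' a b H (i + 1) = b.f i ≫ coconeInr X Y i := by
  simp [coconeMapX, coconeInr_fst_assoc, coconeInr_snd_assoc X' Y' hi]

include H0 hH in
lemma coconeMapX_comm (i : ℕ) : coconeMapX X Y X' Y' a b H i ≫ coconeD X Y f i =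
    coconeD X' Y' f' i ≫ coconeMapX X Y X' Y' a b H (i + 1) := by
  by_cases hi : i ≤ n
  swap
  · exact (isZero_coconeX X Y _ (by omega)).eq_of_tgt _ _
  have e := HomologicalComplex.congr_hom hH i =≫ coconeInr X Y i
  rw [HomologicalComplex.add_f_apply, HomologicalComplex.comp_f, HomologicalComplex.comp_f] at e
  cases i with
  | zero =>
    rw [nullMap_f_zero] at e
    simp only [Category.assoc, Preadditive.add_comp] at e
    apply coconeX_hom_ext_zero
    rw [← Category.assoc, coconeInl_mapX_zero, ← Category.assoc, coconeInl_d _ _ _ hi,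
      Preadditive.add_comp, Category.assoc, Category.assoc, Category.assoc,
      coconeInl_mapX_succ X Y X' Y' a b H H0 hi, coconeInr_mapX X Y X' Y' a b H hi,
      coconeInl_d _ _ _ hi, e]
    simp
    abel
  | succ i =>
    rw [nullMap_f_succ] at e
    simp only [Category.assoc, Preadditive.add_comp] at e
    apply coconeX_hom_ext_succ
    · rw [← Category.assoc, coconeInl_mapX_succ X Y X' Y' a b H H0 (by omega), ← Category.assoc,
        coconeInl_d _ _ _ hi, Preadditive.add_comp, Category.assoc, Category.assoc,
        coconeInl_mapX_succ X Y X' Y' a b H H0 hi, coconeInr_mapX X Y X' Y' a b H hi, e,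
        Preadditive.sub_comp, Category.assoc, Category.assoc, coconeInl_d _ _ _ hi,
        coconeInr_d _ _ _ (by omega)]
      simp
      abel
    · rw [← Category.assoc, coconeInr_mapX X Y X' Y' a b H (by omega), ← Category.assoc,
        coconeInr_d _ _ _ (by omega), Category.assoc, coconeInr_d _ _ _ (by omega),
        Preadditive.neg_comp, Category.assoc, coconeInr_mapX X Y X' Y' a b H hi]
      simp

/-- The morphism of mapping cocones given by a square which commutes up to a homotopy `H`. The
cocone lacks the term `Xₙ₊₁`, which forces the condition `H n = 0`. -/
def coconeMap : (X'.cocone Y' f').K ⟶ (X.cocone Y f).K :=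
  CochainComplex.ofHom (coconeMapX X Y X' Y' a b H) (fun i => by
    rw [cocone_d, cocone_d]
    exact coconeMapX_comm X Y X' Y' f f' a b H H0 hH i)

lemma isLift_coconeMap {a₀ : A' ⟶ A} {a₁ : C' ⟶ C} (ha : X'.IsLift X a a₀ a₁) :
    (X'.cocone Y' f').IsLift (X.cocone Y f) (coconeMap X Y X' Y' f f' a b H H0 hH) a₀ (b.f n) := by
  have h0 (h : coconeX X Y 0 = A) (h' : coconeX X' Y' 0 = A') :
      coconeMapX X Y X' Y' a b H 0 ≫ eqToHom h = eqToHom h' ≫ a₀ := by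
    simp [coconeMapX, coconeFst, coconeInl, ha.f_zero]
  have h1 (h : coconeX X Y (n + 1) = Y.K.X n) (h' : coconeX X' Y' (n + 1) = Y'.K.X n) :
      coconeMapX X Y X' Y' a b H (n + 1) ≫ eqToHom h = eqToHom h' ≫ b.f n := by
    simp [coconeMapX, coconeFst, coconeSnd, coconeInr]
  exact ⟨h0 _ _, h1 _ _⟩

end coconeMap

/-- The mapping cocone of any lift of `(a, 𝟙)` is right exact. -/
lemma RightExact.cocone {X : NComplex n A C} {Y : NComplex n B C} (hX : X.RightExact)
    (hY : Y.RightExact) {f : X.K ⟶ Y.K} {a : A ⟶ B} (hf : X.IsLift Y f a (𝟙 C))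
    (ha : ∀ (T : 𝒞) (y : B ⟶ T) (x : X.K.X 1 ⟶ T), X.ι ≫ x = a ≫ y → ∃ y', Y.ι ≫ y' = y) :
    (X.cocone Y f).RightExact := by
  intro T i hi g hg
  rw [cocone_d] at hg ⊢
  change coconeX X Y (i + 1) ⟶ T at g
  change ∃ g' : coconeX X Y (i + 2) ⟶ T, coconeD X Y f (i + 1) ≫ g' = g
  have hg' : coconeD X Y f i ≫ g = 0 := hg
  obtain ⟨x, hx⟩ : ∃ x, x = coconeInl X Y (i + 1) ≫ g := ⟨_, rfl⟩
  obtain ⟨y, hy⟩ : ∃ y, y = coconeInr X Y i ≫ g := ⟨_, rfl⟩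
  have h1 : X.K.d i (i + 1) ≫ x = - f.f i ≫ y := by
    have := (coconeInl_d X Y f hi.le =≫ g)
    rw [Category.assoc, hg', Preadditive.add_comp, comp_zero, Category.assoc, Category.assoc, ← hx,
      ← hy] at this
    exact eq_neg_of_add_eq_zero_left this.symm
  obtain ⟨y', hy'⟩ : ∃ y', Y.K.d i (i + 1) ≫ y' = y := by
    cases i with
    | zero =>
      obtain ⟨y', hy'⟩ := ha T (eqToHom Y.left.symm ≫ y) (-x) (by
        rw [d_zero, hf.f_zero, Category.assoc] at h1
        rw [← cancel_epi (eqToHom X.left), Preadditive.comp_neg, Preadditive.comp_neg, h1]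
        simp)
      exact ⟨y', by rw [d_zero, Category.assoc, hy']; simp⟩
    | succ i =>
      refine hY T i (by omega) y ?_
      have := (coconeInr_d X Y f (show i ≤ n by omega) =≫ g)
      rw [Category.assoc, hg', comp_zero, Preadditive.neg_comp, Category.assoc, ← hy] at this
      rw [← neg_eq_zero, ← this]
  obtain ⟨x', hx'⟩ := hX T i hi (x + f.f (i + 1) ≫ y') (by
    rw [Preadditive.comp_add, h1, ← f.comm_assoc, hy']
    simp)
  -- For `i + 1 = n` the cocone lacks the next term of `X`, but `f` is the identity there.
  have key : ∃ (x'' : X.K.X (i + 2) ⟶ T) (y'' : Y.K.X (i + 1) ⟶ T), Y.K.d i (i + 1) ≫ y'' = y ∧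
      X.K.d (i + 1) (i + 2) ≫ x'' = x + f.f (i + 1) ≫ y'' ∧ (i + 1 = n → x'' = 0) := by
    by_cases hi' : i + 1 = n
    · subst hi'
      refine ⟨0, y' - Y.K.d (i + 1) (i + 2) ≫ eqToHom Y.right ≫ eqToHom X.right.symm ≫ x',
        by simp [hy'], ?_, fun _ => rfl⟩
      have e := hf.f_last
      rw [Preadditive.comp_sub, f.comm_assoc, e]
      simp only [Category.id_comp, Category.assoc, eqToHom_trans_assoc, eqToHom_refl]
      rw [hx']
      simp
    · exact ⟨x', y', hy', hx', fun h => absurd h hi'⟩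
  obtain ⟨x'', y'', e1, e2, e3⟩ := key
  have e4 : coconeInl X Y (i + 2) ≫ coconeFst X Y (i + 2) ≫ x'' = x'' := by
    by_cases hi' : i + 1 = n
    · rw [e3 hi']; simp
    · exact coconeInl_fst_assoc X Y (by omega) _
  refine ⟨coconeFst X Y (i + 2) ≫ x'' - coconeSnd X Y (i + 1) ≫ y'', ?_⟩
  apply coconeX_hom_ext_succ
  · rw [← Category.assoc, coconeInl_d _ _ _ (by omega), ← hx, Preadditive.comp_sub,
      Preadditive.add_comp, Preadditive.add_comp, Category.assoc, Category.assoc, Category.assoc,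
      Category.assoc, e4, e2, coconeInr_fst_assoc, coconeInl_snd_assoc,
      coconeInr_snd_assoc _ _ (by omega)]
    simp
  · rw [← Category.assoc, coconeInr_d _ _ _ (by omega), ← hy, Preadditive.comp_sub,
      Preadditive.neg_comp, Preadditive.neg_comp, Category.assoc, Category.assoc,
      coconeInr_fst_assoc, coconeInr_snd_assoc _ _ (by omega), e1]
    simp

end Cocone

end NComplex

section Realisation

open NComplex

variable {𝒞 : Type u} [Category.{v} 𝒞] [Preadditive 𝒞] [HasFiniteBiproducts 𝒞]
  {E : 𝒞ᵒᵖ ⥤ 𝒞 ⥤ AddCommGrpCat.{w}} {n : ℕ} [NeZero n] {A B C D : 𝒞} {s : Assignment E n}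

/-- If the mapping cocone of one lift of `(a, 𝟙)` realises `(dₙ)^𝔼 δ`, then so does the mapping
cocone of any other lift which is homotopic to it along equivalences of the complexes. -/
lemma IsExactRealisation.cocone_mem (h : IsExactRealisation s) (hE : E.Additive)
    (δ : Extn E C A) (a : A ⟶ B)
    {X X' : NComplex n A C} (hX' : X' ∈ s δ)
    {Y Y' : NComplex n B C} (hY : Y ∈ s (push E a δ)) (hY' : Y' ∈ s (push E a δ))
    {f : X.K ⟶ Y.K} (hf : X.IsLift Y f a (𝟙 C)) {f' : X'.K ⟶ Y'.K} (hf' : X'.IsLift Y' f' a (𝟙 C))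
    (hcocone : X.cocone Y f ∈ s (pull E Y.π δ))
    {α : X'.K ⟶ X.K} (hα : X'.IsLift X α (𝟙 A) (𝟙 C))
    {β : X.K ⟶ X'.K} (hβ : X.IsLift X' β (𝟙 A) (𝟙 C))
    {γ : Y'.K ⟶ Y.K} (hγ : Y'.IsLift Y γ (𝟙 B) (𝟙 C))
    {ε : Y.K ⟶ Y'.K} (hε : Y.IsLift Y' ε (𝟙 B) (𝟙 C))
    (H1 : Homotopy (γ ≫ ε) (𝟙 _)) (H2 : Homotopy (f' ≫ γ) (α ≫ f))
    (H3 : Homotopy (f ≫ ε) (β ≫ f')) : X'.cocone Y' f' ∈ s (pull E Y'.π δ) := by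
  have hYl := (h.isNExangle _ Y hY).leftExact
  have hYl' := (h.isNExangle _ Y' hY').leftExact
  obtain ⟨k₁, hk₁, e₁⟩ := hYl'.exists_homotopy_last_eq_zero H1 (by simp [hγ.f_last, hε.f_last])
  obtain ⟨k₂, hk₂, e₂⟩ := hYl.exists_homotopy_last_eq_zero H2
    (by simp [hα.f_last, hf.f_last, hf'.f_last, hγ.f_last])
  obtain ⟨k₃, hk₃, e₃⟩ := hYl'.exists_homotopy_last_eq_zero H3
    (by simp [hβ.f_last, hf.f_last, hf'.f_last, hε.f_last])
  have hF := isLift_coconeMap X Y X' Y' f f' α γ k₂ hk₂ e₂ hα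
  have hG := isLift_coconeMap X' Y' X Y f' f β ε k₃ hk₃ e₃ hβ
  obtain ⟨W, hW⟩ := h.exists_mem (pull E Y'.π δ)
  have hWr := h.isNExangle _ W hW
  obtain ⟨L, hL⟩ := h.exists_lift (pull E Y.π δ) (pull E Y'.π δ) (𝟙 A) (ε.f n)
    (by rw [pull_pull, hε.comp_π, push_id, Category.comp_id]) _ hcocone W hW
  obtain ⟨L', hL'⟩ := h.exists_lift (pull E Y'.π δ) (pull E Y.π δ) (𝟙 A) (γ.f n)
    (by rw [pull_pull, hγ.comp_π, push_id, Category.comp_id]) W hW _ hcocone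
  -- The two comparison morphisms are `γₙ εₙ` in degree `n + 1`; a null-homotopic summand corrects
  -- this.
  obtain ⟨q, hq⟩ := hWr.exists_comp_π (𝟙 _ - γ.f n ≫ ε.f n) (by
    rw [pull_sub E hE, pull_id, pull_pull, Category.assoc, hε.comp_π, Category.comp_id,
      hγ.comp_π, Category.comp_id, sub_self])
  have hd : ∃ t : Y'.K.X n ⟶ (X'.cocone Y' f').K.X n,
      t ≫ (X'.cocone Y' f').π = 𝟙 _ - γ.f n ≫ ε.f n := by
    obtain ⟨m, rfl⟩ : ∃ m, n = m + 1 := ⟨n - 1, by have := NeZero.ne n; omega⟩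
    refine ⟨k₁ m ≫ coconeInj X' Y' f' m, ?_⟩
    have := HomologicalComplex.congr_hom e₁ (m + 1)
    rw [HomologicalComplex.add_f_apply, nullMap_f_succ, hk₁, HomologicalComplex.comp_f] at this
    rw [Category.assoc, coconeInj_π, this]
    simp
  obtain ⟨t, ht⟩ := hd
  refine h.mem_of_htpyEquiv hW (hWr.rightExact.htpyEquiv ?_ _ _
    (((hL'.comp hG).add (IsLift.of_singleMap_last W (X'.cocone Y' f') t)).congr ?_ ?_)
    (((hF.comp hL).add (IsLift.of_singleMap_last (X'.cocone Y' f') W q)).congr ?_ ?_))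
  · refine RightExact.cocone (h.isNExangle _ X' hX').rightExact
      (h.isNExangle _ Y' hY').rightExact hf' ?_
    intro T y x hxy
    refine (h.isNExangle _ Y' hY').exists_ι_comp y ?_
    rw [push_push, ← hxy, ← push_push, (h.isNExangle _ X' hX').push_eq_zero, map_zero]
  · simp
  · rw [ht]; simp
  · simp
  · rw [hq]; simp

end Realisation

/-! ### Complexes over the idempotent completion -/

section KaroubiComplex

open NComplex

variable {𝒞 : Type u} [Category.{v} 𝒞]

section

variable (E : 𝒞ᵒᵖ ⥤ 𝒞 ⥤ AddCommGrpCat.{w}) {A B C D : Karoubi 𝒞}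

lemma underlying_injective {δ ρ : Extn (karoubiE E) C A} (h : underlying E δ = underlying E ρ) :
    δ = ρ :=
  Subtype.ext h

lemma underlying_push (a : A ⟶ B) (δ : Extn (karoubiE E) C A) :
    underlying E (push (karoubiE E) a δ) = push E a.f (underlying E δ) := rfl

lemma underlying_pull (c : D ⟶ C) (δ : Extn (karoubiE E) C A) :
    underlying E (pull (karoubiE E) c δ) = pull E c.f (underlying E δ) := rfl

@[simp]
lemma push_underlying (δ : Extn (karoubiE E) C A) :
    push E A.p (underlying E δ) = underlying E δ :=
  (show karoubiExtn E C A from δ).2.1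

@[simp]
lemma pull_underlying (δ : Extn (karoubiE E) C A) :
    pull E C.p (underlying E δ) = underlying E δ :=
  (show karoubiExtn E C A from δ).2.2

lemma exists_underlying_eq {δ : Extn E C.X A.X} (h1 : push E A.p δ = δ) (h2 : pull E C.p δ = δ) :
    ∃ δ' : Extn (karoubiE E) C A, underlying E δ' = δ :=
  ⟨(⟨δ, h1, h2⟩ : karoubiExtn E C A), rfl⟩

end

variable [Preadditive 𝒞] {n : ℕ} {A B C D : Karoubi 𝒞}

lemma idem_f {K : CochainComplex 𝒞 ℕ} {e : K ⟶ K} (idem : e ≫ e = e) (i : ℕ) :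
    e.f i ≫ e.f i = e.f i :=
  HomologicalComplex.congr_hom idem i

section

variable (X : NComplex n A.X C.X) (e : X.K ⟶ X.K) (idem : e ≫ e = e) (he : X.IsLift X e A.p C.p)
  (Y : NComplex n B.X D.X) (e' : Y.K ⟶ Y.K) (idem' : e' ≫ e' = e') (he' : Y.IsLift Y e' B.p D.p)

lemma karoubiComplex_d_f (i j : ℕ) :
    ((karoubiComplex X e idem he).K.d i j).f = e.f i ≫ X.K.d i j := rfl

lemma karoubiComplex_eqToHom_left :
    (eqToHom (karoubiComplex X e idem he).left).f = eqToHom X.left ≫ A.p :=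
  (Karoubi.eqToHom_f _).trans he.1

lemma karoubiComplex_eqToHom_left_symm :
    (eqToHom (karoubiComplex X e idem he).left.symm).f = A.p ≫ eqToHom X.left.symm :=
  Karoubi.eqToHom_f _

lemma karoubiComplex_eqToHom_right :
    (eqToHom (karoubiComplex X e idem he).right).f = eqToHom X.right ≫ C.p :=
  (Karoubi.eqToHom_f _).trans he.2

lemma karoubiComplex_ι_f : (karoubiComplex X e idem he).ι.f = A.p ≫ X.ι := by
  have h1 : A.p ≫ eqToHom X.left.symm ≫ e.f 0 = A.p ≫ eqToHom X.left.symm := by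
    simp [he.f_zero]
  rw [ι, Karoubi.comp_f, karoubiComplex_eqToHom_left_symm, karoubiComplex_d_f]
  change (A.p ≫ eqToHom X.left.symm) ≫ e.f 0 ≫ X.K.d 0 1 = A.p ≫ eqToHom X.left.symm ≫ X.K.d 0 1
  rw [← Category.assoc, Category.assoc A.p, h1, Category.assoc]

lemma karoubiComplex_π_f : (karoubiComplex X e idem he).π.f = X.π ≫ C.p := by
  have h1 : e.f (n + 1) ≫ eqToHom X.right ≫ C.p = eqToHom X.right ≫ C.p := by
    rw [← Category.assoc, he.2, Category.assoc, C.idem]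
  rw [π, Karoubi.comp_f, karoubiComplex_eqToHom_right, karoubiComplex_d_f]
  change (e.f n ≫ X.K.d n (n + 1)) ≫ eqToHom X.right ≫ C.p =
    (X.K.d n (n + 1) ≫ eqToHom X.right) ≫ C.p
  rw [e.comm, Category.assoc, h1, Category.assoc]

variable {X Y} in
/-- The morphism of complexes over the idempotent completion given by a morphism of complexes which
absorbs the idempotents. -/
def karoubiHom (f : X.K ⟶ Y.K) (hf : e ≫ f ≫ e' = f) :
    (karoubiComplex X e idem he).K ⟶ (karoubiComplex Y e' idem' he').K :=
  (karoubiCochainComplexEquivalence 𝒞 ℕ).functor.map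
    (X := ⟨X.K, e, idem⟩) (Y := ⟨Y.K, e', idem'⟩) ⟨f, hf⟩

lemma karoubiHom_f_f (f : X.K ⟶ Y.K) (hf : e ≫ f ≫ e' = f) (i : ℕ) :
    ((karoubiHom e idem he e' idem' he' f hf).f i).f = f.f i := rfl

lemma isLift_karoubiHom (f : X.K ⟶ Y.K) (hf : e ≫ f ≫ e' = f) {a : A ⟶ B} {c : C ⟶ D}
    (h : X.IsLift Y f a.f c.f) :
    (karoubiComplex X e idem he).IsLift (karoubiComplex Y e' idem' he')
      (karoubiHom e idem he e' idem' he' f hf) a c := by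
  constructor
  · apply Karoubi.hom_ext
    rw [Karoubi.comp_f, Karoubi.comp_f, karoubiHom_f_f, karoubiComplex_eqToHom_left,
      karoubiComplex_eqToHom_left]
    change f.f 0 ≫ eqToHom Y.left ≫ B.p = (eqToHom X.left ≫ A.p) ≫ a.f
    rw [← Category.assoc, h.1]
    simp
  · apply Karoubi.hom_ext
    rw [Karoubi.comp_f, Karoubi.comp_f, karoubiHom_f_f, karoubiComplex_eqToHom_right,
      karoubiComplex_eqToHom_right]
    change f.f (n + 1) ≫ eqToHom Y.right ≫ D.p = (eqToHom X.right ≫ C.p) ≫ c.f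
    rw [← Category.assoc, h.2]
    simp

end

variable {E : 𝒞ᵒᵖ ⥤ 𝒞 ⥤ AddCommGrpCat.{w}}

/-- `(X, e)` is an exangle as a direct summand of the exangle `X`. -/
lemma IsNExangle.karoubi {δ : Extn (karoubiE E) C A} {X : NComplex n A.X C.X}
    (h : IsNExangle E X (underlying E δ)) (e : X.K ⟶ X.K) (idem : e ≫ e = e)
    (he : X.IsLift X e A.p C.p) : IsNExangle (karoubiE E) (karoubiComplex X e idem he) δ := by
  refine IsNExangle.of_exact ?_ ?_ ?_ ?_ ?_ ?_
  · intro T i hi g hg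
    obtain ⟨g, hTg⟩ := g
    change T.X ⟶ X.K.X (i + 1) at g
    replace hTg : T.p ≫ g ≫ e.f (i + 1) = g := hTg
    have hge : g ≫ e.f (i + 1) = g := by
      rw [← hTg, Category.assoc, Category.assoc, idem_f idem]
    have hTg : T.p ≫ g = g := by
      rw [← hTg, ← Category.assoc, T.idem]
    have hg' : g ≫ e.f (i + 1) ≫ X.K.d (i + 1) (i + 2) = 0 := congrArg Karoubi.Hom.f hg
    rw [← Category.assoc, hge] at hg'
    obtain ⟨g', e'⟩ := h.leftExact T.X i hi g hg'
    refine ⟨⟨T.p ≫ g' ≫ e.f i, ?_⟩, Karoubi.hom_ext _ _ ?_⟩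
    · change T.p ≫ (T.p ≫ g' ≫ e.f i) ≫ e.f i = T.p ≫ g' ≫ e.f i
      simp [idem_f idem]
    · rw [Karoubi.comp_f, karoubiComplex_d_f]
      change (T.p ≫ g' ≫ e.f i) ≫ e.f i ≫ X.K.d i (i + 1) = g
      rw [Category.assoc, Category.assoc, ← Category.assoc (e.f i), idem_f idem, e.comm,
        ← Category.assoc g', e', hge, hTg]
  · intro T i hi g hg
    obtain ⟨g, hTg⟩ := g
    change X.K.X (i + 1) ⟶ T.X at g
    replace hTg : e.f (i + 1) ≫ g ≫ T.p = g := hTg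
    have hge : e.f (i + 1) ≫ g = g := by
      rw [← hTg, ← Category.assoc, idem_f idem]
    have hTg : g ≫ T.p = g := by
      rw [← hTg, Category.assoc, Category.assoc, T.idem]
    have hg' : (e.f i ≫ X.K.d i (i + 1)) ≫ g = 0 := congrArg Karoubi.Hom.f hg
    rw [e.comm, Category.assoc, hge] at hg'
    obtain ⟨g', e'⟩ := h.rightExact T.X i hi g hg'
    refine ⟨⟨e.f (i + 2) ≫ g' ≫ T.p, ?_⟩, Karoubi.hom_ext _ _ ?_⟩
    · change e.f (i + 2) ≫ (e.f (i + 2) ≫ g' ≫ T.p) ≫ T.p = e.f (i + 2) ≫ g' ≫ T.p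
      rw [← Category.assoc, ← Category.assoc (e.f _), idem_f idem]
      simp
    · rw [Karoubi.comp_f, karoubiComplex_d_f]
      change (e.f (i + 1) ≫ X.K.d (i + 1) (i + 2)) ≫ e.f (i + 2) ≫ g' ≫ T.p = g
      rw [Category.assoc, ← e.comm_assoc, ← Category.assoc, idem_f idem, ← Category.assoc _ g',
        e', ← Category.assoc, hge, hTg]
  · apply underlying_injective
    have h1 : push E (A.p ≫ X.ι) (underlying E δ) = 0 := by
      rw [← push_push, push_underlying, h.push_eq_zero]
    rw [underlying_push, karoubiComplex_ι_f]
    exact h1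
  · apply underlying_injective
    have h1 : pull E (X.π ≫ C.p) (underlying E δ) = 0 := by
      rw [← pull_pull, pull_underlying, h.pull_eq_zero]
    rw [underlying_pull, karoubiComplex_π_f]
    exact h1
  · intro T a ha
    obtain ⟨g, hg⟩ := h.exists_ι_comp a.f (congrArg (underlying E) ha)
    refine ⟨⟨e.f 1 ≫ g ≫ T.p, ?_⟩, Karoubi.hom_ext _ _ ?_⟩
    · change e.f 1 ≫ (e.f 1 ≫ g ≫ T.p) ≫ T.p = e.f 1 ≫ g ≫ T.p
      rw [← Category.assoc, ← Category.assoc (e.f _), idem_f idem]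
      simp
    · rw [Karoubi.comp_f, karoubiComplex_ι_f]
      change (A.p ≫ X.ι) ≫ e.f 1 ≫ g ≫ T.p = a.f
      rw [Category.assoc, ← Category.assoc X.ι, he.ι_comp, Category.assoc, ← Category.assoc,
        A.idem, ← Category.assoc X.ι, hg, Karoubi.comp_p, Karoubi.p_comp]
  · intro T c hc
    obtain ⟨g, hg⟩ := h.exists_comp_π c.f (congrArg (underlying E) hc)
    refine ⟨⟨T.p ≫ g ≫ e.f n, ?_⟩, Karoubi.hom_ext _ _ ?_⟩
    · change T.p ≫ (T.p ≫ g ≫ e.f n) ≫ e.f n = T.p ≫ g ≫ e.f n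
      simp [idem_f idem]
    · rw [Karoubi.comp_f, karoubiComplex_π_f]
      change (T.p ≫ g ≫ e.f n) ≫ X.π ≫ C.p = c.f
      rw [Category.assoc, Category.assoc, ← Category.assoc (e.f n), he.comp_π, Category.assoc,
        C.idem, ← Category.assoc g, hg, Karoubi.comp_p, Karoubi.p_comp]

end KaroubiComplex

/-! ### The realisation of the idempotent completion -/

section KaroubiRealisation

open NComplex

variable {𝒞 : Type u} [Category.{v} 𝒞] [Preadditive 𝒞]
  {E : 𝒞ᵒᵖ ⥤ 𝒞 ⥤ AddCommGrpCat.{w}} {n : ℕ} {A B C D : Karoubi 𝒞} {s : Assignment E n}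

lemma karoubiComplex_mem {δ : Extn (karoubiE E) C A} {X : NComplex n A.X C.X}
    (hX : X ∈ s (underlying E δ)) (e : X.K ⟶ X.K) (idem : e ≫ e = e)
    (he : X.IsLift X e A.p C.p) : karoubiComplex X e idem he ∈ karoubiRealisation s δ :=
  ⟨X, hX, e, idem, he, HtpyEquiv.refl _⟩

variable [HasFiniteBiproducts 𝒞] [NeZero n]

/-- A morphism of extensions lifts to the complexes `(X, e)` and `(Y, e')`: compress a lift over `𝒞`
by the idempotents. -/
lemma IsExactRealisation.exists_karoubi_lift (h : IsExactRealisation s)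
    {δ : Extn (karoubiE E) C A} {ρ : Extn (karoubiE E) D B} (a : A ⟶ B) (c : C ⟶ D)
    (hac : push (karoubiE E) a δ = pull (karoubiE E) c ρ)
    {X : NComplex n A.X C.X} (hX : X ∈ s (underlying E δ)) (e : X.K ⟶ X.K) (idem : e ≫ e = e)
    (he : X.IsLift X e A.p C.p)
    {Y : NComplex n B.X D.X} (hY : Y ∈ s (underlying E ρ)) (e' : Y.K ⟶ Y.K) (idem' : e' ≫ e' = e')
    (he' : Y.IsLift Y e' B.p D.p) :
    ∃ f, (karoubiComplex X e idem he).IsLift (karoubiComplex Y e' idem' he') f a c := by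
  obtain ⟨f, hf⟩ := h.exists_lift (underlying E δ) (underlying E ρ) a.f c.f
    (congrArg (underlying E) hac) X hX Y hY
  refine ⟨karoubiHom e idem he e' idem' he' (e ≫ f ≫ e') ?_, isLift_karoubiHom _ _ _ _ _ _ _ _ _ _
    ((he.comp (hf.comp he')).congr (by simp) (by simp))⟩
  simp only [Category.assoc, idem']
  rw [← Category.assoc, idem]

lemma IsExactRealisation.karoubiComplex_htpyEquiv (h : IsExactRealisation s)
    {δ : Extn (karoubiE E) C A}
    {X : NComplex n A.X C.X} (hX : X ∈ s (underlying E δ)) (e : X.K ⟶ X.K) (idem : e ≫ e = e)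
    (he : X.IsLift X e A.p C.p)
    {Y : NComplex n A.X C.X} (hY : Y ∈ s (underlying E δ)) (e' : Y.K ⟶ Y.K) (idem' : e' ≫ e' = e')
    (he' : Y.IsLift Y e' A.p C.p) :
    HtpyEquiv (karoubiComplex X e idem he) (karoubiComplex Y e' idem' he') := by
  obtain ⟨f, hf⟩ := h.exists_karoubi_lift (δ := δ) (ρ := δ) (𝟙 A) (𝟙 C) (by simp) hX e idem he
    hY e' idem' he'
  obtain ⟨g, hg⟩ := h.exists_karoubi_lift (δ := δ) (ρ := δ) (𝟙 A) (𝟙 C) (by simp) hY e' idem' he'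
    hX e idem he
  exact ((h.isNExangle _ X hX).karoubi e idem he).rightExact.htpyEquiv
    ((h.isNExangle _ Y hY).karoubi e' idem' he').rightExact f g hf hg

lemma IsExactRealisation.karoubiRealisation_eq (h : IsExactRealisation s)
    {δ : Extn (karoubiE E) C A}
    {X : NComplex n A.X C.X} (hX : X ∈ s (underlying E δ)) (e : X.K ⟶ X.K) (idem : e ≫ e = e)
    (he : X.IsLift X e A.p C.p) :
    karoubiRealisation s δ = (karoubiComplex X e idem he).cls := by
  ext Z
  constructor
  · rintro ⟨Y, hY, e', idem', he', hZ⟩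
    exact (h.karoubiComplex_htpyEquiv hX e idem he hY e' idem' he').trans hZ
  · exact fun hZ => ⟨X, hX, e, idem, he, hZ⟩

namespace IsNExangulated

variable (h : IsNExangulated E s)

include h

lemma exists_idempotent (δ : Extn (karoubiE E) C A) {X : NComplex n A.X C.X}
    (hX : X ∈ s (underlying E δ)) :
    ∃ e : X.K ⟶ X.K, e ≫ e = e ∧ X.IsLift X e A.p C.p ∧ Nonempty (Homotopy e (𝟙 _)) :=
  (h.isNExangle _ X hX).exists_idempotent_lift h.additive_snd h.additive_fst A.idem C.idem
    (push_underlying E δ) (pull_underlying E δ)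

lemma exists_karoubiComplex (δ : Extn (karoubiE E) C A) :
    ∃ (X : NComplex n A.X C.X) (e : X.K ⟶ X.K) (idem : e ≫ e = e) (he : X.IsLift X e A.p C.p),
      X ∈ s (underlying E δ) ∧ Nonempty (Homotopy e (𝟙 _)) ∧
      karoubiRealisation s δ = (karoubiComplex X e idem he).cls := by
  obtain ⟨X, hX⟩ := h.exists_mem (underlying E δ)
  obtain ⟨e, idem, he, H⟩ := h.exists_idempotent δ hX
  exact ⟨X, e, idem, he, hX, H, h.karoubiRealisation_eq hX e idem he⟩

lemma karoubi_isExactRealisation :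
    IsExactRealisation (karoubiRealisation s : Assignment (karoubiE E) n) := by
  have hex : ∀ ⦃A C : Karoubi 𝒞⦄ (δ : Extn (karoubiE E) C A) (Z : NComplex n A C),
      Z ∈ karoubiRealisation s δ → IsNExangle (karoubiE E) Z δ := by
    rintro A C δ Z ⟨X, hX, e, idem, he, hZ⟩
    exact ((h.isNExangle _ X hX).karoubi e idem he).of_htpyEquiv hZ
  have hzero : ∀ ⦃A C : Karoubi 𝒞⦄ (Z : NComplex n A C),
      IsNExangle (karoubiE E) Z (0 : Extn (karoubiE E) C A) →
      Z ∈ karoubiRealisation s (0 : Extn (karoubiE E) C A) := by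
    intro A C Z hZ
    obtain ⟨X, e, idem, he, hX, -, hc⟩ := h.exists_karoubiComplex (0 : Extn (karoubiE E) C A)
    rw [hc]
    exact (hex _ _ (karoubiComplex_mem hX e idem he)).htpyEquiv_of_zero hZ
  refine ⟨?_, ?_, hex, fun A => hzero _ (IsNExangle.trivFirst A),
    fun A => hzero _ (IsNExangle.trivLast A)⟩
  · intro A C δ
    obtain ⟨X, e, idem, he, -, -, hc⟩ := h.exists_karoubiComplex δ
    exact ⟨_, hc⟩
  · rintro A B C D δ ρ a c hac Z ⟨X, hX, e, idem, he, F, G, hF, hG, -, -⟩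
      W ⟨Y, hY, e', idem', he', F', G', hF', hG', -, -⟩
    obtain ⟨f, hf⟩ := h.exists_karoubi_lift a c hac hX e idem he hY e' idem' he'
    exact ⟨G ≫ f ≫ F', (hG.comp (hf.comp hF')).congr (by simp) (by simp)⟩

end IsNExangulated

end KaroubiRealisation

/-! ### Additivity of the extension functor of the idempotent completion -/

section KaroubiAdditive

variable {𝒞 : Type u} [Category.{v} 𝒞] [Preadditive 𝒞] {E : 𝒞ᵒᵖ ⥤ 𝒞 ⥤ AddCommGrpCat.{w}}

lemma push_add (h : ∀ C, (E.obj C).Additive) {A B C : 𝒞} (a b : A ⟶ B) (δ : Extn E C A) :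
    push E (a + b) δ = push E a δ + push E b δ := by
  have := h (op C)
  simp [push, Functor.map_add]

lemma pull_add (h : E.Additive) {A C D : 𝒞} (c d : D ⟶ C) (δ : Extn E C A) :
    pull E (c + d) δ = pull E c δ + pull E d δ := by
  simp [pull, op_add, Functor.map_add, NatTrans.app_add]

lemma karoubiE_additive_fst (h : E.Additive) : (karoubiE E).Additive where
  map_add {Z W c d} := by
    ext X δ
    exact Subtype.ext (pull_add h c.unop.f d.unop.f _)

lemma karoubiE_additive_snd (h : ∀ C, (E.obj C).Additive) (C : (Karoubi 𝒞)ᵒᵖ) :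
    ((karoubiE E).obj C).Additive where
  map_add {X Y a b} := by
    ext δ
    exact Subtype.ext (push_add h a.f b.f _)

end KaroubiAdditive

/-! ### Inflations and deflations of the idempotent completion -/

section

open NComplex

variable {𝒞 : Type u} [Category.{v} 𝒞] [Preadditive 𝒞] {E : 𝒞ᵒᵖ ⥤ 𝒞 ⥤ AddCommGrpCat.{w}} {n : ℕ}
  {s : Assignment E n}

lemma IsInflation.exists_mem {A B : 𝒞} {f : A ⟶ B} (hf : IsInflation s f) :
    ∃ (C : 𝒞) (δ : Extn E C A) (X : NComplex n A C) (_ : X ∈ s δ) (e : X.K.X 1 = B),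
      f = X.ι ≫ eqToHom e := by
  obtain ⟨δ, X, hX⟩ := hf
  exact ⟨_, δ, X, hX, rfl, by simp⟩

lemma IsDeflation.exists_mem {B C : 𝒞} {f : B ⟶ C} (hf : IsDeflation s f) :
    ∃ (A : 𝒞) (δ : Extn E C A) (X : NComplex n A C) (_ : X ∈ s δ) (e : B = X.K.X n),
      f = eqToHom e ≫ X.π := by
  obtain ⟨δ, X, hX⟩ := hf
  exact ⟨_, δ, X, hX, rfl, by simp⟩

variable {A B C : Karoubi 𝒞}

lemma exists_of_isInflation_karoubi {f : A ⟶ B} (hf : IsInflation (karoubiRealisation s) f) :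
    ∃ (C' : 𝒞) (δ : Extn E C' A.X) (X : NComplex n A.X C') (_ : X ∈ s δ) (i : B.X ⟶ X.K.X 1),
      A.p ≫ X.ι = f.f ≫ i := by
  obtain ⟨δ, Z, X, hX, e, idem, he, F, G, hF, hG, -, -⟩ := hf
  refine ⟨_, _, X, hX, (G.f 1).f, ?_⟩
  have := congrArg Karoubi.Hom.f hG.ι_comp
  rw [Category.id_comp, Karoubi.comp_f, karoubiComplex_ι_f] at this
  exact this.symm

lemma exists_of_isDeflation_karoubi {f : B ⟶ C} (hf : IsDeflation (karoubiRealisation s) f) :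
    ∃ (A' : 𝒞) (δ : Extn E C.X A') (X : NComplex n A' C.X) (_ : X ∈ s δ) (i : X.K.X n ⟶ B.X),
      X.π ≫ C.p = i ≫ f.f := by
  obtain ⟨δ, Z, X, hX, e, idem, he, F, G, hF, hG, -, -⟩ := hf
  refine ⟨_, _, X, hX, (F.f n).f, ?_⟩
  have := congrArg Karoubi.Hom.f hF.comp_π
  rw [Category.comp_id, Karoubi.comp_f, karoubiComplex_π_f] at this
  exact this.symm

end

section Inflations

open NComplex

variable {𝒞 : Type u} [Category.{v} 𝒞] [Preadditive 𝒞]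
  {E : 𝒞ᵒᵖ ⥤ 𝒞 ⥤ AddCommGrpCat.{w}} {n : ℕ} [NeZero n] {s : Assignment E n}

namespace IsNExangle

variable {A C : 𝒞} {δ : Extn E C A} {Z : NComplex n A C}

/-- An idempotent `(p, q)` of the first differential `d₀ : A ⟶ Z₁` with `p_𝔼 δ = δ` extends to an
idempotent of `Z` homotopic to the identity which differs from it only in the degrees `0, 1, 2`:
after the contractible part given by `1 - p` is split off, the remaining part of `1 - q` vanishes
on `A`, and hence factors through `Z₁ ⟶ Z₂`. -/
lemma exists_idempotent_first (hE : ∀ C, (E.obj C).Additive) (h : IsNExangle E Z δ) {p : A ⟶ A}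
    (hp : p ≫ p = p) (hpδ : push E p δ = δ) {q : Z.K.X 1 ⟶ Z.K.X 1} (hq : q ≫ q = q)
    (hιq : Z.ι ≫ q = p ≫ Z.ι) :
    ∃ e : Z.K ⟶ Z.K, e ≫ e = e ∧ Nonempty (Homotopy e (𝟙 _)) ∧ Z.endLeft e = p ∧ e.f 1 = q := by
  obtain ⟨k, hk⟩ : ∃ k, k = 𝟙 _ - q := ⟨_, rfl⟩
  have hkk : k ≫ k = k := by simp [hk, hq]
  have hιk : Z.ι ≫ k = (𝟙 _ - p) ≫ Z.ι := by simp [hk, hιq]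
  obtain ⟨t', ht'⟩ := h.exists_ι_comp (𝟙 _ - p) (by rw [push_sub E hE, push_id, hpδ, sub_self])
  have hpp : (𝟙 _ - p) ≫ (𝟙 _ - p) = 𝟙 _ - p := by simp [hp]
  obtain ⟨t, ht⟩ : ∃ t, t = k ≫ t' ≫ (𝟙 _ - p) := ⟨_, rfl⟩
  have hιt : Z.ι ≫ t = 𝟙 _ - p := by
    rw [ht, ← Category.assoc, hιk, Category.assoc, ← Category.assoc Z.ι, ht', hpp, hpp]
  have hkt : k ≫ t = t := by rw [ht, ← Category.assoc, hkk]
  have htp : t ≫ (𝟙 _ - p) = t := by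
    rw [ht, Category.assoc, Category.assoc, hpp]
  have htιk : t ≫ Z.ι ≫ k = t ≫ Z.ι := by rw [hιk, ← Category.assoc, htp]
  have htιt : t ≫ Z.ι ≫ t = t := by rw [hιt, htp]
  obtain ⟨k₁, hk₁⟩ : ∃ k₁, k₁ = k - t ≫ Z.ι := ⟨_, rfl⟩
  have hk₁k₁ : k₁ ≫ k₁ = k₁ := by
    have h1 : t ≫ Z.ι ≫ t ≫ Z.ι = t ≫ Z.ι := by
      rw [← Category.assoc Z.ι, hιt, ← Category.assoc, htp]
    have h2 : k ≫ t ≫ Z.ι = t ≫ Z.ι := by rw [← Category.assoc, hkt]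
    simp only [hk₁, Preadditive.sub_comp, Preadditive.comp_sub, Category.assoc, hkk, htιk, h1, h2]
    abel
  have hk₁t : k₁ ≫ t = 0 := by
    rw [hk₁, Preadditive.sub_comp, hkt, Category.assoc, htιt, sub_self]
  obtain ⟨u, hu⟩ : ∃ u : Z.K.X 2 ⟶ Z.K.X 1, Z.K.d 1 2 ≫ u = k₁ :=
    h.rightExact _ 0 (Nat.pos_of_ne_zero (NeZero.ne n)) k₁ (by
      rw [d_zero, Category.assoc, hk₁, Preadditive.comp_sub, hιk, ← Category.assoc Z.ι, hιt,
        sub_self, comp_zero])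
  have hu' : Z.K.d 1 2 ≫ u ≫ k₁ = k₁ := by rw [← Category.assoc, hu, hk₁k₁]
  have ht0 : (t ≫ eqToHom Z.left.symm) ≫ Z.K.d 0 1 = t ≫ Z.ι := by simp [d_zero]
  have ht1 : (t ≫ eqToHom Z.left.symm) ≫ Z.K.d 0 1 ≫ (t ≫ eqToHom Z.left.symm) =
      t ≫ eqToHom Z.left.symm := by
    rw [← Category.assoc, ht0, ← Category.assoc, Category.assoc t, htιt]
  have hu1 : (u ≫ k₁) ≫ Z.K.d 1 2 ≫ (u ≫ k₁) = u ≫ k₁ := by rw [hu', Category.assoc, hk₁k₁]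
  refine ⟨compl 0 1 (t ≫ eqToHom Z.left.symm) (u ≫ k₁), compl_idem Nat.zero_lt_one _ _ ht1 hu1,
    compl_homotopy _ _, ?_, ?_⟩
  · have := singleMap_f_of_ne (K := Z.K) (L := Z.K) 1 (u ≫ k₁) 0 (by omega) (by omega)
    simp [endLeft, compl, this, singleMap_f_self, d_zero, hιt]
  · have h5 : (singleMap 1 (u ≫ k₁)).f 1 = k₁ := (singleMap_f_self _ _).trans hu'
    have h6 : (singleMap 0 (t ≫ eqToHom Z.left.symm)).f 1 = t ≫ Z.ι :=
      (singleMap_f_succ _ _).trans ht0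
    have h7 : k₁ ≫ t ≫ Z.ι = 0 := by rw [← Category.assoc, hk₁t, zero_comp]
    rw [compl, HomologicalComplex.comp_f, HomologicalComplex.sub_f_apply,
      HomologicalComplex.sub_f_apply, h5, h6, HomologicalComplex.id_f, Preadditive.comp_sub,
      Preadditive.sub_comp, Preadditive.sub_comp, h7, hk₁, hk]
    simp
    abel

/-- The dual of `exists_idempotent_first`. -/
lemma exists_idempotent_last (hE : E.Additive) (h : IsNExangle E Z δ) {p : C ⟶ C}
    (hp : p ≫ p = p) (hpδ : pull E p δ = δ) {q : Z.K.X n ⟶ Z.K.X n} (hq : q ≫ q = q)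
    (hπq : q ≫ Z.π = Z.π ≫ p) :
    ∃ e : Z.K ⟶ Z.K, e ≫ e = e ∧ Nonempty (Homotopy e (𝟙 _)) ∧ Z.endRight e = p ∧ e.f n = q := by
  obtain ⟨k, hk⟩ : ∃ k, k = 𝟙 _ - q := ⟨_, rfl⟩
  have hkk : k ≫ k = k := by simp [hk, hq]
  have hπk : k ≫ Z.π = Z.π ≫ (𝟙 _ - p) := by simp [hk, hπq]
  obtain ⟨t', ht'⟩ := h.exists_comp_π (𝟙 _ - p) (by rw [pull_sub E hE, pull_id, hpδ, sub_self])
  have hpp : (𝟙 _ - p) ≫ (𝟙 _ - p) = 𝟙 _ - p := by simp [hp]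
  obtain ⟨t, ht⟩ : ∃ t, t = (𝟙 _ - p) ≫ t' ≫ k := ⟨_, rfl⟩
  have hπt : t ≫ Z.π = 𝟙 _ - p := by
    rw [ht, Category.assoc, Category.assoc, hπk, ← Category.assoc t', ht', hpp, hpp]
  have hkt : t ≫ k = t := by rw [ht, Category.assoc, Category.assoc, hkk]
  have htp : (𝟙 _ - p) ≫ t = t := by rw [ht, ← Category.assoc, hpp]
  have htπt : t ≫ Z.π ≫ t = t := by rw [← Category.assoc, hπt, htp]
  obtain ⟨k₁, hk₁⟩ : ∃ k₁, k₁ = k - Z.π ≫ t := ⟨_, rfl⟩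
  have hk₁k₁ : k₁ ≫ k₁ = k₁ := by
    have h1 : Z.π ≫ t ≫ Z.π ≫ t = Z.π ≫ t := by rw [htπt]
    have h2 : k ≫ Z.π ≫ t = Z.π ≫ t := by rw [← Category.assoc, hπk, Category.assoc, htp]
    simp only [hk₁, Preadditive.sub_comp, Preadditive.comp_sub, Category.assoc, hkk, hkt, h1, h2]
    abel
  have hk₁t : t ≫ k₁ = 0 := by
    rw [hk₁, Preadditive.comp_sub, hkt, htπt, sub_self]
  obtain ⟨N, rfl⟩ : ∃ N, n = N + 1 := ⟨n - 1, by have := NeZero.ne n; omega⟩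
  obtain ⟨u, hu⟩ : ∃ u : Z.K.X (N + 1) ⟶ Z.K.X N, u ≫ Z.K.d N (N + 1) = k₁ :=
    h.leftExact _ N (by omega) k₁ (by
      rw [d_last, ← Category.assoc, hk₁, Preadditive.sub_comp, hπk, Category.assoc, hπt,
        sub_self, zero_comp])
  have hu' : (k₁ ≫ u) ≫ Z.K.d N (N + 1) = k₁ := by rw [Category.assoc, hu, hk₁k₁]
  have ht0 : Z.K.d (N + 1) (N + 2) ≫ eqToHom Z.right ≫ t = Z.π ≫ t := by simp [d_last]
  have ht1 : (eqToHom Z.right ≫ t) ≫ Z.K.d (N + 1) (N + 2) ≫ eqToHom Z.right ≫ t =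
      eqToHom Z.right ≫ t := by
    rw [ht0, Category.assoc, htπt]
  have hu1 : (k₁ ≫ u) ≫ Z.K.d N (N + 1) ≫ (k₁ ≫ u) = k₁ ≫ u := by
    rw [← Category.assoc, hu', ← Category.assoc, hk₁k₁]
  refine ⟨compl N (N + 1) (k₁ ≫ u) (eqToHom Z.right ≫ t), compl_idem N.lt_succ_self _ _ hu1 ht1,
    compl_homotopy _ _, ?_, ?_⟩
  · have h5 : (singleMap N (k₁ ≫ u) : Z.K ⟶ Z.K).f (N + 2) = 0 :=
      singleMap_f_of_ne _ _ _ (by omega) (by omega)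
    have h6 : (singleMap (N + 1) (eqToHom Z.right ≫ t) : Z.K ⟶ Z.K).f (N + 2) =
        (eqToHom Z.right ≫ t) ≫ Z.π ≫ eqToHom Z.right.symm := by
      rw [← d_last]
      exact singleMap_f_succ _ _
    rw [endRight, compl, HomologicalComplex.comp_f, HomologicalComplex.sub_f_apply,
      HomologicalComplex.sub_f_apply, h5, h6]
    simp [hπt]
  · have h5 : (singleMap N (k₁ ≫ u) : Z.K ⟶ Z.K).f (N + 1) = k₁ := (singleMap_f_succ _ _).trans hu'
    have h6 : (singleMap (N + 1) (eqToHom Z.right ≫ t) : Z.K ⟶ Z.K).f (N + 1) = Z.π ≫ t :=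
      (singleMap_f_self _ _).trans ht0
    have h7 : (Z.π ≫ t) ≫ k₁ = 0 := by rw [Category.assoc, hk₁t, comp_zero]
    rw [compl, HomologicalComplex.comp_f, HomologicalComplex.sub_f_apply,
      HomologicalComplex.sub_f_apply, h5, h6, HomologicalComplex.id_f, Preadditive.comp_sub,
      Preadditive.sub_comp, Preadditive.sub_comp, h7, hk₁, hk]
    simp

end IsNExangle

variable [HasFiniteBiproducts 𝒞]

namespace IsNExangulated

section

variable {A B C D : 𝒞} (h : IsNExangulated E s)

include h

/-- A morphism `f : A ⟶ B` out of the source of an inflation `d₀ : A ⟶ X₁` is a retract, relative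
to `A`, of an inflation; the target of the latter is `X₁ ⊕ B`, and the section `(b, 1)` may be
twisted by any `b : B ⟶ X₁`. -/
lemma exists_inflation_retract {δ : Extn E C A} {X : NComplex n A C} (hX : X ∈ s δ) (f : A ⟶ B)
    (b : B ⟶ X.K.X 1) :
    ∃ (C' : 𝒞) (c : C' ⟶ C) (Z : NComplex n A C') (_ : Z ∈ s (pull E c δ)) (j : B ⟶ Z.K.X 1)
      (r : Z.K.X 1 ⟶ B) (m : X.K.X 1 ⟶ Z.K.X 1), j ≫ r = 𝟙 B ∧ Z.ι ≫ r = f ∧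
        Z.ι = f ≫ j + (X.ι - f ≫ b) ≫ m := by
  have hn : 1 ≤ n := Nat.one_le_iff_ne_zero.2 (NeZero.ne n)
  obtain ⟨Y, hY⟩ := h.exists_mem (push E f δ)
  obtain ⟨g, hg, hZ⟩ := h.exists_good_lift_op δ f X hX Y hY
  have hι : (X.cocone Y g).ι = X.ι ≫ coconeInl X Y 1 +
      f ≫ eqToHom Y.left.symm ≫ coconeInr X Y 0 := by
    have e (e' : A = coconeX X Y 0) : eqToHom e' ≫ coconeD X Y g 0 = X.ι ≫ coconeInl X Y 1 +
        f ≫ eqToHom Y.left.symm ≫ coconeInr X Y 0 := by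
      have e1 : eqToHom e' = eqToHom X.left.symm ≫ coconeInl X Y 0 := by simp [coconeInl]
      rw [e1, Category.assoc, coconeInl_d X Y g (Nat.zero_le n), hg.f_zero, ι]
      simp
    rw [ι, cocone_d]
    exact e _
  have h1 := coconeInr_snd_assoc X Y (Nat.zero_le n) (eqToHom Y.left)
  have h2 := coconeInl_snd_assoc X Y 0 (eqToHom Y.left)
  have key : ∀ z : A ⟶ coconeX X Y 1,
      z = X.ι ≫ coconeInl X Y 1 + f ≫ eqToHom Y.left.symm ≫ coconeInr X Y 0 →
      ∃ (j : B ⟶ coconeX X Y 1) (r : coconeX X Y 1 ⟶ B) (m : X.K.X 1 ⟶ coconeX X Y 1),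
        j ≫ r = 𝟙 B ∧ z ≫ r = f ∧ z = f ≫ j + (X.ι - f ≫ b) ≫ m := by
    rintro _ rfl
    refine ⟨eqToHom Y.left.symm ≫ coconeInr X Y 0 + b ≫ coconeInl X Y 1,
      coconeSnd X Y 0 ≫ eqToHom Y.left, coconeInl X Y 1, ?_, ?_, ?_⟩
    · simp [h1, h2]
    · simp [h1, h2]
    · simp
      abel
  obtain ⟨j, r, m, e1, e2, e3⟩ := key _ hι
  exact ⟨_, Y.π, _, hZ, j, r, m, e1, e2, e3⟩

/-- A morphism `f : B ⟶ C` into the target of a deflation `dₙ : Xₙ ⟶ C` is a retract, relative to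
`C`, of a deflation; the source of the latter is `B ⊕ Xₙ`. -/
lemma exists_deflation_retract {δ : Extn E C A} {X : NComplex n A C} (hX : X ∈ s δ) (f : B ⟶ C)
    (b : X.K.X n ⟶ B) :
    ∃ (A' : 𝒞) (a : A ⟶ A') (Z : NComplex n A' C) (_ : Z ∈ s (push E a δ)) (j : Z.K.X n ⟶ B)
      (r : B ⟶ Z.K.X n) (m : Z.K.X n ⟶ X.K.X n), r ≫ j = 𝟙 B ∧ r ≫ Z.π = f ∧
        Z.π = j ≫ f + m ≫ (X.π - b ≫ f) := by
  obtain ⟨N, rfl⟩ : ∃ N, n = N + 1 := ⟨n - 1, by have := NeZero.ne n; omega⟩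
  obtain ⟨Y, hY⟩ := h.exists_mem (pull E f δ)
  obtain ⟨g, hg, hZ⟩ := h.exists_good_lift δ f Y hY X hX
  have hπ : (Y.cone X g).π = coneFst Y X (N + 1) ≫ eqToHom Y.right ≫ f +
      coneSnd Y X (N + 1) ≫ X.π := by
    have e (e' : coneX Y X (N + 2) = C) : coneD Y X g (N + 1) ≫ eqToHom e' =
        coneFst Y X (N + 1) ≫ eqToHom Y.right ≫ f + coneSnd Y X (N + 1) ≫ X.π := by
      have hz : Y.K.d (N + 2) (N + 3) = 0 := (Y.isZero _ (by omega)).eq_of_tgt _ _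
      simp [coneD, hz, coneInr, hg.f_last, π]
    rw [π, cone_d]
    exact e _
  have h1 := coneInl_fst_assoc Y X (N + 1) (eqToHom Y.right)
  have h2 := fun {T : 𝒞} (u : X.K.X (N + 1) ⟶ T) => coneInl_snd_assoc Y X (N + 1) u
  have h3 := fun {T : 𝒞} (u : Y.K.X (N + 2) ⟶ T) => coneInl_fst_assoc Y X (N + 1) u
  have key : ∀ z : coneX Y X (N + 1) ⟶ C,
      z = coneFst Y X (N + 1) ≫ eqToHom Y.right ≫ f + coneSnd Y X (N + 1) ≫ X.π →
      ∃ (j : coneX Y X (N + 1) ⟶ B) (r : B ⟶ coneX Y X (N + 1))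
        (m : coneX Y X (N + 1) ⟶ X.K.X (N + 1)),
        r ≫ j = 𝟙 B ∧ r ≫ z = f ∧ z = j ≫ f + m ≫ (X.π - b ≫ f) := by
    rintro _ rfl
    refine ⟨coneFst Y X (N + 1) ≫ eqToHom Y.right + coneSnd Y X (N + 1) ≫ b,
      eqToHom Y.right.symm ≫ coneInl Y X (N + 1), coneSnd Y X (N + 1), ?_, ?_, ?_⟩
    · simp [h2, h3]
    · simp [h2, h3]
    · simp
  obtain ⟨j, r, m, e1, e2, e3⟩ := key _ hπ
  exact ⟨_, Y.ι, _, hZ, j, r, m, e1, e2, e3⟩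

end

variable {A B C D : Karoubi 𝒞} (h : IsNExangulated E s)

include h

/-- If `p φ` factors through `f`, where `φ` is an inflation of `𝒞` and `p` is the idempotent of the
source of `f`, then `f` is an inflation of the idempotent completion. -/
lemma isInflation_karoubi {C' : 𝒞} {δ : Extn E C' A.X} {X : NComplex n A.X C'} (hX : X ∈ s δ)
    (f : A ⟶ B) (i : B.X ⟶ X.K.X 1) (hi : A.p ≫ X.ι = f.f ≫ i) :
    IsInflation (karoubiRealisation s) f := by
  obtain ⟨Y, hY⟩ := h.exists_mem (push E A.p δ)
  obtain ⟨g, hg⟩ := h.exists_lift δ (push E A.p δ) A.p (𝟙 _) (pull_id E _).symm X hX Y hY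
  obtain ⟨C', c, Z, hZ, j, r, m, e1, e2, e3⟩ := h.exists_inflation_retract hY f.f (i ≫ g.f 1)
  have hpι : A.p ≫ Z.ι = f.f ≫ j := by
    have : A.p ≫ (Y.ι - f.f ≫ i ≫ g.f 1) = 0 := by
      rw [← Category.assoc f.f, ← hi, Category.assoc, hg.ι_comp]
      simp
    rw [e3, Preadditive.comp_add, ← Category.assoc A.p (Y.ι - _), this]
    simp
  have hZe := h.isNExangle _ Z hZ
  have hpδ : push E A.p (pull E c (push E A.p δ)) = pull E c (push E A.p δ) := by
    rw [← pull_push, push_push, A.idem]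
  have hfq : f.f ≫ B.p = f.f := Karoubi.comp_p f
  have e1' {T : 𝒞} (x : B.X ⟶ T) : j ≫ r ≫ x = x := by
    rw [← Category.assoc, e1, Category.id_comp]
  -- The idempotent `r q j` cuts the summand `B` out of `Z₁`.
  obtain ⟨e, idem, ⟨H⟩, he0, he1⟩ := hZe.exists_idempotent_first h.additive_snd A.idem hpδ
    (q := r ≫ B.p ≫ j) (by simp [e1'])
    (by rw [hpι, ← Category.assoc, e2, ← Category.assoc, hfq])
  let P : Karoubi 𝒞 := ⟨C', Z.endRight e, by
    have := idem_f idem (n + 1)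
    simp [endRight, reassoc_of% this]⟩
  have hlift : Z.IsLift Z e A.p P.p := (isLift_endLeft_endRight Z e).congr he0 rfl
  obtain ⟨δ', hδ'⟩ := exists_underlying_eq E (A := A) (C := P) hpδ
    (hZe.pull_endRight h.additive_fst H)
  have hmem := karoubiComplex_mem (δ := δ') (X := Z) (hδ' ▸ hZ) e idem hlift
  let α : (karoubiComplex (A := A) (C := P) Z e idem hlift).K.X 1 ≅ B :=
    { hom := ⟨r ≫ B.p, by
        change e.f 1 ≫ (r ≫ B.p) ≫ B.p = r ≫ B.p
        simp [he1, e1']⟩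
      inv := ⟨B.p ≫ j, by
        change B.p ≫ (B.p ≫ j) ≫ e.f 1 = B.p ≫ j
        simp [he1, e1']⟩
      hom_inv_id := by
        apply Karoubi.hom_ext
        change (r ≫ B.p) ≫ B.p ≫ j = e.f 1
        simp [he1]
      inv_hom_id := by
        apply Karoubi.hom_ext
        change (B.p ≫ j) ≫ r ≫ B.p = B.p
        simp [e1'] }
  have hα : (karoubiComplex (A := A) (C := P) Z e idem hlift).ι ≫ α.hom = f := by
    apply Karoubi.hom_ext
    rw [Karoubi.comp_f, karoubiComplex_ι_f]
    change (A.p ≫ Z.ι) ≫ r ≫ B.p = f.f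
    rw [hpι, Category.assoc, e1', hfq]
  rw [← hα]
  exact h.karoubi_isExactRealisation.isInflation_of_iso hmem α

/-- The dual of `isInflation_karoubi`. -/
lemma isDeflation_karoubi {A' : 𝒞} {δ : Extn E C.X A'} {X : NComplex n A' C.X} (hX : X ∈ s δ)
    (f : B ⟶ C) (i : X.K.X n ⟶ B.X) (hi : X.π ≫ C.p = i ≫ f.f) :
    IsDeflation (karoubiRealisation s) f := by
  obtain ⟨Y, hY⟩ := h.exists_mem (pull E C.p δ)
  obtain ⟨g, hg⟩ := h.exists_lift (pull E C.p δ) δ (𝟙 _) C.p (push_id E _) Y hY X hX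
  obtain ⟨A', a, Z, hZ, j, r, m, e1, e2, e3⟩ := h.exists_deflation_retract hY f.f (g.f n ≫ i)
  have hpπ : Z.π ≫ C.p = j ≫ f.f := by
    have : (Y.π - (g.f n ≫ i) ≫ f.f) ≫ C.p = 0 := by
      rw [Category.assoc, ← hi, ← Category.assoc (g.f n), hg.comp_π]
      simp
    rw [e3, Preadditive.add_comp, Category.assoc m, this]
    simp
  have hZe := h.isNExangle _ Z hZ
  have hpδ : pull E C.p (push E a (pull E C.p δ)) = push E a (pull E C.p δ) := by
    rw [pull_push, pull_pull, C.idem]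
  have hqf : B.p ≫ f.f = f.f := Karoubi.p_comp f
  have e1' {T : 𝒞} (x : B.X ⟶ T) : r ≫ j ≫ x = x := by
    rw [← Category.assoc, e1, Category.id_comp]
  obtain ⟨e, idem, ⟨H⟩, he0, he1⟩ := hZe.exists_idempotent_last h.additive_fst C.idem hpδ
    (q := j ≫ B.p ≫ r) (by simp [e1'])
    (by rw [hpπ, Category.assoc, Category.assoc, e2, hqf])
  let P : Karoubi 𝒞 := ⟨A', Z.endLeft e, by
    have := idem_f idem 0
    simp [endLeft, reassoc_of% this]⟩
  have hlift : Z.IsLift Z e P.p C.p := (isLift_endLeft_endRight Z e).congr rfl he0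
  obtain ⟨δ', hδ'⟩ := exists_underlying_eq E (A := P) (C := C)
    (hZe.push_endLeft h.additive_snd H) hpδ
  have hmem := karoubiComplex_mem (δ := δ') (X := Z) (hδ' ▸ hZ) e idem hlift
  let α : (karoubiComplex (A := P) (C := C) Z e idem hlift).K.X n ≅ B :=
    { hom := ⟨j ≫ B.p, by
        change e.f n ≫ (j ≫ B.p) ≫ B.p = j ≫ B.p
        simp [he1, e1']⟩
      inv := ⟨B.p ≫ r, by
        change B.p ≫ (B.p ≫ r) ≫ e.f n = B.p ≫ r
        simp [he1, e1']⟩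
      hom_inv_id := by
        apply Karoubi.hom_ext
        change (j ≫ B.p) ≫ B.p ≫ r = e.f n
        simp [he1]
      inv_hom_id := by
        apply Karoubi.hom_ext
        change (B.p ≫ r) ≫ j ≫ B.p = B.p
        simp [e1'] }
  have hα : α.inv ≫ (karoubiComplex (A := P) (C := C) Z e idem hlift).π = f := by
    apply Karoubi.hom_ext
    rw [Karoubi.comp_f, karoubiComplex_π_f]
    change (B.p ≫ r) ≫ Z.π ≫ C.p = f.f
    rw [hpπ, Category.assoc, e1', hqf]
  rw [← hα]
  exact h.karoubi_isExactRealisation.isDeflation_of_iso hmem α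

lemma karoubi_inflation_comp (f : A ⟶ B) (g : B ⟶ D) (hf : IsInflation (karoubiRealisation s) f)
    (hg : IsInflation (karoubiRealisation s) g) : IsInflation (karoubiRealisation s) (f ≫ g) := by
  obtain ⟨P, δ, X, hX, i, hi⟩ := exists_of_isInflation_karoubi hf
  obtain ⟨P', δ', X', hX', i', hi'⟩ := exists_of_isInflation_karoubi hg
  obtain ⟨Q, c, Z, hZ, j, r, m, -, -, e3⟩ := h.exists_inflation_retract hX f.f i
  have hpι : A.p ≫ Z.ι = f.f ≫ j := by
    have : A.p ≫ (X.ι - f.f ≫ i) = 0 := by simp [hi]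
    rw [e3, Preadditive.comp_add, ← Category.assoc A.p (X.ι - _), this]
    simp
  obtain ⟨Y, hY⟩ := h.exists_mem (push E j δ')
  obtain ⟨b, hb⟩ := h.exists_lift δ' (push E j δ') j (𝟙 _) (pull_id E _).symm X' hX' Y hY
  have hψ := h.inflation_comp _ _ ⟨_, Z, hZ⟩ ⟨_, Y, hY⟩
  have key : A.p ≫ Z.ι ≫ Y.ι = (f ≫ g).f ≫ i' ≫ b.f 1 := by
    rw [← Category.assoc, hpι, Category.assoc, ← hb.ι_comp, Karoubi.comp_f, Category.assoc,
      ← Category.assoc g.f, ← hi', Category.assoc, ← Category.assoc f.f B.p, Karoubi.comp_p]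
  obtain ⟨R, ρ, W, hW, e, hψW⟩ := hψ.exists_mem
  refine h.isInflation_karoubi hW (f ≫ g) ((i' ≫ b.f 1) ≫ eqToHom e.symm) ?_
  rw [← Category.assoc (f ≫ g).f, ← key, hψW]
  simp

lemma karoubi_deflation_comp (f : B ⟶ C) (g : C ⟶ D) (hf : IsDeflation (karoubiRealisation s) f)
    (hg : IsDeflation (karoubiRealisation s) g) : IsDeflation (karoubiRealisation s) (f ≫ g) := by
  obtain ⟨P, δ, X, hX, i, hi⟩ := exists_of_isDeflation_karoubi hg
  obtain ⟨P', δ', X', hX', i', hi'⟩ := exists_of_isDeflation_karoubi hf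
  obtain ⟨Q, a, Z, hZ, j, r, m, -, -, e3⟩ := h.exists_deflation_retract hX g.f i
  have hpπ : Z.π ≫ D.p = j ≫ g.f := by
    have : (X.π - i ≫ g.f) ≫ D.p = 0 := by simp [hi]
    rw [e3, Preadditive.add_comp, Category.assoc m, this]
    simp
  obtain ⟨Y, hY⟩ := h.exists_mem (pull E j δ')
  obtain ⟨b, hb⟩ := h.exists_lift (pull E j δ') δ' (𝟙 _) j (push_id E _) Y hY X' hX'
  have hψ := h.deflation_comp _ _ ⟨_, Y, hY⟩ ⟨_, Z, hZ⟩
  have key : (Y.π ≫ Z.π) ≫ D.p = (b.f n ≫ i') ≫ (f ≫ g).f := by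
    rw [Category.assoc, hpπ, ← Category.assoc, ← hb.comp_π, Karoubi.comp_f, Category.assoc,
      Category.assoc, ← Category.assoc i', ← hi', Category.assoc, Karoubi.p_comp]
  obtain ⟨R, ρ, W, hW, e, hψW⟩ := hψ.exists_mem
  refine h.isDeflation_karoubi hW (f ≫ g) (eqToHom e.symm ≫ b.f n ≫ i') ?_
  rw [Category.assoc, ← key, hψW]
  simp

end IsNExangulated

end Inflations

namespace NComplex

/-! ### Recognising mapping cones and cocones -/

section Recognition

variable {𝒞 : Type u} [Category.{v} 𝒞] [Preadditive 𝒞] {n : ℕ} {A B C D : 𝒞}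

lemma htpyEquiv_of_iso {X Y : NComplex n A C} (φ : X.K ≅ Y.K)
    (h : X.IsLift Y φ.hom (𝟙 A) (𝟙 C)) : HtpyEquiv X Y := by
  refine ⟨φ.hom, φ.inv, h, ⟨?_, ?_⟩, ⟨Homotopy.ofEq φ.hom_inv_id⟩, ⟨Homotopy.ofEq φ.inv_hom_id⟩⟩
  · have h0 := HomologicalComplex.congr_hom φ.inv_hom_id 0
    rw [HomologicalComplex.comp_f, h.f_zero] at h0
    rw [← cancel_mono (eqToHom Y.left.symm)]
    simpa using h0
  · have h0 := HomologicalComplex.congr_hom φ.inv_hom_id (n + 1)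
    rw [HomologicalComplex.comp_f, h.f_last] at h0
    rw [← cancel_mono (eqToHom Y.right.symm)]
    simpa using h0

variable [HasFiniteBiproducts 𝒞]

/-- A complex with the direct sum decompositions and the differentials of a mapping cone is
isomorphic to the mapping cone. -/
lemma htpyEquiv_cone (X : NComplex n A C) (Y : NComplex n B D) (f : X.K ⟶ Y.K)
    (Z : NComplex n (X.K.X 1) D) (i₁ : ∀ i, X.K.X (i + 1) ⟶ Z.K.X i)
    (i₂ : ∀ i, Y.K.X i ⟶ Z.K.X i) (p₁ : ∀ i, Z.K.X i ⟶ X.K.X (i + 1))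
    (p₂ : ∀ i, Z.K.X i ⟶ Y.K.X i) (h₁₁ : ∀ i, i₁ i ≫ p₁ i = 𝟙 _) (h₁₂ : ∀ i, i₁ i ≫ p₂ i = 0)
    (h₂₁ : ∀ i, i₂ i ≫ p₁ i = 0) (h₂₂ : ∀ i, i₂ (i + 1) ≫ p₂ (i + 1) = 𝟙 _) (h₀ : i₂ 0 = 0)
    (hid : ∀ i, p₁ i ≫ i₁ i + p₂ i ≫ i₂ i = 𝟙 _)
    (hd₁ : ∀ i, i₁ i ≫ Z.K.d i (i + 1) =
      f.f (i + 1) ≫ i₂ (i + 1) - X.K.d (i + 1) (i + 2) ≫ i₁ (i + 1))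
    (hd₂ : ∀ i, i₂ (i + 1) ≫ Z.K.d (i + 1) (i + 2) = Y.K.d (i + 1) (i + 2) ≫ i₂ (i + 2))
    (hl : i₁ 0 ≫ eqToHom Z.left = 𝟙 _) (hr : i₂ (n + 1) ≫ eqToHom Z.right = eqToHom Y.right) :
    HtpyEquiv (X.cone Y f) Z := by
  let ψ : ∀ i, coneX X Y i ≅ Z.K.X i := fun i =>
    { hom := coneFst X Y i ≫ i₁ i + coneSnd X Y i ≫ i₂ i
      inv := p₁ i ≫ coneInl X Y i + p₂ i ≫ coneInr X Y i
      hom_inv_id := by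
        have a1 : i₁ i ≫ p₁ i ≫ coneInl X Y i = coneInl X Y i := by
          rw [← Category.assoc, h₁₁, Category.id_comp]
        have a2 : i₁ i ≫ p₂ i ≫ coneInr X Y i = 0 := by
          rw [← Category.assoc, h₁₂, zero_comp]
        have a3 : i₂ i ≫ p₁ i ≫ coneInl X Y i = 0 := by
          rw [← Category.assoc, h₂₁, zero_comp]
        have a4 : i₂ i ≫ p₂ i ≫ coneInr X Y i = coneInr X Y i := by
          cases i with
          | zero => rw [h₀]; simp [coneInr]
          | succ i => rw [← Category.assoc, h₂₂, Category.id_comp]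
        simp [a1, a2, a3, a4, coneFst_inl_add]
      inv_hom_id := by
        have a1 : coneInr X Y i ≫ coneSnd X Y i ≫ i₂ i = i₂ i := by
          cases i with
          | zero => rw [h₀]; simp
          | succ i => rw [coneInr_snd_assoc]
        simp [coneInl_fst_assoc, coneInl_snd_assoc, coneInr_fst_assoc, a1, hid] }
  have hψ : ∀ i, (ψ i).hom ≫ Z.K.d i (i + 1) = coneD X Y f i ≫ (ψ (i + 1)).hom := by
    intro i
    apply coneX_hom_ext
    · rw [← Category.assoc, ← Category.assoc, coneInl_d]
      simp [ψ, coneInl_fst_assoc, coneInl_snd_assoc, coneInr_fst_assoc, coneInr_snd_assoc, hd₁]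
      abel
    · cases i with
      | zero => simp [coneInr]
      | succ i =>
        rw [← Category.assoc, ← Category.assoc, coneInr_d]
        simp [ψ, coneInr_fst_assoc, coneInr_snd_assoc, hd₂]
  refine htpyEquiv_of_iso (HomologicalComplex.Hom.isoOfComponents ψ ?_) ⟨?_, ?_⟩
  · rintro i _ rfl
    rw [cone_d]
    exact hψ i
  · have h1 (h : coneX X Y 0 = X.K.X 1) : (ψ 0).hom ≫ eqToHom Z.left = eqToHom h ≫ 𝟙 _ := by
      simp [ψ, h₀, hl, coneFst]
    exact h1 _
  · have h1 (h : coneX X Y (n + 1) = D) : (ψ (n + 1)).hom ≫ eqToHom Z.right = eqToHom h ≫ 𝟙 _ := by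
      simp [ψ, hr, coneFst, coneSnd]
    exact h1 _

/-- A complex with the direct sum decompositions and the differentials of a mapping cocone is
isomorphic to the mapping cocone. -/
lemma htpyEquiv_cocone (X : NComplex n A C) (Y : NComplex n B D) (f : X.K ⟶ Y.K)
    (Z : NComplex n A (Y.K.X n)) (i₁ : ∀ i, X.K.X i ⟶ Z.K.X i)
    (i₂ : ∀ i, Y.K.X i ⟶ Z.K.X (i + 1)) (p₁ : ∀ i, Z.K.X i ⟶ X.K.X i)
    (p₂ : ∀ i, Z.K.X (i + 1) ⟶ Y.K.X i) (h₁₁ : ∀ i ≤ n, i₁ i ≫ p₁ i = 𝟙 _)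
    (h₁₂ : ∀ i, i₁ (i + 1) ≫ p₂ i = 0) (h₂₁ : ∀ i, i₂ i ≫ p₁ (i + 1) = 0)
    (h₂₂ : ∀ i ≤ n, i₂ i ≫ p₂ i = 𝟙 _) (h₀ : i₁ (n + 1) = 0) (hid₀ : p₁ 0 ≫ i₁ 0 = 𝟙 _)
    (hid : ∀ i ≤ n, p₁ (i + 1) ≫ i₁ (i + 1) + p₂ i ≫ i₂ i = 𝟙 _)
    (hd₁ : ∀ i ≤ n, i₁ i ≫ Z.K.d i (i + 1) = X.K.d i (i + 1) ≫ i₁ (i + 1) + f.f i ≫ i₂ i)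
    (hd₂ : ∀ i < n, i₂ i ≫ Z.K.d (i + 1) (i + 2) = -Y.K.d i (i + 1) ≫ i₂ (i + 1))
    (hl : i₁ 0 ≫ eqToHom Z.left = eqToHom X.left) (hr : i₂ n ≫ eqToHom Z.right = 𝟙 _) :
    HtpyEquiv (X.cocone Y f) Z := by
  have hX : ∀ i, n < i → IsZero (coconeX X Y (i + 1)) := fun i hi =>
    isZero_coconeX X Y _ (by omega)
  have hZ : ∀ i, n < i → IsZero (Z.K.X (i + 1)) := fun i hi => Z.isZero _ (by omega)
  have h₁₀ : ∀ i, n < i → i₁ i = 0 := by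
    intro i hi
    obtain rfl | hi : i = n + 1 ∨ n + 1 < i := by omega
    · exact h₀
    · exact (X.isZero _ hi).eq_of_src _ _
  have a1 {i : ℕ} (hi : i ≤ n) {T : 𝒞} (g : X.K.X i ⟶ T) : i₁ i ≫ p₁ i ≫ g = g := by
    rw [← Category.assoc, h₁₁ i hi, Category.id_comp]
  have a2 (i : ℕ) {T : 𝒞} (g : Y.K.X i ⟶ T) : i₁ (i + 1) ≫ p₂ i ≫ g = 0 := by
    rw [← Category.assoc, h₁₂, zero_comp]
  have a3 (i : ℕ) {T : 𝒞} (g : X.K.X (i + 1) ⟶ T) : i₂ i ≫ p₁ (i + 1) ≫ g = 0 := by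
    rw [← Category.assoc, h₂₁, zero_comp]
  have a4 {i : ℕ} (hi : i ≤ n) {T : 𝒞} (g : Y.K.X i ⟶ T) : i₂ i ≫ p₂ i ≫ g = g := by
    rw [← Category.assoc, h₂₂ i hi, Category.id_comp]
  have a5 (i : ℕ) : coconeInl X Y i ≫ coconeFst X Y i ≫ i₁ i = i₁ i := by
    by_cases hi : i ≤ n
    · rw [coconeInl_fst_assoc X Y hi]
    · simp [h₁₀ i (by omega)]
  have a6 (i : ℕ) : i₁ i ≫ p₁ i ≫ coconeInl X Y i = coconeInl X Y i := by
    by_cases hi : i ≤ n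
    · rw [a1 hi]
    · obtain ⟨i, rfl⟩ : ∃ k, i = k + 1 := ⟨i - 1, by omega⟩
      simp [coconeInl, hi]
  let ψ : ∀ i, coconeX X Y i ≅ Z.K.X i := fun
    | 0 =>
      { hom := coconeFst X Y 0 ≫ i₁ 0
        inv := p₁ 0 ≫ coconeInl X Y 0
        hom_inv_id := by
          apply coconeX_hom_ext_zero
          simp [coconeInl_fst_assoc, a1]
        inv_hom_id := by simp [coconeInl_fst_assoc, hid₀] }
    | i + 1 =>
      { hom := coconeFst X Y (i + 1) ≫ i₁ (i + 1) + coconeSnd X Y i ≫ i₂ i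
        inv := p₁ (i + 1) ≫ coconeInl X Y (i + 1) + p₂ i ≫ coconeInr X Y i
        hom_inv_id := by
          by_cases hi : i ≤ n
          swap
          · exact (hX i (by omega)).eq_of_src _ _
          have a7 : coconeInl X Y (i + 1) ≫ coconeFst X Y (i + 1) ≫ coconeInl X Y (i + 1) =
              coconeInl X Y (i + 1) := by
            by_cases hi' : i + 1 ≤ n
            · rw [coconeInl_fst_assoc X Y hi']
            · simp [coconeInl, hi']
          apply coconeX_hom_ext_succ
          · simp [a7, coconeInl_snd_assoc, a2, a6]
          · simp [coconeInr_fst_assoc, coconeInr_snd_assoc X Y hi, a3, a4 hi]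
        inv_hom_id := by
          by_cases hi : i ≤ n
          swap
          · exact (hZ i (by omega)).eq_of_src _ _
          simp [a5, coconeInl_snd_assoc, coconeInr_fst_assoc, coconeInr_snd_assoc X Y hi,
            hid i hi] }
  have ψ1 : ∀ i, coconeInl X Y i ≫ (ψ i).hom = i₁ i := by
    rintro (_ | i)
    · exact a5 0
    · simp [ψ, a5, coconeInl_snd_assoc]
  have ψ2 : ∀ i ≤ n, coconeInr X Y i ≫ (ψ (i + 1)).hom = i₂ i := by
    intro i hi
    simp [ψ, coconeInr_fst_assoc, coconeInr_snd_assoc X Y hi]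
  have hψ : ∀ i, (ψ i).hom ≫ Z.K.d i (i + 1) = coconeD X Y f i ≫ (ψ (i + 1)).hom := by
    have b1 : ∀ i ≤ n, coconeInl X Y i ≫ (ψ i).hom ≫ Z.K.d i (i + 1) =
        coconeInl X Y i ≫ coconeD X Y f i ≫ (ψ (i + 1)).hom := by
      intro i hi
      rw [← Category.assoc, ← Category.assoc, coconeInl_d X Y f hi, ψ1, hd₁ i hi,
        Preadditive.add_comp, Category.assoc, Category.assoc, ψ1, ψ2 i hi]
    intro i
    by_cases hi : i ≤ n
    swap
    · exact (hZ i (by omega)).eq_of_tgt _ _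
    rcases i with _ | i
    · exact coconeX_hom_ext_zero _ _ (b1 0 hi)
    · apply coconeX_hom_ext_succ
      · exact b1 _ hi
      · rw [← Category.assoc, ← Category.assoc, ψ2 i (by omega), coconeInr_d X Y f (by omega),
          hd₂ i (by omega), Preadditive.neg_comp, Category.assoc, ψ2 _ hi]
  refine htpyEquiv_of_iso (HomologicalComplex.Hom.isoOfComponents ψ ?_) ⟨?_, ?_⟩
  · rintro i _ rfl
    rw [cocone_d]
    exact hψ i
  · have h1 (h : coconeX X Y 0 = A) : (ψ 0).hom ≫ eqToHom Z.left = eqToHom h ≫ 𝟙 _ := by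
      simp [ψ, hl, coconeFst]
    exact h1 _
  · have h1 (h : coconeX X Y (n + 1) = Y.K.X n) :
        (ψ (n + 1)).hom ≫ eqToHom Z.right = eqToHom h ≫ 𝟙 _ := by
      simp [ψ, h₀, hr, coconeSnd]
    exact h1 _

end Recognition

end NComplex

/-! ### Good lifts do not depend on the representing complexes -/

section Transport

open NComplex

variable {𝒞 : Type u} [Category.{v} 𝒞] [Preadditive 𝒞] [HasFiniteBiproducts 𝒞]
  {E : 𝒞ᵒᵖ ⥤ 𝒞 ⥤ AddCommGrpCat.{w}} {n : ℕ} [NeZero n] {A B C D : 𝒞} {s : Assignment E n}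

/-- If a good lift of `(𝟙, c)` exists for some complexes realising the two extensions, then one
exists for all of them. -/
lemma IsExactRealisation.exists_cone_mem (h : IsExactRealisation s)
    (hE : ∀ C, (E.obj C).Additive) (δ : Extn E D A) (c : C ⟶ D)
    {X X' : NComplex n A C} (hX : X ∈ s (pull E c δ)) (hX' : X' ∈ s (pull E c δ))
    {Y Y' : NComplex n A D} (hY : Y ∈ s δ) (hY' : Y' ∈ s δ)
    {f : X.K ⟶ Y.K} (hf : X.IsLift Y f (𝟙 A) c) (hcone : X.cone Y f ∈ s (push E X.ι δ)) :
    ∃ f' : X'.K ⟶ Y'.K, X'.IsLift Y' f' (𝟙 A) c ∧ X'.cone Y' f' ∈ s (push E X'.ι δ) := by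
  obtain ⟨F, G, hF, hG, ⟨H1⟩, ⟨H2⟩⟩ := h.htpyEquiv_of_mem hX hX'
  obtain ⟨F', G', hF', hG', ⟨H1'⟩, ⟨H2'⟩⟩ := h.htpyEquiv_of_mem hY hY'
  have hf' : X'.IsLift Y' (G ≫ f ≫ F') (𝟙 A) c :=
    (hG.comp (hf.comp hF')).congr (by simp) (by simp)
  refine ⟨_, hf', h.cone_mem hE δ c hX hX' hY' hf hf' hcone hG hF hG' hF' H2 ?_ ?_⟩
  · exact (Homotopy.ofEq (by simp)).trans
      ((H1'.compLeft (G ≫ f)).trans (Homotopy.ofEq (by simp)))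
  · exact (Homotopy.ofEq (by simp)).trans
      ((H1.symm.compRight (f ≫ F')).trans (Homotopy.ofEq (by simp)))

/-- The dual of `exists_cone_mem`. -/
lemma IsExactRealisation.exists_cocone_mem (h : IsExactRealisation s)
    (hE : E.Additive) (δ : Extn E C A) (a : A ⟶ B)
    {X X' : NComplex n A C} (hX : X ∈ s δ) (hX' : X' ∈ s δ)
    {Y Y' : NComplex n B C} (hY : Y ∈ s (push E a δ)) (hY' : Y' ∈ s (push E a δ))
    {f : X.K ⟶ Y.K} (hf : X.IsLift Y f a (𝟙 C)) (hcocone : X.cocone Y f ∈ s (pull E Y.π δ)) :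
    ∃ f' : X'.K ⟶ Y'.K, X'.IsLift Y' f' a (𝟙 C) ∧ X'.cocone Y' f' ∈ s (pull E Y'.π δ) := by
  obtain ⟨F, G, hF, hG, ⟨H1⟩, ⟨H2⟩⟩ := h.htpyEquiv_of_mem hX hX'
  obtain ⟨F', G', hF', hG', ⟨H1'⟩, ⟨H2'⟩⟩ := h.htpyEquiv_of_mem hY hY'
  have hf' : X'.IsLift Y' (G ≫ f ≫ F') a (𝟙 C) :=
    (hG.comp (hf.comp hF')).congr (by simp) (by simp)
  refine ⟨_, hf', h.cocone_mem hE δ a hX' hY hY' hf hf' hcocone hG hF hG' hF' H2' ?_ ?_⟩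
  · exact (Homotopy.ofEq (by simp)).trans
      ((H1'.compLeft (G ≫ f)).trans (Homotopy.ofEq (by simp)))
  · exact (Homotopy.ofEq (by simp)).trans
      ((H1.symm.compRight (f ≫ F')).trans (Homotopy.ofEq (by simp)))

end Transport

/-! ### Mapping cones and cocones over the idempotent completion -/

section KaroubiCone

open NComplex

lemma nullMap_zero {𝒞 : Type u} [Category.{v} 𝒞] [Preadditive 𝒞] {K L : CochainComplex 𝒞 ℕ} :
    (nullMap (fun _ => 0) : K ⟶ L) = 0 := by
  ext i
  cases i <;> simp [nullMap_f_zero, nullMap_f_succ]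

variable {𝒞 : Type u} [Category.{v} 𝒞] [Preadditive 𝒞] [HasFiniteBiproducts 𝒞] {n : ℕ}
  {A B C D : Karoubi 𝒞}

/-- If `f` commutes with the idempotents `e` and `e'`, then the mapping cone over the idempotent
completion of the morphism `(X, e) ⟶ (Y, e')` given by `f` is the mapping cone of `f` with the
idempotent with the components `e` and `e'`. -/
lemma exists_htpyEquiv_cone_karoubi (X : NComplex n A.X C.X) (e : X.K ⟶ X.K) (idem : e ≫ e = e)
    (he : X.IsLift X e A.p C.p) (Y : NComplex n B.X D.X) (e' : Y.K ⟶ Y.K) (idem' : e' ≫ e' = e')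
    (he' : Y.IsLift Y e' B.p D.p) (f : X.K ⟶ Y.K) (hf : f ≫ e' = e ≫ f)
    (hf' : e ≫ (e ≫ f) ≫ e' = e ≫ f) :
    ∃ (E : (X.cone Y f).K ⟶ (X.cone Y f).K) (idemE : E ≫ E = E)
      (hE : (X.cone Y f).IsLift (X.cone Y f) E (e.f 1) D.p),
      HtpyEquiv ((karoubiComplex X e idem he).cone (karoubiComplex Y e' idem' he')
          (karoubiHom e idem he e' idem' he' (e ≫ f) hf'))
        (karoubiComplex (A := (karoubiComplex X e idem he).K.X 1) (C := D) (X.cone Y f) E idemE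
          hE) := by
  have hff (i : ℕ) {T : 𝒞} (g : Y.K.X i ⟶ T) : f.f i ≫ e'.f i ≫ g = e.f i ≫ f.f i ≫ g := by
    have := HomologicalComplex.congr_hom hf i =≫ g
    simpa using this
  have ea (i : ℕ) {T : 𝒞} (g : X.K.X i ⟶ T) : e.f i ≫ e.f i ≫ g = e.f i ≫ g := by
    rw [← Category.assoc, idem_f idem]
  have ea' (i : ℕ) {T : 𝒞} (g : Y.K.X i ⟶ T) : e'.f i ≫ e'.f i ≫ g = e'.f i ≫ g := by
    rw [← Category.assoc, idem_f idem']
  let q (i : ℕ) : coneX X Y i ⟶ coneX X Y i := coneMapX X Y X Y e e' (fun _ => 0) i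
  have q1 (i : ℕ) {T : 𝒞} (g : coneX X Y i ⟶ T) :
      coneInl X Y i ≫ q i ≫ g = e.f (i + 1) ≫ coneInl X Y i ≫ g := by
    simp [q, coneMapX, coneInl_fst_assoc, coneInl_snd_assoc]
  have q2 (i : ℕ) {T : 𝒞} (g : coneX X Y i ⟶ T) :
      coneInr X Y i ≫ q i ≫ g = e'.f i ≫ coneInr X Y i ≫ g := by
    cases i with
    | zero => simp [coneInr]
    | succ i => simp [q, coneMapX, coneInr_fst_assoc, coneInr_snd_assoc]
  have q1' (i : ℕ) : coneInl X Y i ≫ q i = e.f (i + 1) ≫ coneInl X Y i := by simpa using q1 i (𝟙 _)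
  have q2' (i : ℕ) : coneInr X Y i ≫ q i = e'.f i ≫ coneInr X Y i := by simpa using q2 i (𝟙 _)
  have q3 (i : ℕ) {T : 𝒞} (g : X.K.X (i + 1) ⟶ T) :
      q i ≫ coneFst X Y i ≫ g = coneFst X Y i ≫ e.f (i + 1) ≫ g := by
    simp [q, coneMapX, coneInl_fst_assoc, coneInr_fst_assoc]
  have q4 (i : ℕ) {T : 𝒞} (g : Y.K.X i ⟶ T) :
      q i ≫ coneSnd X Y i ≫ g = coneSnd X Y i ≫ e'.f i ≫ g := by
    cases i with
    | zero => simp [coneSnd]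
    | succ i => simp [q, coneMapX, coneInl_snd_assoc, coneInr_snd_assoc]
  have q5 (i : ℕ) : coneFst X Y i ≫ e.f (i + 1) ≫ coneInl X Y i +
      coneSnd X Y i ≫ e'.f i ≫ coneInr X Y i = q i := by
    simp [q, coneMapX]
  have hqq (i : ℕ) : q i ≫ q i = q i := by
    apply coneX_hom_ext
    · rw [q1, q1', ea]
    · rw [q2, q2', ea']
  let E : (X.cone Y f).K ⟶ (X.cone Y f).K :=
    coneMap X Y X Y f f e e' (fun _ => 0) rfl (by rw [nullMap_zero, zero_add, hf])
  have idemE : E ≫ E = E := by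
    ext i
    exact hqq i
  have hE : (X.cone Y f).IsLift (X.cone Y f) E (e.f 1) D.p :=
    isLift_coneMap _ _ _ _ _ _ _ _ _ _ _ he'
  refine ⟨E, idemE, hE, htpyEquiv_cone _ _ _ _
    (fun i => ⟨(e.f (i + 1) ≫ coneInl X Y i : X.K.X (i + 1) ⟶ coneX X Y i), ?_⟩)
    (fun i => ⟨(e'.f i ≫ coneInr X Y i : Y.K.X i ⟶ coneX X Y i), ?_⟩)
    (fun i => ⟨(coneFst X Y i ≫ e.f (i + 1) : coneX X Y i ⟶ X.K.X (i + 1)), ?_⟩)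
    (fun i => ⟨(coneSnd X Y i ≫ e'.f i : coneX X Y i ⟶ Y.K.X i), ?_⟩)
    ?_ ?_ ?_ ?_ ?_ ?_ ?_ ?_ ?_ ?_⟩
  · have : e.f (i + 1) ≫ (e.f (i + 1) ≫ coneInl X Y i) ≫ q i = e.f (i + 1) ≫ coneInl X Y i := by
      simp [q1', ea]
    exact this
  · have : e'.f i ≫ (e'.f i ≫ coneInr X Y i) ≫ q i = e'.f i ≫ coneInr X Y i := by
      simp [q2', ea']
    exact this
  · have : q i ≫ (coneFst X Y i ≫ e.f (i + 1)) ≫ e.f (i + 1) = coneFst X Y i ≫ e.f (i + 1) := by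
      simp [q3, idem_f idem]
    exact this
  · have : q i ≫ (coneSnd X Y i ≫ e'.f i) ≫ e'.f i = coneSnd X Y i ≫ e'.f i := by
      simp [q4, idem_f idem']
    exact this
  · intro i
    have : (e.f (i + 1) ≫ coneInl X Y i) ≫ coneFst X Y i ≫ e.f (i + 1) = e.f (i + 1) := by
      simp [coneInl_fst_assoc, idem_f idem]
    exact Karoubi.hom_ext _ _ this
  · intro i
    have : (e.f (i + 1) ≫ coneInl X Y i) ≫ coneSnd X Y i ≫ e'.f i = 0 := by
      simp [coneInl_snd_assoc]
    exact Karoubi.hom_ext _ _ this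
  · intro i
    have : (e'.f i ≫ coneInr X Y i) ≫ coneFst X Y i ≫ e.f (i + 1) = 0 := by
      simp [coneInr_fst_assoc]
    exact Karoubi.hom_ext _ _ this
  · intro i
    have : (e'.f (i + 1) ≫ coneInr X Y (i + 1)) ≫ coneSnd X Y (i + 1) ≫ e'.f (i + 1) =
        e'.f (i + 1) := by
      simp [coneInr_snd_assoc, idem_f idem']
    exact Karoubi.hom_ext _ _ this
  · have : e'.f 0 ≫ coneInr X Y 0 = 0 := by simp [coneInr]
    exact Karoubi.hom_ext _ _ this
  · intro i
    have : (coneFst X Y i ≫ e.f (i + 1)) ≫ (e.f (i + 1) ≫ coneInl X Y i) +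
        (coneSnd X Y i ≫ e'.f i) ≫ (e'.f i ≫ coneInr X Y i) = q i := by
      simp only [Category.assoc, ea, ea', q5]
    exact Karoubi.hom_ext _ _ this
  · intro i
    have : (e.f (i + 1) ≫ coneInl X Y i) ≫ q i ≫ coneD X Y f i =
        (e.f (i + 1) ≫ f.f (i + 1)) ≫ e'.f (i + 1) ≫ coneInr X Y (i + 1) -
          (e.f (i + 1) ≫ X.K.d (i + 1) (i + 2)) ≫ e.f (i + 2) ≫ coneInl X Y (i + 1) := by
      rw [Category.assoc, q1, ea, coneInl_d, Preadditive.comp_sub, Category.assoc, hff, ea,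
        Category.assoc, ← HomologicalComplex.Hom.comm_assoc, ea]
    rw [← cone_d, sub_eq_add_neg] at this
    exact Karoubi.hom_ext _ _ this
  · intro i
    have : (e'.f (i + 1) ≫ coneInr X Y (i + 1)) ≫ q (i + 1) ≫ coneD X Y f (i + 1) =
        (e'.f (i + 1) ≫ Y.K.d (i + 1) (i + 2)) ≫ e'.f (i + 2) ≫ coneInr X Y (i + 2) := by
      rw [Category.assoc, q2, ea', coneInr_d, Category.assoc,
        ← HomologicalComplex.Hom.comm_assoc, ea']
    rw [← cone_d] at this
    exact Karoubi.hom_ext _ _ this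
  · have : (e.f 1 ≫ coneInl X Y 0) ≫ eqToHom (coneX_zero X Y) ≫ e.f 1 = e.f 1 := by
      simp [coneInl, idem_f idem]
    exact Karoubi.hom_ext _ _ ((congrArg (fun x : coneX X Y 0 ⟶ X.K.X 1 =>
      (e.f 1 ≫ coneInl X Y 0) ≫ x) (karoubiComplex_eqToHom_left
        (A := (karoubiComplex X e idem he).K.X 1) _ E idemE hE)).trans this)
  · have (h : coneX X Y (n + 1) = D.X) : (e'.f (n + 1) ≫ coneInr X Y (n + 1)) ≫ eqToHom h ≫ D.p =
        eqToHom Y.right ≫ D.p := by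
      simp [coneInr, he'.f_last]
    exact Karoubi.hom_ext _ _ ((congrArg (fun x : coneX X Y (n + 1) ⟶ D.X =>
      (e'.f (n + 1) ≫ coneInr X Y (n + 1)) ≫ x) (karoubiComplex_eqToHom_right
        (A := (karoubiComplex X e idem he).K.X 1) _ E idemE hE)).trans
      ((this _).trans (karoubiComplex_eqToHom_right Y e' idem' he').symm))

/-- If `f` commutes with the idempotents `e` and `e'`, then the mapping cocone over the idempotent
completion of the morphism `(X, e) ⟶ (Y, e')` given by `f` is the mapping cocone of `f` with the
idempotent with the components `e` and `e'`. -/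
lemma exists_htpyEquiv_cocone_karoubi (X : NComplex n A.X C.X) (e : X.K ⟶ X.K) (idem : e ≫ e = e)
    (he : X.IsLift X e A.p C.p) (Y : NComplex n B.X D.X) (e' : Y.K ⟶ Y.K) (idem' : e' ≫ e' = e')
    (he' : Y.IsLift Y e' B.p D.p) (f : X.K ⟶ Y.K) (hf : f ≫ e' = e ≫ f)
    (hf' : e ≫ (e ≫ f) ≫ e' = e ≫ f) :
    ∃ (E : (X.cocone Y f).K ⟶ (X.cocone Y f).K) (idemE : E ≫ E = E)
      (hE : (X.cocone Y f).IsLift (X.cocone Y f) E A.p (e'.f n)),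
      HtpyEquiv ((karoubiComplex X e idem he).cocone (karoubiComplex Y e' idem' he')
          (karoubiHom e idem he e' idem' he' (e ≫ f) hf'))
        (karoubiComplex (A := A) (C := (karoubiComplex Y e' idem' he').K.X n) (X.cocone Y f) E
          idemE hE) := by
  have hff (i : ℕ) {T : 𝒞} (g : Y.K.X i ⟶ T) : f.f i ≫ e'.f i ≫ g = e.f i ≫ f.f i ≫ g := by
    have := HomologicalComplex.congr_hom hf i =≫ g
    simpa using this
  have ea (i : ℕ) {T : 𝒞} (g : X.K.X i ⟶ T) : e.f i ≫ e.f i ≫ g = e.f i ≫ g := by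
    rw [← Category.assoc, idem_f idem]
  have ea' (i : ℕ) {T : 𝒞} (g : Y.K.X i ⟶ T) : e'.f i ≫ e'.f i ≫ g = e'.f i ≫ g := by
    rw [← Category.assoc, idem_f idem']
  let q (i : ℕ) : coconeX X Y i ⟶ coconeX X Y i := coconeMapX X Y X Y e e' (fun _ => 0) i
  have q1 (i : ℕ) {T : 𝒞} (g : coconeX X Y i ⟶ T) :
      coconeInl X Y i ≫ q i ≫ g = e.f i ≫ coconeInl X Y i ≫ g := by
    by_cases hi : i ≤ n
    · cases i <;> simp [q, coconeMapX, coconeInl_fst_assoc X Y hi, coconeInl_snd_assoc]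
    · obtain ⟨i, rfl⟩ : ∃ k, i = k + 1 := ⟨i - 1, by omega⟩
      simp [coconeInl, hi]
  have q2 (i : ℕ) {T : 𝒞} (g : coconeX X Y (i + 1) ⟶ T) :
      coconeInr X Y i ≫ q (i + 1) ≫ g = e'.f i ≫ coconeInr X Y i ≫ g := by
    by_cases hi : i ≤ n
    · simp [q, coconeMapX, coconeInr_fst_assoc, coconeInr_snd_assoc X Y hi]
    · simp [coconeInr, show ¬ i + 1 ≤ n by omega, show ¬ i = n by omega]
  have q1' (i : ℕ) : coconeInl X Y i ≫ q i = e.f i ≫ coconeInl X Y i := by simpa using q1 i (𝟙 _)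
  have q2' (i : ℕ) : coconeInr X Y i ≫ q (i + 1) = e'.f i ≫ coconeInr X Y i := by
    simpa using q2 i (𝟙 _)
  have q3 (i : ℕ) {T : 𝒞} (g : X.K.X i ⟶ T) :
      q i ≫ coconeFst X Y i ≫ g = coconeFst X Y i ≫ e.f i ≫ g := by
    by_cases hi : i ≤ n
    · cases i <;> simp [q, coconeMapX, coconeInl_fst_assoc X Y hi, coconeInr_fst_assoc]
    · obtain ⟨i, rfl⟩ : ∃ k, i = k + 1 := ⟨i - 1, by omega⟩
      simp [coconeFst, hi]
  have q4 (i : ℕ) {T : 𝒞} (g : Y.K.X i ⟶ T) :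
      q (i + 1) ≫ coconeSnd X Y i ≫ g = coconeSnd X Y i ≫ e'.f i ≫ g := by
    by_cases hi : i ≤ n
    · simp [q, coconeMapX, coconeInl_snd_assoc, coconeInr_snd_assoc X Y hi]
    · simp [coconeSnd, show ¬ i + 1 ≤ n by omega, show ¬ i = n by omega]
  have q5 : coconeFst X Y 0 ≫ e.f 0 ≫ coconeInl X Y 0 = q 0 := by
    simp [q, coconeMapX]
  have q6 (i : ℕ) : coconeFst X Y (i + 1) ≫ e.f (i + 1) ≫ coconeInl X Y (i + 1) +
      coconeSnd X Y i ≫ e'.f i ≫ coconeInr X Y i = q (i + 1) := by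
    simp [q, coconeMapX]
  have hqq (i : ℕ) : q i ≫ q i = q i := by
    rcases i with _ | i
    · apply coconeX_hom_ext_zero
      rw [q1, q1', ea]
    · apply coconeX_hom_ext_succ
      · rw [q1, q1', ea]
      · rw [q2, q2', ea']
  let E : (X.cocone Y f).K ⟶ (X.cocone Y f).K :=
    coconeMap X Y X Y f f e e' (fun _ => 0) rfl (by rw [nullMap_zero, zero_add, hf])
  have idemE : E ≫ E = E := by
    ext i
    exact hqq i
  have hE : (X.cocone Y f).IsLift (X.cocone Y f) E A.p (e'.f n) :=
    isLift_coconeMap _ _ _ _ _ _ _ _ _ _ _ he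
  refine ⟨E, idemE, hE, htpyEquiv_cocone _ _ _ _
    (fun i => ⟨(e.f i ≫ coconeInl X Y i : X.K.X i ⟶ coconeX X Y i), ?_⟩)
    (fun i => ⟨(e'.f i ≫ coconeInr X Y i : Y.K.X i ⟶ coconeX X Y (i + 1)), ?_⟩)
    (fun i => ⟨(coconeFst X Y i ≫ e.f i : coconeX X Y i ⟶ X.K.X i), ?_⟩)
    (fun i => ⟨(coconeSnd X Y i ≫ e'.f i : coconeX X Y (i + 1) ⟶ Y.K.X i), ?_⟩)
    ?_ ?_ ?_ ?_ ?_ ?_ ?_ ?_ ?_ ?_ ?_⟩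
  · have : e.f i ≫ (e.f i ≫ coconeInl X Y i) ≫ q i = e.f i ≫ coconeInl X Y i := by
      simp [q1', ea]
    exact this
  · have : e'.f i ≫ (e'.f i ≫ coconeInr X Y i) ≫ q (i + 1) = e'.f i ≫ coconeInr X Y i := by
      simp [q2', ea']
    exact this
  · have : q i ≫ (coconeFst X Y i ≫ e.f i) ≫ e.f i = coconeFst X Y i ≫ e.f i := by
      simp [q3, idem_f idem]
    exact this
  · have : q (i + 1) ≫ (coconeSnd X Y i ≫ e'.f i) ≫ e'.f i = coconeSnd X Y i ≫ e'.f i := by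
      simp [q4, idem_f idem']
    exact this
  · intro i hi
    have : (e.f i ≫ coconeInl X Y i) ≫ coconeFst X Y i ≫ e.f i = e.f i := by
      simp [coconeInl_fst_assoc X Y hi, idem_f idem]
    exact Karoubi.hom_ext _ _ this
  · intro i
    have : (e.f (i + 1) ≫ coconeInl X Y (i + 1)) ≫ coconeSnd X Y i ≫ e'.f i = 0 := by
      simp [coconeInl_snd_assoc]
    exact Karoubi.hom_ext _ _ this
  · intro i
    have : (e'.f i ≫ coconeInr X Y i) ≫ coconeFst X Y (i + 1) ≫ e.f (i + 1) = 0 := by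
      simp [coconeInr_fst_assoc]
    exact Karoubi.hom_ext _ _ this
  · intro i hi
    have : (e'.f i ≫ coconeInr X Y i) ≫ coconeSnd X Y i ≫ e'.f i = e'.f i := by
      simp [coconeInr_snd_assoc X Y hi, idem_f idem']
    exact Karoubi.hom_ext _ _ this
  · have : e.f (n + 1) ≫ coconeInl X Y (n + 1) = 0 := by simp [coconeInl_last]
    exact Karoubi.hom_ext _ _ this
  · have : (coconeFst X Y 0 ≫ e.f 0) ≫ (e.f 0 ≫ coconeInl X Y 0) = q 0 := by
      rw [Category.assoc, ea, q5]
    exact Karoubi.hom_ext _ _ this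
  · intro i hi
    have : (coconeFst X Y (i + 1) ≫ e.f (i + 1)) ≫ (e.f (i + 1) ≫ coconeInl X Y (i + 1)) +
        (coconeSnd X Y i ≫ e'.f i) ≫ (e'.f i ≫ coconeInr X Y i) = q (i + 1) := by
      simp only [Category.assoc, ea, ea', q6]
    exact Karoubi.hom_ext _ _ this
  · intro i hi
    have : (e.f i ≫ coconeInl X Y i) ≫ q i ≫ coconeD X Y f i =
        (e.f i ≫ X.K.d i (i + 1)) ≫ e.f (i + 1) ≫ coconeInl X Y (i + 1) +
          (e.f i ≫ f.f i) ≫ e'.f i ≫ coconeInr X Y i := by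
      rw [Category.assoc, q1, ea, coconeInl_d X Y f hi, Preadditive.comp_add, Category.assoc,
        ← HomologicalComplex.Hom.comm_assoc, ea, Category.assoc, hff, ea]
    rw [← cocone_d] at this
    exact Karoubi.hom_ext _ _ this
  · intro i hi
    have : (e'.f i ≫ coconeInr X Y i) ≫ q (i + 1) ≫ coconeD X Y f (i + 1) =
        -(e'.f i ≫ Y.K.d i (i + 1)) ≫ e'.f (i + 1) ≫ coconeInr X Y (i + 1) := by
      rw [Category.assoc, q2, ea', coconeInr_d X Y f hi.le, Preadditive.comp_neg, Category.assoc,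
        ← HomologicalComplex.Hom.comm_assoc, ea']
    rw [← cocone_d] at this
    exact Karoubi.hom_ext _ _ this
  · have (h : coconeX X Y 0 = A.X) : (e.f 0 ≫ coconeInl X Y 0) ≫ eqToHom h ≫ A.p =
        eqToHom X.left ≫ A.p := by
      simp [coconeInl, he.f_zero]
    exact Karoubi.hom_ext _ _ ((congrArg (fun x : coconeX X Y 0 ⟶ A.X =>
      (e.f 0 ≫ coconeInl X Y 0) ≫ x) (karoubiComplex_eqToHom_left
        (C := (karoubiComplex Y e' idem' he').K.X n) _ E idemE hE)).trans
      ((this _).trans (karoubiComplex_eqToHom_left X e idem he).symm))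
  · have (h : coconeX X Y (n + 1) = Y.K.X n) :
        (e'.f n ≫ coconeInr X Y n) ≫ eqToHom h ≫ e'.f n = e'.f n := by
      simp [coconeInr, idem_f idem']
    exact Karoubi.hom_ext _ _ ((congrArg (fun x : coconeX X Y (n + 1) ⟶ Y.K.X n =>
      (e'.f n ≫ coconeInr X Y n) ≫ x) (karoubiComplex_eqToHom_right
        (C := (karoubiComplex Y e' idem' he').K.X n) _ E idemE hE)).trans (this _))

end KaroubiCone

/-! ### Good lifts over the idempotent completion -/

section GoodLifts

open NComplex

variable {𝒞 : Type u} [Category.{v} 𝒞] [Preadditive 𝒞] {n : ℕ} {A B C D : Karoubi 𝒞}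

/-- A lift `f` of a pair of morphisms of the idempotent completion is homotopic to its diagonal part
`e f e' + (1 - e) f (1 - e')`, which commutes with the idempotents. -/
lemma exists_diagonal_lift {X : NComplex n A.X C.X} {Y : NComplex n B.X D.X}
    {e : X.K ⟶ X.K} (idem : e ≫ e = e) (he : X.IsLift X e A.p C.p) (H : Homotopy e (𝟙 _))
    {e' : Y.K ⟶ Y.K} (idem' : e' ≫ e' = e') (he' : Y.IsLift Y e' B.p D.p) (H' : Homotopy e' (𝟙 _))
    {f : X.K ⟶ Y.K} {a : A.X ⟶ B.X} {c : C.X ⟶ D.X} (ha : A.p ≫ a = a ≫ B.p)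
    (hc : C.p ≫ c = c ≫ D.p) (hf : X.IsLift Y f a c) :
    ∃ f' : X.K ⟶ Y.K, X.IsLift Y f' a c ∧ f' ≫ e' = e ≫ f' ∧ Nonempty (Homotopy f f') := by
  have hd {P Q : 𝒞} {p : P ⟶ P} {q : Q ⟶ Q} {x : P ⟶ Q} (hq : q ≫ q = q) (hx : p ≫ x = x ≫ q) :
      p ≫ x ≫ q + (𝟙 P - p) ≫ x ≫ (𝟙 Q - q) = x := by
    have e1 : p ≫ x ≫ q = x ≫ q := by rw [← Category.assoc, hx, Category.assoc, hq]
    simp [e1, hx]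
  refine ⟨e ≫ f ≫ e' + (𝟙 _ - e) ≫ f ≫ (𝟙 _ - e'),
    ((he.comp (hf.comp he')).add (((IsLift.id X).sub he).comp
      (hf.comp ((IsLift.id Y).sub he')))).congr (hd B.idem ha) (hd D.idem hc), ?_, ?_⟩
  · have ee {K : CochainComplex 𝒞 ℕ} (g : X.K ⟶ K) : e ≫ e ≫ g = e ≫ g := by
      rw [← Category.assoc, idem]
    simp [idem', ee]
  · obtain ⟨K⟩ := homotopy_sub (Homotopy.refl (𝟙 X.K)) H
    obtain ⟨K'⟩ := homotopy_sub (Homotopy.refl (𝟙 Y.K)) H'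
    have G1 := H.comp ((Homotopy.refl f).comp H')
    have G2 := K.comp ((Homotopy.refl f).comp K')
    exact ⟨((G1.add G2).trans (Homotopy.ofEq (by simp))).symm⟩

namespace IsNExangulated

variable [HasFiniteBiproducts 𝒞] {E : 𝒞ᵒᵖ ⥤ 𝒞 ⥤ AddCommGrpCat.{w}} [NeZero n] {s : Assignment E n}
  (h : IsNExangulated E s)

include h

lemma karoubi_exists_good_lift (δ : Extn (karoubiE E) D A) (c : C ⟶ D) (Y : NComplex n A C)
    (hY : Y ∈ karoubiRealisation s (pull (karoubiE E) c δ)) (X : NComplex n A D)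
    (hX : X ∈ karoubiRealisation s δ) :
    ∃ f : Y.K ⟶ X.K, Y.IsLift X f (𝟙 A) c ∧
      Y.cone X f ∈ karoubiRealisation s (push (karoubiE E) Y.ι δ) := by
  obtain ⟨X₀, e, idem, he, hX₀, ⟨H⟩, -⟩ := h.exists_karoubiComplex (pull (karoubiE E) c δ)
  obtain ⟨Y₀, e', idem', he', hY₀, ⟨H'⟩, -⟩ := h.exists_karoubiComplex δ
  obtain ⟨f, hf, hcone⟩ := h.exists_good_lift (underlying E δ) c.f X₀ hX₀ Y₀ hY₀
  obtain ⟨f', hf', hfe, ⟨K⟩⟩ := exists_diagonal_lift idem he H idem' he' H' (by simp) (by simp) hf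
  have hcone' := h.cone_mem h.additive_snd (underlying E δ) c.f hX₀ hX₀ hY₀ hf hf' hcone
    (IsLift.id _) (IsLift.id _) (IsLift.id _) (IsLift.id _) (Homotopy.ofEq (by simp))
    ((Homotopy.ofEq (by simp)).trans (K.symm.trans (Homotopy.ofEq (by simp))))
    ((Homotopy.ofEq (by simp)).trans (K.trans (Homotopy.ofEq (by simp))))
  have hef : e ≫ (e ≫ f') ≫ e' = e ≫ f' := by
    rw [Category.assoc, hfe, ← Category.assoc e e f', idem, ← Category.assoc, idem]
  obtain ⟨ε, idemε, hε, hequiv⟩ := exists_htpyEquiv_cone_karoubi X₀ e idem he Y₀ e' idem' he' f' hfe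
    hef
  have hmem := karoubiComplex_mem (s := s)
    (δ := push (karoubiE E) (karoubiComplex X₀ e idem he).ι δ) (X := X₀.cone Y₀ f') (by
      have h1 : push E X₀.ι (underlying E δ) = push E (A.p ≫ X₀.ι) (underlying E δ) := by
        rw [← push_push, push_underlying]
      rw [underlying_push, karoubiComplex_ι_f]
      exact h1 ▸ hcone') ε idemε hε
  refine h.karoubi_isExactRealisation.exists_cone_mem (karoubiE_additive_snd h.additive_snd) δ c
    (karoubiComplex_mem hX₀ e idem he) hY (karoubiComplex_mem hY₀ e' idem' he') hX ?_
    (h.karoubi_isExactRealisation.mem_of_htpyEquiv hmem hequiv.symm)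
  exact isLift_karoubiHom _ _ _ _ _ _ _ _ _ _ ((he.comp hf').congr (by simp) (by simp))

lemma karoubi_exists_good_lift_op (δ : Extn (karoubiE E) C A) (a : A ⟶ B) (X : NComplex n A C)
    (hX : X ∈ karoubiRealisation s δ) (Y : NComplex n B C)
    (hY : Y ∈ karoubiRealisation s (push (karoubiE E) a δ)) :
    ∃ f : X.K ⟶ Y.K, X.IsLift Y f a (𝟙 C) ∧
      X.cocone Y f ∈ karoubiRealisation s (pull (karoubiE E) Y.π δ) := by
  obtain ⟨X₀, e, idem, he, hX₀, ⟨H⟩, -⟩ := h.exists_karoubiComplex δ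
  obtain ⟨Y₀, e', idem', he', hY₀, ⟨H'⟩, -⟩ := h.exists_karoubiComplex (push (karoubiE E) a δ)
  obtain ⟨f, hf, hcocone⟩ := h.exists_good_lift_op (underlying E δ) a.f X₀ hX₀ Y₀ hY₀
  obtain ⟨f', hf', hfe, ⟨K⟩⟩ := exists_diagonal_lift idem he H idem' he' H' (by simp) (by simp) hf
  have hcocone' := h.cocone_mem h.additive_fst (underlying E δ) a.f hX₀ hY₀ hY₀ hf hf' hcocone
    (IsLift.id _) (IsLift.id _) (IsLift.id _) (IsLift.id _) (Homotopy.ofEq (by simp))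
    ((Homotopy.ofEq (by simp)).trans (K.symm.trans (Homotopy.ofEq (by simp))))
    ((Homotopy.ofEq (by simp)).trans (K.trans (Homotopy.ofEq (by simp))))
  have hef : e ≫ (e ≫ f') ≫ e' = e ≫ f' := by
    rw [Category.assoc, hfe, ← Category.assoc e e f', idem, ← Category.assoc, idem]
  obtain ⟨ε, idemε, hε, hequiv⟩ := exists_htpyEquiv_cocone_karoubi X₀ e idem he Y₀ e' idem' he' f'
    hfe hef
  have hmem := karoubiComplex_mem (s := s)
    (δ := pull (karoubiE E) (karoubiComplex Y₀ e' idem' he').π δ) (X := X₀.cocone Y₀ f') (by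
      have h1 : pull E Y₀.π (underlying E δ) = pull E (Y₀.π ≫ C.p) (underlying E δ) := by
        rw [← pull_pull, pull_underlying]
      rw [underlying_pull, karoubiComplex_π_f]
      exact h1 ▸ hcocone') ε idemε hε
  refine h.karoubi_isExactRealisation.exists_cocone_mem (karoubiE_additive_fst h.additive_fst) δ a
    (karoubiComplex_mem hX₀ e idem he) hX (karoubiComplex_mem hY₀ e' idem' he') hY ?_
    (h.karoubi_isExactRealisation.mem_of_htpyEquiv hmem hequiv.symm)
  exact isLift_karoubiHom _ _ _ _ _ _ _ _ _ _ ((he.comp hf').congr (by simp) (by simp))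

/-- The idempotent completion of an `n`-exangulated category is `n`-exangulated. -/
lemma karoubi : IsNExangulated (karoubiE E) (karoubiRealisation s) where
  toIsExactRealisation := h.karoubi_isExactRealisation
  additive_fst := karoubiE_additive_fst h.additive_fst
  additive_snd := karoubiE_additive_snd h.additive_snd
  inflation_comp _ _ _ f g hf hg := h.karoubi_inflation_comp f g hf hg
  deflation_comp _ _ _ f g hf hg := h.karoubi_deflation_comp f g hf hg
  exists_good_lift _ _ _ δ c Y hY X hX := h.karoubi_exists_good_lift δ c Y hY X hX
  exists_good_lift_op _ _ _ δ a X hX Y hY := h.karoubi_exists_good_lift_op δ a X hX Y hY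

end IsNExangulated

end GoodLifts

end

end NExangulated

theorem theorem4p17 {𝒞 : Type u} [Category.{v} 𝒞] [Preadditive 𝒞] [HasFiniteBiproducts 𝒞]
    (n : ℕ) [NeZero n] (E : 𝒞ᵒᵖ ⥤ 𝒞 ⥤ AddCommGrpCat.{w}) (s : NExangulated.Assignment E n)
    (h : NExangulated.IsNExangulated E s) :
    NExangulated.IsNExangulated (NExangulated.karoubiE E) (NExangulated.karoubiRealisation s) ∧
      IsIdempotentComplete (Karoubi 𝒞) ∧
      ∀ (A C : Karoubi 𝒞) (δ : NExangulated.Extn (NExangulated.karoubiE E) C A)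
        (X : NExangulated.NComplex n A.X C.X), X ∈ s (NExangulated.underlying E δ) →
        ∃ (e : X.K ⟶ X.K) (idem : e ≫ e = e) (he : X.IsLift X e A.p C.p),
          NExangulated.karoubiRealisation s δ =
            (NExangulated.karoubiComplex X e idem he).cls := by
  refine ⟨h.karoubi, inferInstance, fun A C δ X hX => ?_⟩
  obtain ⟨e, idem, he, -⟩ := h.exists_idempotent δ hX
  exact ⟨e, idem, he, h.karoubiRealisation_eq hX e idem he⟩
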